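/- Let $p \ge 3$ be an integer and let $G = BS(1,p)$ be the solvable Baumslag–Solitar group with the presentation $\langle a,t \mid tat^{-1}=a^p\rangle$; words are taken over $A=\{a^{\pm1},t^{\pm1}\}$, and the relators are all cyclic permutations of $tat^{-1}a^{-p}$ and of its inverse. Then $G$ has, over this presentation, an intrinsic tame filling function that is exponential, i.e. Lipschitz equivalent to $n \mapsto p^n$. Definitions. Write $\mathbb N[\frac14]=\{0,\frac14,\frac24,\dots\}$. In a combinatorial 2-complex $Y$ with basepoint vertex $y$, the coarse distance $\tilde d_Y(y,q)$ is the path-metric distance in the 1-skeleton $Y^{(1)}$ if $q$ is a vertex; it is $\min\{\tilde d_Y(y,v) : v\in\partial e\}+\frac12$ if $q$ is in the interior of an edge $e$; and it is $\max\{\tilde d_Y(y,q'): q'\in\partial\sigma\setminus Y^{(0)}\}-\frac14$ if $q$ is in the interior of a 2-cell $\sigma$. A van Kampen diagram $\Delta$ for a word $w$ is a finite planar contractible combinatorial 2-complex with directed edges labelled by letters of $A$ and a basepoint vertex $*$, whose 2-cell boundaries are labelled by relators and whose boundary path, read counterclockwise from $*$, is labelled by $w$. A 1-combing of $(\Delta,\partial\Delta)$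 at $*$ is a continuous map $\Psi:\partial\Delta\times[0,1]\to\Delta$ with $\Psi(q,0)=*$ and $\Psi(q,1)=q$ for all $q\in\partial\Delta$, with $\Psi(*,s)=*$ for all $s$, and with $\Psi(q,s)\in\Delta^{(1)}$ for all $s$ whenever $q$ is a vertex. A nondecreasing $f:\mathbb N[\frac14]\to\mathbb N[\frac14]$ is an intrinsic tame filling function for $G$ over the presentation if for every word $w$ over $A$ representing the identity of $G$ there are a van Kampen diagram $\Delta$ for $w$ and a 1-combing $\Psi$ of $(\Delta,\partial\Delta)$ at $*$ with $\tilde d_\Delta(*,\Psi(q,s))\le f(\tilde d_\Delta(*,\Psi(q,s')))$ for all $q\in\partial\Delta$ and $0\le s<s'\le1$. Functions $f,g$ on $\mathbb N[\frac14]$ are Lipschitz equivalent if there is a constant $C\in\mathbb N$ with $f(n)\le C\,g(Cn+C)+C$ and $g(n)\le C\,f(Cn+C)+C$ for all $n$. -/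

import Mathlib

noncomputable section

namespace TameFilling

open scoped unitInterval

/-! ### The number set `ℕ[1/4]` and Lipschitz equivalence -/

/-- `ℕ[1/4] = {n / 4 : n = 0, 1, 2, …}`, the set in which coarse distances take their values. -/
abbrev QuarterNat : Type := {x : ℝ // ∃ n : ℕ, x = (n : ℝ) / 4}

/-- The element `C * n + C` of `ℕ[1/4]`, for a constant `C` and `n ∈ ℕ[1/4]`. -/
def QuarterNat.affine (C : ℕ) (x : QuarterNat) : QuarterNat :=
  ⟨C * x.1 + C, by
    obtain ⟨x, n, rfl⟩ := x
    exact ⟨C * n + 4 * C, by push_cast; ring⟩⟩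

/-- Lipschitz equivalence of functions on `ℕ[1/4]`: there is a constant `C` with
`f n ≤ C * g (C n + C) + C` and `g n ≤ C * f (C n + C) + C` for all `n`. -/
def LipschitzEquivalent (f g : QuarterNat → ℝ) : Prop :=
  ∃ C : ℕ, ∀ n : QuarterNat,
    f n ≤ C * g (QuarterNat.affine C n) + C ∧ g n ≤ C * f (QuarterNat.affine C n) + C

/-! ### Combinatorial 2-complexes -/

/-- A combinatorial 2-complex: a set `V` of vertices, a set `D` of directed edges with a
fixed-point-free reversal `inv` (an undirected edge is a pair `{d, inv d}`) and a set `F` of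
2-cells, each of which is a polygon glued along a nonempty closed edge path `bd f`. -/
structure TwoComplex where
  V : Type
  D : Type
  F : Type
  src : D → V
  inv : D → D
  inv_inv : ∀ d, inv (inv d) = d
  inv_ne : ∀ d, inv d ≠ d
  bd : F → List D
  bd_ne_nil : ∀ f, bd f ≠ []
  bd_closed : ∀ (f : F) (i : ℕ) (hi : i < (bd f).length),
    src (inv ((bd f)[i])) = src ((bd f)[(i + 1) % (bd f).length]'(Nat.mod_lt _ (by omega)))

namespace TwoComplex

variable (Y : TwoComplex)

/-- The terminal vertex of a directed edge. -/
def tgt (d : Y.D) : Y.V := Y.src (Y.inv d)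

/-- The simple graph underlying the 1-skeleton; its graph distance is the path metric of the
1-skeleton restricted to the vertices. -/
def graph : SimpleGraph Y.V where
  Adj u v := u ≠ v ∧ ∃ d, Y.src d = u ∧ Y.tgt d = v
  symm := ⟨by
    rintro u v ⟨h, d, rfl, rfl⟩
    exact ⟨h.symm, Y.inv d, rfl, by rw [tgt, Y.inv_inv]⟩⟩
  loopless := ⟨fun _ h => h.1 rfl⟩

/-- The closed unit disc. -/
abbrev Disc : Type := Metric.closedBall (0 : ℂ) 1

/-- The disjoint union of the closed cells: a point for each vertex, an interval for each directed
edge, a closed disc for each 2-cell. -/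
abbrev Cells : Type := (Σ _ : Y.V, Unit) ⊕ (Σ _ : Y.D, I) ⊕ (Σ _ : Y.F, Disc)

/-- The point with parameter `s` on the `i`-th side of the polygon with `n` sides, whose boundary
is the unit circle divided into `n` equal arcs. -/
def sidePoint (n i : ℕ) (s : I) : Disc :=
  ⟨Complex.exp (2 * Real.pi * Complex.I * (((i : ℂ) + ((s : ℝ) : ℂ)) / n)), by
    have h : (2 * Real.pi * Complex.I * (((i : ℂ) + ((s : ℝ) : ℂ)) / n))
        = ((2 * Real.pi * (((i : ℝ) + (s : ℝ)) / n) : ℝ) : ℂ) * Complex.I := by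
      push_cast; ring
    rw [mem_closedBall_zero_iff, h, Complex.norm_exp_ofReal_mul_I]⟩

variable {Y} in
/-- The gluing of the cells: the ends of an edge are its end vertices, `d` and `inv d` are the same
edge with opposite directions, and the sides of a polygon are glued to the edges on its boundary
path. -/
inductive Glue : Y.Cells → Y.Cells → Prop
  | start (d : Y.D) : Glue (.inr (.inl ⟨d, 0⟩)) (.inl ⟨Y.src d, ()⟩)
  | reverse (d : Y.D) (s : I) :
      Glue (.inr (.inl ⟨d, s⟩)) (.inr (.inl ⟨Y.inv d, unitInterval.symm s⟩))
  | side (f : Y.F) (i : ℕ) (hi : i < (Y.bd f).length) (s : I) :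
      Glue (.inr (.inr ⟨f, sidePoint (Y.bd f).length i s⟩)) (.inr (.inl ⟨(Y.bd f)[i], s⟩))

/-- The geometric realization of a 2-complex, with the quotient topology. -/
def Realization : Type := Quot (Glue (Y := Y))

instance : TopologicalSpace Y.Realization :=
  inferInstanceAs (TopologicalSpace (Quot (Glue (Y := Y))))

/-- The point of the realization given by a vertex. -/
def vertexPt (v : Y.V) : Y.Realization := Quot.mk _ (.inl ⟨v, ()⟩)

/-- The point with parameter `s` of a directed edge. -/
def edgePt (d : Y.D) (s : I) : Y.Realization := Quot.mk _ (.inr (.inl ⟨d, s⟩))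

/-- The point with position `z` of a 2-cell. -/
def facePt (f : Y.F) (z : Disc) : Y.Realization := Quot.mk _ (.inr (.inr ⟨f, z⟩))

/-- The 0-skeleton. -/
def skeleton0 : Set Y.Realization := Set.range Y.vertexPt

/-- The 1-skeleton. -/
def skeleton1 : Set Y.Realization := Y.skeleton0 ∪ {q | ∃ d s, q = Y.edgePt d s}

/-! ### Coarse distance -/

/-- Coarse distance from `y` to the interior points of an edge. -/
def edgeDist (y : Y.V) (d : Y.D) : ℝ :=
  min (Y.graph.dist y (Y.src d) : ℝ) (Y.graph.dist y (Y.tgt d)) + 1 / 2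

/-- Coarse distance from `y` to the interior points of a 2-cell: the maximum over the edges on its
boundary, minus `1/4`. -/
def faceDist (y : Y.V) (f : Y.F) : ℝ :=
  sSup {x | ∃ d ∈ Y.bd f, x = Y.edgeDist y d} - 1 / 4

/-- Coarse distance from `y` to the point with parameter `s` on the closed edge `d`. -/
def closedEdgeDist (y : Y.V) (d : Y.D) (s : I) : ℝ :=
  if s = 0 then Y.graph.dist y (Y.src d)
  else if s = 1 then Y.graph.dist y (Y.tgt d)
  else Y.edgeDist y d

open Classical in
/-- Coarse distance from `y` to the point `z` of the closed 2-cell `f`; when `z` is on the boundary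
circle, it is the coarse distance to the corresponding point of the boundary path. -/
def closedFaceDist (y : Y.V) (f : Y.F) (z : Disc) : ℝ :=
  if h : ∃ (i : Fin (Y.bd f).length) (s : I), z = sidePoint (Y.bd f).length i s then
    Y.closedEdgeDist y ((Y.bd f)[h.choose]) h.choose_spec.choose
  else Y.faceDist y f

/-- Coarse distance on the disjoint union of the closed cells. -/
def cellsDist (y : Y.V) : Y.Cells → ℝ
  | .inl v => Y.graph.dist y v.1
  | .inr (.inl e) => Y.closedEdgeDist y e.1 e.2
  | .inr (.inr c) => Y.closedFaceDist y c.1 c.2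

lemma closedEdgeDist_one (y : Y.V) (d : Y.D) :
    Y.closedEdgeDist y d 1 = Y.graph.dist y (Y.tgt d) := by
  simp [closedEdgeDist]

lemma closedEdgeDist_zero (y : Y.V) (d : Y.D) :
    Y.closedEdgeDist y d 0 = Y.graph.dist y (Y.src d) := by
  simp [closedEdgeDist]

lemma sidePoint_eq {n i j : ℕ} (hi : i < n) (hj : j < n) {s t : I}
    (h : sidePoint n i s = sidePoint n j t) :
    (i = j ∧ s = t) ∨ (s = 1 ∧ t = 0 ∧ j = (i + 1) % n) ∨
      (s = 0 ∧ t = 1 ∧ i = (j + 1) % n) := by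
  have hn : (n : ℂ) ≠ 0 := by
    have : n ≠ 0 := by omega
    exact_mod_cast this
  have h' := congrArg Subtype.val h
  simp only [sidePoint] at h'
  obtain ⟨k, hk⟩ := Complex.exp_eq_exp_iff_exists_int.mp h'
  have hpi : (2 * Real.pi * Complex.I : ℂ) ≠ 0 := Complex.two_pi_I_ne_zero
  have hk2 : (((i : ℂ) + ((s : ℝ) : ℂ)) / n) = (((j : ℂ) + ((t : ℝ) : ℂ)) / n) + k := by
    apply mul_left_cancel₀ hpi
    rw [hk]; ring
  have hk3 : ((i : ℂ) + ((s : ℝ) : ℂ)) = ((j : ℂ) + ((t : ℝ) : ℂ)) + k * n := by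
    field_simp at hk2
    rw [hk2]; ring
  have hk4 : (i : ℝ) + (s : ℝ) = (j : ℝ) + (t : ℝ) + k * n := by exact_mod_cast hk3
  obtain ⟨s, hs0, hs1⟩ := s
  obtain ⟨t, ht0, ht1⟩ := t
  simp only at hk4
  have hst : ∃ m : ℤ, s = t + m := ⟨j + k * n - i, by push_cast; linarith⟩
  obtain ⟨m, hm⟩ := hst
  have hm1 : (m : ℝ) ≤ 1 := by linarith
  have hm2 : (-1 : ℝ) ≤ m := by linarith
  have hm1' : m ≤ 1 := by exact_mod_cast hm1
  have hm2' : -1 ≤ m := by exact_mod_cast hm2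
  have hint : (i : ℤ) + m = j + k * n := by
    have : (i : ℝ) + m = j + k * n := by linarith
    exact_mod_cast this
  have hk_cases : k = -1 ∨ k = 0 ∨ k = 1 := by
    have hin : (i : ℤ) < n := by exact_mod_cast hi
    have hjn : (j : ℤ) < n := by exact_mod_cast hj
    have h1 : k < 2 := by
      by_contra hc
      push Not at hc
      nlinarith
    have h2 : -2 < k := by
      by_contra hc
      push Not at hc
      nlinarith
    omega
  have hm_cases : m = -1 ∨ m = 0 ∨ m = 1 := by omega
  rcases hm_cases with rfl | rfl | rfl
  · right; right
    push_cast at hm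
    refine ⟨Subtype.ext (by simp; linarith), Subtype.ext (by simp; linarith), ?_⟩
    rcases hk_cases with rfl | rfl | rfl
    · have : j + 1 = n := by omega
      rw [this, Nat.mod_self]; omega
    · rw [Nat.mod_eq_of_lt (by omega)]; omega
    · omega
  · left
    push_cast at hm
    refine ⟨?_, Subtype.ext (by simpa using hm)⟩
    rcases hk_cases with rfl | rfl | rfl <;> omega
  · right; left
    push_cast at hm
    refine ⟨Subtype.ext (by simp; linarith), Subtype.ext (by simp; linarith), ?_⟩
    rcases hk_cases with rfl | rfl | rfl
    · omega
    · rw [Nat.mod_eq_of_lt (by omega)]; omega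
    · have : i + 1 = n := by omega
      rw [this, Nat.mod_self]; omega

lemma closedEdgeDist_side (y : Y.V) (f : Y.F) {i j : ℕ} (hi : i < (Y.bd f).length)
    (hj : j < (Y.bd f).length) {s t : I}
    (h : sidePoint (Y.bd f).length i s = sidePoint (Y.bd f).length j t) :
    Y.closedEdgeDist y ((Y.bd f)[j]) t = Y.closedEdgeDist y ((Y.bd f)[i]) s := by
  rcases sidePoint_eq hi hj h with ⟨h1, h2⟩ | ⟨h1, h2, h3⟩ | ⟨h1, h2, h3⟩
  · subst h1; rw [h2]
  · rw [h1, h2, closedEdgeDist_one, closedEdgeDist_zero, tgt, Y.bd_closed f i hi]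
    simp only [h3]
  · rw [h1, h2, closedEdgeDist_one, closedEdgeDist_zero, tgt, Y.bd_closed f j hj]
    simp only [h3]

lemma closedFaceDist_side (y : Y.V) (f : Y.F) (i : ℕ) (hi : i < (Y.bd f).length) (s : I) :
    Y.closedFaceDist y f (sidePoint (Y.bd f).length i s) =
      Y.closedEdgeDist y ((Y.bd f)[i]) s := by
  have h : ∃ (j : Fin (Y.bd f).length) (t : I),
      sidePoint (Y.bd f).length i s = sidePoint (Y.bd f).length j t := ⟨⟨i, hi⟩, s, rfl⟩
  rw [closedFaceDist, dif_pos h]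
  exact Y.closedEdgeDist_side y f hi h.choose.2 h.choose_spec.choose_spec

lemma norm_sidePoint (n i : ℕ) (s : I) : ‖(sidePoint n i s : ℂ)‖ = 1 := by
  have h : (2 * Real.pi * Complex.I * (((i : ℂ) + ((s : ℝ) : ℂ)) / n))
      = ((2 * Real.pi * (((i : ℝ) + (s : ℝ)) / n) : ℝ) : ℂ) * Complex.I := by
    push_cast; ring
  change ‖Complex.exp _‖ = 1
  rw [h, Complex.norm_exp_ofReal_mul_I]

lemma closedFaceDist_interior (y : Y.V) (f : Y.F) (z : Disc) (hz : ‖(z : ℂ)‖ < 1) :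
    Y.closedFaceDist y f z = Y.faceDist y f := by
  rw [closedFaceDist, dif_neg]
  rintro ⟨i, s, rfl⟩
  rw [norm_sidePoint] at hz
  exact lt_irrefl _ hz

lemma cellsDist_glue (y : Y.V) (a b : Y.Cells) (h : Glue a b) :
    Y.cellsDist y a = Y.cellsDist y b := by
  cases h with
  | start d => exact Y.closedEdgeDist_zero y d
  | reverse d s =>
    simp only [cellsDist, closedEdgeDist, edgeDist, tgt, Y.inv_inv, unitInterval.symm_eq_zero,
      unitInterval.symm_eq_one]
    by_cases h0 : s = 0
    · subst h0; simp
    · by_cases h1 : s = 1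
      · subst h1; simp
      · simp [h0, h1, min_comm]
  | side f i hi s => exact Y.closedFaceDist_side y f i hi s

/-- The coarse distance from the vertex `y` to a point of the realization. -/
def coarseDist (y : Y.V) : Y.Realization → ℝ :=
  Quot.lift (Y.cellsDist y) (Y.cellsDist_glue y)

lemma coarseDist_vertexPt (y v : Y.V) :
    Y.coarseDist y (Y.vertexPt v) = Y.graph.dist y v := rfl

lemma coarseDist_edgePt (y : Y.V) (d : Y.D) (s : I) (h0 : s ≠ 0) (h1 : s ≠ 1) :
    Y.coarseDist y (Y.edgePt d s) = Y.edgeDist y d := by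
  change Y.closedEdgeDist y d s = _
  simp [closedEdgeDist, h0, h1]

lemma coarseDist_facePt (y : Y.V) (f : Y.F) (z : Disc) (hz : ‖(z : ℂ)‖ < 1) :
    Y.coarseDist y (Y.facePt f z) = Y.faceDist y f :=
  Y.closedFaceDist_interior y f z hz

lemma edgeDist_quarter (y : Y.V) (d : Y.D) :
    ∃ n : ℕ, Y.edgeDist y d = ((n + 1 : ℕ) : ℝ) / 4 := by
  refine ⟨4 * min (Y.graph.dist y (Y.src d)) (Y.graph.dist y (Y.tgt d)) + 1, ?_⟩
  rw [edgeDist]; push_cast; ring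

lemma closedEdgeDist_quarter (y : Y.V) (d : Y.D) (s : I) :
    ∃ n : ℕ, Y.closedEdgeDist y d s = (n : ℝ) / 4 := by
  unfold closedEdgeDist
  split_ifs
  · exact ⟨4 * Y.graph.dist y (Y.src d), by push_cast; ring⟩
  · exact ⟨4 * Y.graph.dist y (Y.tgt d), by push_cast; ring⟩
  · obtain ⟨n, hn⟩ := Y.edgeDist_quarter y d
    exact ⟨n + 1, hn⟩

lemma faceDist_quarter (y : Y.V) (f : Y.F) :
    ∃ n : ℕ, Y.faceDist y f = (n : ℝ) / 4 := by
  have hfin : {x | ∃ d ∈ Y.bd f, x = Y.edgeDist y d}.Finite := by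
    have : {x | ∃ d ∈ Y.bd f, x = Y.edgeDist y d} = Y.edgeDist y '' {d | d ∈ Y.bd f} := by
      ext x; simp [eq_comm]
    rw [this]
    exact (List.finite_toSet (Y.bd f)).image _
  obtain ⟨d, hd⟩ := List.exists_mem_of_ne_nil _ (Y.bd_ne_nil f)
  have hne : {x | ∃ d ∈ Y.bd f, x = Y.edgeDist y d}.Nonempty := ⟨_, d, hd, rfl⟩
  obtain ⟨d', _, h⟩ := hne.csSup_mem hfin
  obtain ⟨n, hn⟩ := Y.edgeDist_quarter y d'
  refine ⟨n, ?_⟩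
  rw [faceDist, h, hn]; push_cast; ring

/-- Coarse distances are elements of `ℕ[1/4]`. -/
lemma coarseDist_quarter (y : Y.V) (q : Y.Realization) :
    ∃ n : ℕ, Y.coarseDist y q = (n : ℝ) / 4 := by
  induction q using Quot.ind with
  | mk a =>
    change ∃ n : ℕ, Y.cellsDist y a = (n : ℝ) / 4
    rcases a with v | e | c
    · exact ⟨4 * Y.graph.dist y v.1, by simp only [cellsDist]; push_cast; ring⟩
    · exact Y.closedEdgeDist_quarter y e.1 e.2
    · simp only [cellsDist, closedFaceDist]
      split_ifs
      · exact Y.closedEdgeDist_quarter y _ _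
      · exact Y.faceDist_quarter y c.1

/-! ### 1-combings and tameness -/

/-- `ψ` is a 1-combing of the pair `(Y, Z)` at the basepoint `y`. -/
structure IsOneCombing (Z : Set Y.Realization) (y : Y.V) (ψ : Z × I → Y.Realization) :
    Prop where
  continuous : Continuous ψ
  start : ∀ p : Z, ψ (p, 0) = Y.vertexPt y
  finish : ∀ p : Z, ψ (p, 1) = p
  base : ∀ p : Z, (p : Y.Realization) = Y.vertexPt y → ∀ t : I, ψ (p, t) = Y.vertexPt y
  vertex : ∀ p : Z, (p : Y.Realization) ∈ Y.skeleton0 → ∀ t : I, ψ (p, t) ∈ Y.skeleton1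

/-- `ψ` is `f`-tame with respect to coarse distance from `y`. -/
def IsTame (f : QuarterNat → QuarterNat) {Z : Set Y.Realization} (y : Y.V)
    (ψ : Z × I → Y.Realization) : Prop :=
  ∀ (p : Z) (s t : I), s < t →
    Y.coarseDist y (ψ (p, s)) ≤
      f ⟨Y.coarseDist y (ψ (p, t)), Y.coarseDist_quarter y (ψ (p, t))⟩

end TwoComplex

/-! ### Van Kampen diagrams -/

/-- Words over the letters `x` (as `(x, true)`) and `x⁻¹` (as `(x, false)`), for `x : α`. -/
abbrev Word (α : Type) : Type := List (α × Bool)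

/-- The symmetrized set of relators: all cyclic permutations of the words in `S` and of their
formal inverses. -/
def symmetrize {α : Type} (S : Set (Word α)) : Set (Word α) :=
  {u | ∃ r ∈ S, List.IsRotated r u ∨ List.IsRotated (FreeGroup.invRev r) u}

/-- A van Kampen diagram for the word `w` over the presentation `⟨α | S⟩`: a finite planar
contractible combinatorial 2-complex with a basepoint and with directed edges labelled by letters,
in which 2-cells are labelled by relators and the boundary path, starting at the basepoint, is
labelled by `w`.

Planarity and contractibility are expressed by a planar map: a connected combinatorial map on the
sphere (genus `0` by Euler's formula) whose regions are the 2-cells and one further region, the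
complement of the diagram. Each directed edge `d` has exactly one region on its right, and `next d`
is the edge following `d` on the walk around that region. So the walk around the outer region, which
is the boundary path, goes counterclockwise around the diagram. The edges leaving a vertex form one
cycle of the rotation `d ↦ next (inv d)`. -/
structure VanKampenDiagram {α : Type} (S : Set (Word α)) (w : Word α) extends TwoComplex where
  finite_V : Finite V
  finite_D : Finite D
  finite_F : Finite F
  base : V
  label : D → α × Bool
  label_inv : ∀ d, label (inv d) = ((label d).1, !(label d).2)
  label_bd : ∀ f, (bd f).map label ∈ symmetrize S
  /-- the boundary path -/
  boundary : List D
  boundary_start : ∀ d ∈ boundary.head?, src d = base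
  boundary_label : boundary.map label = w
  next : Equiv.Perm D
  /-- the region on the right of a directed edge; `none` is the outer region -/
  region : D → Option F
  src_next : ∀ d, src (next d) = src (inv d)
  bd_nodup : ∀ f, (bd f).Nodup
  mem_bd : ∀ f d, d ∈ bd f ↔ region d = some f
  next_bd : ∀ (f : F) (i : ℕ) (hi : i < (bd f).length),
    next ((bd f)[i]) = (bd f)[(i + 1) % (bd f).length]'(Nat.mod_lt _ (by omega))
  boundary_nodup : boundary.Nodup
  mem_boundary : ∀ d, d ∈ boundary ↔ region d = none
  next_boundary : ∀ (i : ℕ) (hi : i < boundary.length),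
    next (boundary[i]) = boundary[(i + 1) % boundary.length]'(Nat.mod_lt _ (by omega))
  rotation : ∀ d d', src d = src d' →
    Equiv.Perm.SameCycle ((Function.Involutive.toPerm inv inv_inv).trans next) d d'
  connected : toTwoComplex.graph.Connected
  /-- `|V| - |E| + (|F| + 1) = 2`, where `|D| = 2 |E|` -/
  euler : 2 * Nat.card V + 2 * Nat.card F = Nat.card D + 2

namespace VanKampenDiagram

variable {α : Type} {S : Set (Word α)} {w : Word α} (Δ : VanKampenDiagram S w)

/-- The boundary `∂Δ`, a subcomplex of the 1-skeleton: the basepoint and all the edges on the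
boundary path. -/
def boundarySet : Set Δ.Realization :=
  {Δ.vertexPt Δ.base} ∪ {q | ∃ d ∈ Δ.boundary, ∃ s : I, q = Δ.edgePt d s}

end VanKampenDiagram

/-! ### Tame filling functions -/

/-- The group `⟨α | S⟩`. -/
abbrev PresentedBy {α : Type} (S : Set (Word α)) : Type := PresentedGroup (FreeGroup.mk '' S)

/-- The element of `⟨α | S⟩` represented by a word. -/
def wordValue {α : Type} (S : Set (Word α)) (w : Word α) : PresentedBy S :=
  PresentedGroup.mk (FreeGroup.mk '' S) (FreeGroup.mk w)

/-- `f` is an intrinsic tame filling function for the group `⟨α | S⟩` over this presentation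
(with the symmetrized set of relators). -/
def IsIntrinsicTameFillingFunction {α : Type} (S : Set (Word α))
    (f : QuarterNat → QuarterNat) : Prop :=
  Monotone f ∧ ∀ w : Word α, wordValue S w = 1 →
    ∃ (Δ : VanKampenDiagram S w) (ψ : Δ.boundarySet × I → Δ.Realization),
      Δ.IsOneCombing Δ.boundarySet Δ.base ψ ∧ Δ.IsTame f Δ.base ψ

/-! ### Solvable Baumslag–Solitar groups -/

/-- The generators of `BS(1, p)`. -/
inductive BSGen : Type
  | a
  | t

/-- The relator `t a t⁻¹ a⁻ᵖ`. -/
def bsRelator (p : ℕ) : Word BSGen :=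
  [(.t, true), (.a, true), (.t, false)] ++ List.replicate p (.a, false)

/-- The relators of the presentation `⟨a, t | t a t⁻¹ = aᵖ⟩` of `BS(1, p)`. -/
def bsRelators (p : ℕ) : Set (Word BSGen) := {bsRelator p}

/-- The solvable Baumslag–Solitar group `BS(1, p) = ⟨a, t | t a t⁻¹ = aᵖ⟩`. -/
abbrev BS (p : ℕ) : Type := PresentedBy (bsRelators p)

lemma bsRelator_eq (p : ℕ) :
    FreeGroup.mk (bsRelator p) =
      FreeGroup.of BSGen.t * FreeGroup.of BSGen.a * (FreeGroup.of BSGen.t)⁻¹ *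
        (FreeGroup.of BSGen.a ^ p)⁻¹ := by
  have h : ∀ n : ℕ, FreeGroup.mk (List.replicate n (BSGen.a, false)) =
      (FreeGroup.of BSGen.a ^ n)⁻¹ := by
    intro n
    induction n with
    | zero => simp [FreeGroup.one_eq_mk]
    | succ k ih =>
      rw [List.replicate_succ', ← FreeGroup.mul_mk, ih, pow_succ', mul_inv_rev]
      rfl
  rw [bsRelator, ← FreeGroup.mul_mk, h]
  rfl

end TameFilling

end

noncomputable section
namespace TameFilling

open scoped unitInterval

/-! ### Points, invariants and closed sets of the geometric realization -/

namespace TwoComplex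

variable (Y : TwoComplex)

/-! Let a act on ℚ by x ↦ x + 1 and t by x ↦ p x, so that t⁻ⁱ aᵐ tᵏ becomes `aff p i m k`. Give an
element the weight `size`, the least i + |m| + 2 pᵏ over all such expressions. The minimum is
attained at a reduced expression (`size_eq`), and words of length n have weight at most p^(3n+2)
(`size_wordProd_le`).

It suffices to find, for each word w representing 1, a diagram and a combing of its whole 1-skeleton
along which the weight never decreases, such that dist(*, v) + 1 is at most the weight of v for
every vertex v. Here an open edge has the larger weight of its ends, and a 2-cell the largest weight
of its vertices. The coarse distance at an earlier point is then at most the weight there, hence at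
most the weight at a later point. The latter is exponentially bounded by the coarse distance at the
later point, because the labels along a geodesic of the diagram spell a word for its end vertex
(`CombedDiagram.exists_tame`). The diagram need not embed in the Cayley complex; the weight does the
comparison.

Such diagrams (`CombedDiagram`) grow from a point by two moves. An edge may be attached at a
boundary vertex in a direction in which the weight increases; this inserts x x⁻¹ into the boundary
word (`nonempty_addSpike`). A 2-cell may be attached along a boundary segment l if it has one
further edge x and no vertex of l is heavier than both ends of x; this replaces l by x
(`nonempty_addFace'`). The new edge is combed by following the old paths to the points of l and then
crossing the cell.

The rest is a rewriting of words. For every word v there is a reduced word r = t⁻ⁱ aᵐ tᵏ such that r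
v bounds a combed diagram: to pass from v to x v, the two moves turn r into a reduced word for r x⁻¹
followed by x (`hasCombing_step`). If v represents 1, then r is empty
(`hasCombing_of_value_eq_one`). -/

lemma exists_sidePoint {n : ℕ} (hn : 0 < n) (z : Disc) (hz : ‖(z : ℂ)‖ = 1) :
    ∃ (i : Fin n) (s : I), z = sidePoint n i s := by
  obtain ⟨x, hx0, hx1, hx⟩ : ∃ x : ℝ, 0 ≤ x ∧ x < 1 ∧ (z : ℂ) = Complex.exp (2 * Real.pi * Complex.I * x) := by
    have h1 : (z : ℂ) = Complex.exp (Complex.arg z * Complex.I) := by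
      have := Complex.norm_mul_exp_arg_mul_I (z : ℂ)
      rw [hz] at this
      simpa using this.symm
    refine ⟨Int.fract (Complex.arg z / (2 * Real.pi)), Int.fract_nonneg _, Int.fract_lt_one _, ?_⟩
    rw [h1, Complex.exp_eq_exp_iff_exists_int]
    refine ⟨⌊Complex.arg z / (2 * Real.pi)⌋, ?_⟩
    have h2 : (2 * Real.pi : ℂ) ≠ 0 := by
      simp
    rw [← h1, Int.fract]
    push_cast
    field_simp
    ring
  have hn' : (0 : ℝ) < n := by exact_mod_cast hn
  have hx2 : ⌊n * x⌋₊ < n := by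
    rw [Nat.floor_lt (by positivity)]
    nlinarith
  have hf := Nat.floor_le (a := n * x) (by positivity)
  have hf' := Nat.lt_floor_add_one (n * x)
  refine ⟨⟨⌊n * x⌋₊, hx2⟩, ⟨n * x - ⌊n * x⌋₊, by constructor <;> linarith⟩, ?_⟩
  apply Subtype.ext
  simp only [sidePoint, hx]
  congr 2
  have : (n : ℂ) ≠ 0 := by exact_mod_cast hn.ne'
  push_cast
  field_simp
  ring

section lift

variable {Y} {Z : Type*}

/-- Compatible maps on the vertices and edges. -/
structure Compatible (gV : Y.V → Z) (gE : Y.D → I → Z) : Prop where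
  start : ∀ d, gE d 0 = gV (Y.src d)
  reverse : ∀ d s, gE (Y.inv d) (unitInterval.symm s) = gE d s

lemma Compatible.finish {gV : Y.V → Z} {gE : Y.D → I → Z} (h : Compatible gV gE) (d : Y.D) :
    gE d 1 = gV (Y.tgt d) := by
  rw [← h.reverse, unitInterval.symm_one, h.start]; rfl

open Classical in
/-- The map on the disjoint union of the cells which is `gV`, `gE` on the vertices and edges and is
constant on the interior of a 2-cell. -/
def cellsLift (gV : Y.V → Z) (gE : Y.D → I → Z) (gF : Y.F → Z) : Y.Cells → Z
  | .inl v => gV v.1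
  | .inr (.inl e) => gE e.1 e.2
  | .inr (.inr c) =>
    if h : ∃ (i : Fin (Y.bd c.1).length) (s : I), c.2 = sidePoint (Y.bd c.1).length i s then
      gE ((Y.bd c.1)[h.choose]) h.choose_spec.choose
    else gF c.1

/-- By `sidePoint_eq`, coinciding points have the same side and parameter or are the common end of
consecutive sides, where the values at the vertices decide. -/
lemma Compatible.side {gV : Y.V → Z} {gE : Y.D → I → Z} (H : Compatible gV gE) (f : Y.F)
    {i j : ℕ} (hi : i < (Y.bd f).length) (hj : j < (Y.bd f).length) {s t : I}
    (h : sidePoint (Y.bd f).length i s = sidePoint (Y.bd f).length j t) :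
    gE ((Y.bd f)[j]) t = gE ((Y.bd f)[i]) s := by
  rcases sidePoint_eq hi hj h with ⟨h1, h2⟩ | ⟨h1, h2, h3⟩ | ⟨h1, h2, h3⟩
  · subst h1; rw [h2]
  · rw [h1, h2, H.finish, H.start, tgt, Y.bd_closed f i hi]
    simp only [h3]
  · rw [h1, h2, H.finish, H.start, tgt, Y.bd_closed f j hj]
    simp only [h3]

open Classical in
/-- The map on the realization induced by compatible maps on vertices and edges, constant on the
interior of a 2-cell. -/
def lift (gV : Y.V → Z) (gE : Y.D → I → Z) (gF : Y.F → Z) (H : Compatible gV gE) :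
    Y.Realization → Z :=
  Quot.lift (cellsLift gV gE gF) (by
    intro a b h
    cases h with
    | start d => exact H.start d
    | reverse d s => exact (H.reverse d s).symm
    | side f i hi s =>
      have h : ∃ (j : Fin (Y.bd f).length) (t : I),
        sidePoint (Y.bd f).length i s = sidePoint (Y.bd f).length j t := ⟨⟨i, hi⟩, s, rfl⟩
      change dite _ _ _ = _
      rw [dif_pos h]
      exact H.side f hi h.choose.2 h.choose_spec.choose_spec)

variable {gV : Y.V → Z} {gE : Y.D → I → Z} {gF : Y.F → Z} (H : Compatible gV gE)

@[simp] lemma lift_vertexPt (v : Y.V) : lift gV gE gF H (Y.vertexPt v) = gV v := rfl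

@[simp] lemma lift_edgePt (d : Y.D) (s : I) : lift gV gE gF H (Y.edgePt d s) = gE d s := rfl

open Classical in
lemma lift_facePt (f : Y.F) (z : Disc) (hz : ‖(z : ℂ)‖ < 1) :
    lift gV gE gF H (Y.facePt f z) = gF f := by
  change dite _ _ _ = _
  rw [dif_neg]
  rintro ⟨i, s, hs⟩
  have := norm_sidePoint (Y.bd f).length i s
  rw [← hs] at this
  exact hz.ne this

end lift

lemma edgePt_zero (d : Y.D) : Y.edgePt d 0 = Y.vertexPt (Y.src d) := Quot.sound (.start d)

lemma edgePt_inv (d : Y.D) (s : I) : Y.edgePt (Y.inv d) (unitInterval.symm s) = Y.edgePt d s :=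
  (Quot.sound (.reverse d s)).symm

lemma edgePt_one (d : Y.D) : Y.edgePt d 1 = Y.vertexPt (Y.tgt d) := by
  rw [← edgePt_inv, unitInterval.symm_one, edgePt_zero]; rfl

lemma facePt_side (f : Y.F) (i : ℕ) (hi : i < (Y.bd f).length) (s : I) :
    Y.facePt f (sidePoint (Y.bd f).length i s) = Y.edgePt (Y.bd f)[i] s :=
  Quot.sound (.side f i hi s)

/-- A point of the realization is a vertex, an interior point of an edge or an interior point of a
2-cell. -/
lemma realization_cases {P : Y.Realization → Prop} (hV : ∀ v, P (Y.vertexPt v))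
    (hE : ∀ d s, s ≠ 0 → s ≠ 1 → P (Y.edgePt d s))
    (hF : ∀ (f : Y.F) (z : Disc), ‖(z : ℂ)‖ < 1 → P (Y.facePt f z)) (q : Y.Realization) : P q := by
  have hE' : ∀ d s, P (Y.edgePt d s) := by
    intro d s
    by_cases h0 : s = 0
    · rw [h0, edgePt_zero]; exact hV _
    by_cases h1 : s = 1
    · rw [h1, edgePt_one]; exact hV _
    exact hE d s h0 h1
  induction q using Quot.ind with
  | mk a =>
    rcases a with v | e | c
    · exact hV v.1
    · exact hE' e.1 e.2
    · rcases (mem_closedBall_zero_iff.mp c.2.2).lt_or_eq with h | h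
      · exact hF c.1 c.2 h
      · obtain ⟨i, s, hs⟩ := exists_sidePoint
          (List.length_pos_iff.mpr (Y.bd_ne_nil c.1)) c.2 h
        have := Y.facePt_side c.1 i i.2 s
        rw [← hs] at this
        change P (Y.facePt c.1 c.2)
        rw [this]
        exact hE' _ _

lemma continuous_edgePt (d : Y.D) : Continuous (Y.edgePt d) :=
  continuous_quot_mk.comp (continuous_inr.comp (continuous_inl.comp continuous_sigmaMk))

lemma continuous_facePt (f : Y.F) : Continuous (Y.facePt f) :=
  continuous_quot_mk.comp (continuous_inr.comp (continuous_inr.comp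
    continuous_sigmaMk))

lemma continuous_sidePoint (n i : ℕ) : Continuous (sidePoint n i) := by
  unfold sidePoint
  fun_prop

/-! ### Closed subsets of edges -/

/-- Points of the realization are told apart by invariants that descend through `lift`. With the
value `False` on 2-cells, this one detects the interior points of edges. -/
lemma compatible_interior :
    Compatible (Y := Y) (fun _ => False) (fun _ x => x ≠ 0 ∧ x ≠ 1) := by
  constructor
  · simp
  · intro e x
    simp only [ne_eq, unitInterval.symm_eq_zero, unitInterval.symm_eq_one, eq_iff_iff]
    tauto

lemma edgePt_injective {d d' : Y.D} {s s' : I} (h0 : s' ≠ 0) (h1 : s' ≠ 1)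
    (h : Y.edgePt d s = Y.edgePt d' s') :
    (d = d' ∧ s = s') ∨ (d = Y.inv d' ∧ s = unitInterval.symm s') := by
  -- The invariant is membership in the gluing class of `(d, s)`, restricted to interior parameters
  -- so that it may be false at all vertices.
  have H : Compatible (Y := Y) (fun _ => False) (fun e x =>
      (x ≠ 0 ∧ x ≠ 1) ∧ ((d = e ∧ s = x) ∨ (d = Y.inv e ∧ s = unitInterval.symm x))) := by
    constructor
    · simp
    · intro e x
      simp only [Y.inv_inv, unitInterval.symm_symm, ne_eq, unitInterval.symm_eq_zero,
        unitInterval.symm_eq_one, eq_iff_iff]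
      tauto
  have h2 := congrArg (lift _ _ (fun _ => False) H) h
  simp only [lift_edgePt, eq_iff_iff] at h2
  by_cases hs0 : s = 0
  · have h3 := congrArg (lift _ _ (fun _ => False) Y.compatible_interior) h
    simp only [lift_edgePt, eq_iff_iff] at h3
    exact absurd hs0 (h3.mpr ⟨h0, h1⟩).1
  by_cases hs1 : s = 1
  · have h3 := congrArg (lift _ _ (fun _ => False) Y.compatible_interior) h
    simp only [lift_edgePt, eq_iff_iff] at h3
    exact absurd hs1 (h3.mpr ⟨h0, h1⟩).2
  exact (h2.mp ⟨⟨hs0, hs1⟩, Or.inl (by simp)⟩).2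

lemma vertexPt_ne_facePt (v : Y.V) (f : Y.F) (z : Disc) (hz : ‖(z : ℂ)‖ < 1) :
    Y.vertexPt v ≠ Y.facePt f z := by
  have H : Compatible (Y := Y) (fun _ => True) (fun _ _ => True) := ⟨by simp, by simp⟩
  intro h
  have h2 := congrArg (lift _ _ (fun _ => False) H) h
  rw [lift_facePt H _ _ hz] at h2
  simp at h2

lemma edgePt_ne_facePt (d : Y.D) (s : I) (f : Y.F) (z : Disc) (hz : ‖(z : ℂ)‖ < 1) :
    Y.edgePt d s ≠ Y.facePt f z := by
  have H : Compatible (Y := Y) (fun _ => True) (fun _ _ => True) := ⟨by simp, by simp⟩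
  intro h
  have h2 := congrArg (lift _ _ (fun _ => False) H) h
  rw [lift_facePt H _ _ hz] at h2
  simp at h2

/-- `T` and `K` differ by at most the two endpoints, a finite set. -/
lemma isClosed_of_subset_endpoints {T : Set I} (K : Set I) (hK : IsClosed K) (hKT : K ⊆ T)
    (hT : ∀ s ∈ T, s ≠ 0 → s ≠ 1 → s ∈ K) : IsClosed T := by
  have : T = K ∪ (T ∩ {0, 1}) := by
    ext s
    simp only [Set.mem_union, Set.mem_inter_iff, Set.mem_insert_iff, Set.mem_singleton_iff]
    constructor
    · intro h
      by_cases h0 : s = 0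
      · exact Or.inr ⟨h, Or.inl h0⟩
      by_cases h1 : s = 1
      · exact Or.inr ⟨h, Or.inr h1⟩
      exact Or.inl (hT s h h0 h1)
    · rintro (h | h)
      · exact hKT h
      · exact h.1
  rw [this]
  exact hK.union (Set.Finite.isClosed (Set.Finite.inter_of_right (by simp) _))

/-- In a closed disc the preimage lies on the circle and is a finite union of images of compact
subsets of sides; among the vertices every set is closed. So only the edges have to be checked, even
if the complex is infinite. -/
lemma isClosed_realization {T : Set Y.Realization}
    (hE : ∀ d, IsClosed (Y.edgePt d ⁻¹' T))
    (hF : ∀ (f : Y.F) (z : Disc), ‖(z : ℂ)‖ < 1 → Y.facePt f z ∉ T) : IsClosed T := by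
  have hq : Topology.IsQuotientMap (Quot.mk (Glue (Y := Y))) := isQuotientMap_quot_mk
  refine hq.isClosed_preimage.mp ?_
  rw [isClosed_sum_iff, isClosed_sum_iff]
  refine ⟨?_, ?_, ?_⟩
  · rw [isClosed_sigma_iff]
    intro v
    exact isClosed_discrete _
  · rw [isClosed_sigma_iff]
    exact hE
  · rw [isClosed_sigma_iff]
    intro f
    have : (fun z : Disc => Y.facePt f z) ⁻¹' T = ⋃ i : Fin (Y.bd f).length,
        sidePoint (Y.bd f).length i '' (Y.edgePt ((Y.bd f)[i]) ⁻¹' T) := by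
      ext z
      simp only [Set.mem_preimage, Set.mem_iUnion, Set.mem_image]
      constructor
      · intro h
        rcases (mem_closedBall_zero_iff.mp z.2).lt_or_eq with h1 | h1
        · exact absurd h (hF f z h1)
        · obtain ⟨i, s, rfl⟩ := exists_sidePoint (List.length_pos_iff.mpr (Y.bd_ne_nil f)) z h1
          rw [Y.facePt_side f i i.2 s] at h
          exact ⟨i, s, h, rfl⟩
      · rintro ⟨i, s, h, rfl⟩
        rw [Y.facePt_side f i i.2 s]
        exact h
    change IsClosed ((fun z : Disc => Y.facePt f z) ⁻¹' T)
    rw [this]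
    refine isClosed_iUnion_of_finite fun i => ?_
    exact ((hE _).isCompact.image (continuous_sidePoint _ _)).isClosed

/-- Up to endpoints, the preimage in an edge is empty, `K`, or the mirror image of `K`. -/
lemma isClosed_edgePt_image (d : Y.D) {K : Set I} (hK : IsClosed K) :
    IsClosed (Y.edgePt d '' K) := by
  apply Y.isClosed_realization
  · intro d'
    apply isClosed_of_subset_endpoints
      ({s | d = d' ∧ s ∈ K} ∪ {s | d = Y.inv d' ∧ unitInterval.symm s ∈ K})
    · exact (isClosed_const.inter hK).union
        (isClosed_const.inter (hK.preimage unitInterval.continuous_symm))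
    · rintro s (⟨rfl, h⟩ | ⟨rfl, h⟩)
      · exact ⟨s, h, rfl⟩
      · exact ⟨_, h, Y.edgePt_inv d' s⟩
    · rintro s ⟨x, hx, h⟩ h0 h1
      rcases Y.edgePt_injective h0 h1 h with ⟨rfl, rfl⟩ | ⟨rfl, rfl⟩
      · exact Or.inl ⟨rfl, hx⟩
      · exact Or.inr ⟨rfl, hx⟩
  · rintro f z hz ⟨s, -, h⟩
    exact Y.edgePt_ne_facePt d s f z hz h

lemma isClosed_vertexPt (v : Y.V) : IsClosed {Y.vertexPt v} := by
  apply Y.isClosed_realization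
  · intro d
    apply isClosed_of_subset_endpoints ∅ isClosed_empty (by simp)
    intro s hs h0 h1
    have h3 := congrArg (lift _ _ (fun _ => False) Y.compatible_interior) (Set.mem_singleton_iff.mp hs)
    simp only [lift_edgePt, lift_vertexPt, eq_iff_iff, iff_false] at h3
    exact h3 ⟨h0, h1⟩
  · intro f z hz h
    exact Y.vertexPt_ne_facePt v f z hz h.symm

end TwoComplex

namespace TwoComplex

variable (Y : TwoComplex)

/-! ### Combings of the 1-skeleton -/

/-- A combing of all of the 1-skeleton, as compatible families of paths indexed by the vertices and
by the points of the edges. -/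
structure SkeletonCombing (y : Y.V) where
  atVertex : Y.V → C(I, Y.Realization)
  atEdge : Y.D → C(I, C(I, Y.Realization))
  compatible : Compatible atVertex (fun d x => atEdge d x)
  base : ∀ s, atVertex y s = Y.vertexPt y
  vertex_zero : ∀ v, atVertex v 0 = Y.vertexPt y
  vertex_one : ∀ v, atVertex v 1 = Y.vertexPt v
  edge_zero : ∀ d x, atEdge d x 0 = Y.vertexPt y
  edge_one : ∀ d x, atEdge d x 1 = Y.edgePt d x
  mem_skeleton1 : ∀ v s, atVertex v s ∈ Y.skeleton1

/-- The union of a vertex and finitely many closed edges. -/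
def edgeUnion (y : Y.V) (B : List Y.D) : Set Y.Realization :=
  {Y.vertexPt y} ∪ {q | ∃ d ∈ B, ∃ s : I, q = Y.edgePt d s}

variable {Y} in
/-- The parametrization of a union of closed edges. -/
def edgeUnionMap (y : Y.V) (B : List Y.D) :
    (Unit ⊕ (Σ _ : {d // d ∈ B}, I)) → Y.edgeUnion y B
  | .inl _ => ⟨Y.vertexPt y, Or.inl rfl⟩
  | .inr e => ⟨Y.edgePt e.1 e.2, Or.inr ⟨e.1, e.1.2, e.2, rfl⟩⟩

variable {Y}

/-- The map is closed because finitely many edges are involved. Consequently continuity on the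
subspace, in particular on ∂Δ, can be tested one edge at a time. -/
lemma isQuotientMap_edgeUnionMap (y : Y.V) (B : List Y.D) :
    Topology.IsQuotientMap (edgeUnionMap y B) := by
  have hc : Continuous (edgeUnionMap y B) := by
    rw [continuous_sum_dom]
    refine ⟨continuous_of_discreteTopology, ?_⟩
    rw [continuous_sigma_iff]
    intro d
    exact (Y.continuous_edgePt d).subtype_mk _
  have hs : Function.Surjective (edgeUnionMap y B) := by
    rintro ⟨q, rfl | ⟨d, hd, s, rfl⟩⟩
    · exact ⟨.inl (), rfl⟩
    · exact ⟨.inr ⟨⟨d, hd⟩, s⟩, rfl⟩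
  refine IsClosedMap.isQuotientMap ?_ hc hs
  have : Finite {d // d ∈ B} := List.finite_toSet B
  intro K hK
  rw [isClosed_sum_iff, isClosed_sigma_iff] at hK
  have h : edgeUnionMap y B '' K = Subtype.val ⁻¹'
      ((fun _ : Unit => Y.vertexPt y) '' (Sum.inl ⁻¹' K) ∪
        ⋃ d : {d // d ∈ B}, Y.edgePt d '' ((fun s : I => (⟨d, s⟩ : Σ _ : {d // d ∈ B}, I)) ⁻¹'
          (Sum.inr ⁻¹' K))) := by
    ext q
    simp only [Set.mem_image, Set.mem_preimage, Set.mem_union, Set.mem_iUnion]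
    constructor
    · rintro ⟨(u | ⟨d, s⟩), hx, rfl⟩
      · exact Or.inl ⟨u, hx, rfl⟩
      · exact Or.inr ⟨d, s, hx, rfl⟩
    · rintro (⟨u, hx, hq⟩ | ⟨d, s, hx, hq⟩)
      · exact ⟨_, hx, Subtype.ext hq⟩
      · exact ⟨_, hx, Subtype.ext hq⟩
  rw [h]
  refine IsClosed.preimage continuous_subtype_val (IsClosed.union ?_ ?_)
  · rcases (Set.subsingleton_of_subsingleton.image
      (fun _ : Unit => Y.vertexPt y) : Set.Subsingleton (_ '' (Sum.inl ⁻¹' K))).eq_empty_or_singleton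
      with h | ⟨q, h⟩
    · rw [h]; exact isClosed_empty
    · obtain ⟨u, -, hu⟩ : q ∈ (fun _ : Unit => Y.vertexPt y) '' (Sum.inl ⁻¹' K) := by rw [h]; rfl
      rw [h, ← hu]
      exact Y.isClosed_vertexPt y
  · exact isClosed_iUnion_of_finite fun d => Y.isClosed_edgePt_image d (hK.2 d)

lemma SkeletonCombing.exists_isOneCombing {y : Y.V} (K : Y.SkeletonCombing y) (B : List Y.D) :
    ∃ ψ : Y.edgeUnion y B × I → Y.Realization, Y.IsOneCombing (Y.edgeUnion y B) y ψ ∧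
      ∀ p, (∃ v, ∀ s, ψ (p, s) = K.atVertex v s) ∨ ∃ d x, ∀ s, ψ (p, s) = K.atEdge d x s := by
  -- The value on open 2-cells is arbitrary: only vertices and points of edges get combed.
  set Ψ : Y.Realization → C(I, Y.Realization) :=
    lift K.atVertex (fun d x => K.atEdge d x) (fun _ => K.atVertex y) K.compatible with hΨ
  have hcov : ∀ p : Y.edgeUnion y B, (∃ v, p.1 = Y.vertexPt v) ∨ ∃ d x, p.1 = Y.edgePt d x := by
    rintro ⟨q, rfl | ⟨d, hd, s, rfl⟩⟩
    · exact Or.inl ⟨_, rfl⟩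
    · exact Or.inr ⟨_, _, rfl⟩
  refine ⟨fun p => Ψ p.1 p.2, ⟨?_, ?_, ?_, ?_, ?_⟩, ?_⟩
  · have h : Continuous (fun p : Y.edgeUnion y B => Ψ p.1) := by
      rw [(isQuotientMap_edgeUnionMap y B).continuous_iff, continuous_sum_dom]
      refine ⟨continuous_of_discreteTopology, ?_⟩
      rw [continuous_sigma_iff]
      intro d
      exact (K.atEdge d).continuous
    exact ContinuousEval.continuous_eval.comp (h.prodMap continuous_id)
  · intro p
    rcases hcov p with ⟨v, hv⟩ | ⟨d, x, hv⟩
    · simp [hv, hΨ, K.vertex_zero]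
    · simp [hv, hΨ, K.edge_zero]
  · intro p
    rcases hcov p with ⟨v, hv⟩ | ⟨d, x, hv⟩
    · simp [hv, hΨ, K.vertex_one]
    · simp [hv, hΨ, K.edge_one]
  · intro p hp t
    simp [hp, hΨ, K.base]
  · rintro p ⟨v, hv⟩ t
    simp only [← hv, hΨ, lift_vertexPt]
    exact K.mem_skeleton1 v t
  · intro p
    rcases hcov p with ⟨v, hv⟩ | ⟨d, x, hv⟩
    · exact Or.inl ⟨v, fun s => by simp [hv, hΨ]⟩
    · exact Or.inr ⟨d, x, fun s => by simp [hv, hΨ]⟩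

/-! ### Weights -/

/-- The weight of the points of an edge. -/
def edgeWeight (M : Y.V → ℕ) (d : Y.D) (s : I) : ℕ :=
  if s = 0 then M (Y.src d) else if s = 1 then M (Y.tgt d) else max (M (Y.src d)) (M (Y.tgt d))

lemma edgeWeight_compatible (M : Y.V → ℕ) : Compatible M (edgeWeight M) := by
  constructor
  · intro d; simp [edgeWeight]
  · intro d s
    simp only [edgeWeight, tgt, Y.inv_inv, unitInterval.symm_eq_zero, unitInterval.symm_eq_one]
    by_cases h0 : s = 0
    · subst h0; simp
    · by_cases h1 : s = 1
      · subst h1; simp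
      · simp [h0, h1, max_comm]

lemma edgeWeight_le (M : Y.V → ℕ) (d : Y.D) (s : I) :
    edgeWeight M d s ≤ max (M (Y.src d)) (M (Y.tgt d)) := by
  unfold edgeWeight
  split_ifs <;> simp

/-- The weight of the points of the realization, for given weights of vertices and 2-cells. -/
def weight (M : Y.V → ℕ) (N : Y.F → ℕ) : Y.Realization → ℕ :=
  lift M (edgeWeight M) N (edgeWeight_compatible M)

section weight

variable (M : Y.V → ℕ) (N : Y.F → ℕ)

@[simp] lemma weight_vertexPt (v : Y.V) : weight M N (Y.vertexPt v) = M v := rfl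

lemma weight_edgePt (d : Y.D) (s : I) : weight M N (Y.edgePt d s) = edgeWeight M d s := rfl

lemma weight_facePt (f : Y.F) (z : Disc) (hz : ‖(z : ℂ)‖ < 1) :
    weight M N (Y.facePt f z) = N f := lift_facePt _ f z hz

variable {M N}

/-- The summand 1 in `hM` pays for the half unit between an open edge and its nearer end. -/
lemma coarseDist_le_weight {y : Y.V} (hM : ∀ v, Y.graph.dist y v + 1 ≤ M v)
    (hN : ∀ f, ∀ d ∈ Y.bd f, M (Y.src d) ≤ N f) (q : Y.Realization) :
    Y.coarseDist y q ≤ weight M N q := by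
  have hM' : ∀ v, (Y.graph.dist y v : ℝ) + 1 ≤ M v := fun v => by exact_mod_cast hM v
  induction q using realization_cases with
  | hV v =>
    rw [coarseDist_vertexPt, weight_vertexPt]
    linarith [hM' v]
  | hE d s h0 h1 =>
    rw [coarseDist_edgePt _ _ _ _ h0 h1, weight_edgePt, edgeWeight, if_neg h0, if_neg h1, edgeDist,
      Nat.cast_max]
    linarith [hM' (Y.src d), min_le_left (Y.graph.dist y (Y.src d) : ℝ) (Y.graph.dist y (Y.tgt d)),
      le_max_left (M (Y.src d) : ℝ) (M (Y.tgt d))]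
  | hF f z hz =>
    rw [coarseDist_facePt _ _ _ _ hz, weight_facePt _ _ _ _ hz, faceDist, sub_le_iff_le_add]
    obtain ⟨d, hd⟩ := List.exists_mem_of_ne_nil _ (Y.bd_ne_nil f)
    refine csSup_le ⟨_, d, hd, rfl⟩ ?_
    rintro x ⟨d, hd, rfl⟩
    rw [edgeDist]
    have : (M (Y.src d) : ℝ) ≤ N f := by exact_mod_cast hN f d hd
    linarith [hM' (Y.src d), min_le_left (Y.graph.dist y (Y.src d) : ℝ) (Y.graph.dist y (Y.tgt d))]

lemma dist_src_le (hY : Y.graph.Connected) (y : Y.V) (d : Y.D) :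
    Y.graph.dist y (Y.src d) ≤ Y.graph.dist y (Y.tgt d) + 1 := by
  by_cases h : Y.src d = Y.tgt d
  · rw [h]; omega
  · have hadj : Y.graph.Adj (Y.tgt d) (Y.src d) :=
      Y.graph.adj_symm ⟨h, d, rfl, rfl⟩
    calc _ ≤ Y.graph.dist y (Y.tgt d) + Y.graph.dist (Y.tgt d) (Y.src d) := hY.dist_triangle
      _ = _ := by rw [SimpleGraph.dist_eq_one_iff_adj.mpr hadj]

lemma dist_le_edgeDist (hY : Y.graph.Connected) (y : Y.V) (d : Y.D) :
    (Y.graph.dist y (Y.src d) : ℝ) ≤ Y.edgeDist y d + 1 / 2 := by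
  have h1 : (Y.graph.dist y (Y.src d) : ℝ) ≤ Y.graph.dist y (Y.tgt d) + 1 := by
    exact_mod_cast dist_src_le hY y d
  rw [edgeDist]
  rcases min_choice (Y.graph.dist y (Y.src d) : ℝ) (Y.graph.dist y (Y.tgt d)) with h | h <;>
    rw [h] <;> linarith

lemma edgeDist_inv (y : Y.V) (d : Y.D) : Y.edgeDist y (Y.inv d) = Y.edgeDist y d := by
  rw [edgeDist, edgeDist, tgt, tgt, Y.inv_inv, min_comm]

lemma edgeDist_le_faceDist (y : Y.V) (f : Y.F) {d : Y.D} (hd : d ∈ Y.bd f) :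
    Y.edgeDist y d ≤ Y.faceDist y f + 1 / 4 := by
  have hfin : {x | ∃ d ∈ Y.bd f, x = Y.edgeDist y d}.Finite := by
    have : {x | ∃ d ∈ Y.bd f, x = Y.edgeDist y d} = Y.edgeDist y '' {d | d ∈ Y.bd f} := by
      ext x; simp [eq_comm]
    rw [this]
    exact (List.finite_toSet (Y.bd f)).image _
  rw [faceDist, sub_add_cancel]
  exact le_csSup hfin.bddAbove ⟨d, hd, rfl⟩

/-- A vertex of a cell is further from `y` than the coarse distance of the open cell by at most 1/2
for an edge and 3/4 for a 2-cell, and the weight of a cell is bounded by that of one of its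
vertices. The shift by 1 covers both cases. -/
lemma weight_le_of_coarseDist (hY : Y.graph.Connected) {y : Y.V} {φ : ℕ → ℕ} (hφ : Monotone φ)
    (hM : ∀ v, M v ≤ φ (Y.graph.dist y v))
    (hN : ∀ f, ∃ d ∈ Y.bd f, N f ≤ M (Y.src d)) (q : Y.Realization) :
    weight M N q ≤ φ (⌈Y.coarseDist y q⌉₊ + 1) := by
  have key : ∀ v, (Y.graph.dist y v : ℝ) ≤ Y.coarseDist y q + 1 →
      M v ≤ φ (⌈Y.coarseDist y q⌉₊ + 1) := by
    intro v hv
    refine (hM v).trans (hφ ?_)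
    have := Nat.le_ceil (Y.coarseDist y q)
    have h2 : (Y.graph.dist y v : ℝ) ≤ (⌈Y.coarseDist y q⌉₊ + 1 : ℕ) := by push_cast; linarith
    exact_mod_cast h2
  revert key
  induction q using realization_cases with
  | hV v =>
    intro key
    refine key v ?_
    rw [coarseDist_vertexPt]; linarith
  | hE d s h0 h1 =>
    rw [coarseDist_edgePt _ _ _ _ h0 h1, weight_edgePt]
    intro key
    refine (edgeWeight_le _ _ _).trans (max_le (key _ ?_) (key _ ?_))
    · linarith [dist_le_edgeDist hY y d]
    · have := dist_le_edgeDist hY y (Y.inv d)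
      rw [edgeDist_inv] at this
      rw [tgt]
      linarith
  | hF f z hz =>
    rw [coarseDist_facePt _ _ _ _ hz, weight_facePt _ _ _ _ hz]
    intro key
    obtain ⟨d, hd, h⟩ := hN f
    refine h.trans (key _ ?_)
    linarith [dist_le_edgeDist hY y d, edgeDist_le_faceDist y f hd]

end weight

/-! ### Embeddings of 2-complexes -/

/-- A morphism of 2-complexes which is injective on vertices. -/
structure Embedding (Y Y' : TwoComplex) where
  onV : Y.V → Y'.V
  onD : Y.D → Y'.D
  onF : Y.F → Y'.F
  onV_injective : Function.Injective onV
  src : ∀ d, Y'.src (onD d) = onV (Y.src d)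
  inv : ∀ d, Y'.inv (onD d) = onD (Y.inv d)
  bd : ∀ f, Y'.bd (onF f) = (Y.bd f).map onD

namespace Embedding

variable {Y' : TwoComplex} (i : Embedding Y Y')

lemma tgt (d : Y.D) : Y'.tgt (i.onD d) = i.onV (Y.tgt d) := by
  rw [TwoComplex.tgt, i.inv, i.src]; rfl

/-- The map of the disjoint unions of the cells. -/
def onCells : Y.Cells → Y'.Cells
  | .inl v => .inl ⟨i.onV v.1, v.2⟩
  | .inr (.inl e) => .inr (.inl ⟨i.onD e.1, e.2⟩)
  | .inr (.inr c) => .inr (.inr ⟨i.onF c.1, c.2⟩)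

/-- The map of the realizations. -/
def map : Y.Realization → Y'.Realization :=
  Quot.map i.onCells (by
    intro a b h
    cases h with
    | start d =>
      have := Glue.start (i.onD d)
      rw [i.src] at this
      exact this
    | reverse d s =>
      have := Glue.reverse (i.onD d) s
      rw [i.inv] at this
      exact this
    | side f j hj s =>
      have hl : (Y'.bd (i.onF f)).length = (Y.bd f).length := by rw [i.bd, List.length_map]
      have := Glue.side (i.onF f) j (hl ▸ hj) s
      simp only [hl] at this
      simp only [i.bd, List.getElem_map] at this
      exact this)

@[simp] lemma map_vertexPt (v : Y.V) : i.map (Y.vertexPt v) = Y'.vertexPt (i.onV v) := rfl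

@[simp] lemma map_edgePt (d : Y.D) (s : I) : i.map (Y.edgePt d s) = Y'.edgePt (i.onD d) s := rfl

@[simp] lemma map_facePt (f : Y.F) (z : Disc) : i.map (Y.facePt f z) = Y'.facePt (i.onF f) z := rfl

lemma continuous_map : Continuous i.map := by
  refine continuous_quot_lift _ (continuous_quot_mk.comp ?_)
  rw [continuous_sum_dom, continuous_sum_dom, continuous_sigma_iff, continuous_sigma_iff,
    continuous_sigma_iff]
  exact ⟨fun v => continuous_of_discreteTopology,
    fun d => continuous_inr.comp (continuous_inl.comp
      (@continuous_sigmaMk _ (fun _ : Y'.D => I) _ (i.onD d))),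
    fun f => continuous_inr.comp (continuous_inr.comp
      (@continuous_sigmaMk _ (fun _ : Y'.F => Disc) _ (i.onF f)))⟩

lemma map_mem_skeleton1 {q : Y.Realization} (h : q ∈ Y.skeleton1) : i.map q ∈ Y'.skeleton1 := by
  rcases h with ⟨v, rfl⟩ | ⟨d, s, rfl⟩
  · exact Or.inl ⟨_, rfl⟩
  · exact Or.inr ⟨_, _, rfl⟩

lemma weight_map {M : Y.V → ℕ} {N : Y.F → ℕ} {M' : Y'.V → ℕ} {N' : Y'.F → ℕ}
    (hM : ∀ v, M' (i.onV v) = M v) (hN : ∀ f, N' (i.onF f) = N f) (q : Y.Realization) :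
    weight M' N' (i.map q) = weight M N q := by
  induction q using realization_cases with
  | hV v => simp [hM]
  | hE d s h0 h1 => simp [weight_edgePt, edgeWeight, i.src, i.tgt, hM]
  | hF f z hz => rw [map_facePt, weight_facePt _ _ _ _ hz, weight_facePt _ _ _ _ hz, hN]

/-- The homomorphism of the underlying graphs. -/
def graphHom : Y.graph →g Y'.graph where
  toFun := i.onV
  map_rel' := by
    rintro u v ⟨h, d, rfl, rfl⟩
    exact ⟨fun h' => h (i.onV_injective h'), i.onD d, i.src d, i.tgt d⟩

/-- Walks persist in the larger complex, so upper bounds for distances survive each enlargement of a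
diagram. -/
lemma dist_le (hY : Y.graph.Connected) (u v : Y.V) :
    Y'.graph.dist (i.onV u) (i.onV v) ≤ Y.graph.dist u v := by
  obtain ⟨p, hp⟩ := hY.exists_walk_length_eq_dist u v
  rw [← hp, ← SimpleGraph.Walk.length_map i.graphHom p]
  exact SimpleGraph.dist_le _

lemma reachable (hY : Y.graph.Connected) (u v : Y.V) :
    Y'.graph.Reachable (i.onV u) (i.onV v) :=
  (hY u v).map i.graphHom

end Embedding

end TwoComplex

/-! ### Chains -/

/-- The list `L` is a chain from `P` to `Q`, where `g d` and `f d` are the start and the end of the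
link `d`. -/
def Chain {D E : Type*} (g f : D → E) : E → List D → E → Prop
  | P, [], Q => P = Q
  | P, d :: L, Q => g d = P ∧ Chain g f (f d) L Q

section Chain

variable {D E D' E' : Type*} {g f : D → E}

@[simp] lemma chain_nil {P Q : E} : Chain g f P [] Q ↔ P = Q := Iff.rfl

@[simp] lemma chain_cons {P Q : E} {d : D} {L : List D} :
    Chain g f P (d :: L) Q ↔ g d = P ∧ Chain g f (f d) L Q := Iff.rfl

lemma chain_append {P Q : E} {A B : List D} :
    Chain g f P (A ++ B) Q ↔ ∃ R, Chain g f P A R ∧ Chain g f R B Q := by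
  induction A generalizing P with
  | nil => simp
  | cons a A ih => simp [ih, and_assoc]

lemma Chain.eq_end {P Q Q' : E} {L : List D} (h : Chain g f P L Q) (h' : Chain g f P L Q') :
    Q = Q' := by
  induction L generalizing P with
  | nil => exact h.symm.trans h'
  | cons a L ih => exact ih h.2 h'.2

lemma chain_rotate {P : E} {A B : List D} (h : Chain g f P (A ++ B) P) :
    ∃ Q, Chain g f Q (B ++ A) Q := by
  obtain ⟨R, h1, h2⟩ := chain_append.mp h
  exact ⟨R, chain_append.mpr ⟨P, h2, h1⟩⟩

lemma Chain.map {g' f' : D' → E'} (φ : D → D') (ψ : E → E') {P Q : E} {L : List D}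
    (hg : ∀ a ∈ L, g' (φ a) = ψ (g a)) (hf : ∀ a ∈ L, f' (φ a) = ψ (f a)) (h : Chain g f P L Q) :
    Chain g' f' (ψ P) (L.map φ) (ψ Q) := by
  induction L generalizing P with
  | nil => exact congrArg ψ h
  | cons a L ih =>
    obtain ⟨rfl, h⟩ := h
    simp only [List.map_cons, chain_cons]
    refine ⟨hg _ (by simp), ?_⟩
    rw [hf _ (by simp)]
    exact ih (fun b hb => hg b (by simp [hb])) (fun b hb => hf b (by simp [hb])) h

lemma chain_iff {P Q : E} {L : List D} : Chain g f P L Q ↔ P :: L.map f = L.map g ++ [Q] := by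
  induction L generalizing P with
  | nil => simp
  | cons a L ih => simp [ih, eq_comm]

/-- Together with `exists_chain`, this translates between closed chains, which can be cut and
rotated, and the cyclic indexing in the definition of a diagram. -/
lemma Chain.getElem {P : E} {L : List D} (h : Chain g f P L P) (i : ℕ) (hi : i < L.length) :
    f L[i] = g (L[(i + 1) % L.length]'(Nat.mod_lt _ (by omega))) := by
  have h1 := congrArg (·[i + 1]?) (chain_iff.mp h)
  have h0 := congrArg (·[0]?) (chain_iff.mp h)
  simp only [List.getElem?_cons_succ, List.getElem?_map, List.getElem?_eq_getElem hi,
    Option.map_some] at h1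
  rcases Nat.lt_or_ge (i + 1) L.length with h2 | h2
  · rw [List.getElem?_append_left (by simpa using h2), List.getElem?_map,
      List.getElem?_eq_getElem h2] at h1
    simp only [Option.map_some, Option.some.injEq] at h1
    simp only [h1, Nat.mod_eq_of_lt h2]
  · have h3 : i + 1 = L.length := by omega
    rw [List.getElem?_append_right (by simp; omega)] at h1
    simp only [h3, List.length_map, Nat.sub_self, List.getElem?_cons_zero, Option.some.injEq] at h1
    have hpos : 0 < L.length := by omega
    rw [List.getElem?_append_left (by simpa using hpos), List.getElem?_map,
      List.getElem?_eq_getElem hpos] at h0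
    simp only [List.getElem?_cons_zero, Option.map_some, Option.some.injEq] at h0
    simp only [h3, Nat.mod_self, h1, h0]

lemma exists_chain {L : List D} (hL : L ≠ []) (h : ∀ (i : ℕ) (hi : i < L.length),
    f L[i] = g (L[(i + 1) % L.length]'(Nat.mod_lt _ (by omega)))) :
    Chain g f (g (L.head hL)) L (g (L.head hL)) := by
  rw [chain_iff]
  apply List.ext_getElem
  · simp
  · intro j h1 h2
    rcases j with _ | j
    · rw [List.getElem_append_left (by simpa using List.length_pos_iff.mpr hL)]
      simp [List.head_eq_getElem]
    · simp only [List.length_cons, List.length_map] at h1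
      simp only [List.getElem_cons_succ, List.getElem_map]
      rw [h j (by omega)]
      rcases Nat.lt_or_ge (j + 1) L.length with h3 | h3
      · rw [List.getElem_append_left (by simpa using h3)]
        simp [Nat.mod_eq_of_lt h3]
      · have h4 : j + 1 = L.length := by omega
        rw [List.getElem_append_right (by simpa using h3)]
        simp [h4, List.head_eq_getElem]

end Chain

/-- One step of `ρ` may correspond to several steps of `ρ'`, as happens when new elements are
inserted into the cycles. -/
lemma sameCycle_map {D D' : Type*} {ρ : Equiv.Perm D} {ρ' : Equiv.Perm D'} (φ : D → D')
    (h : ∀ d, ρ'.SameCycle (φ d) (φ (ρ d))) {d d' : D} (hd : ρ.SameCycle d d') :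
    ρ'.SameCycle (φ d) (φ d') := by
  obtain ⟨i, rfl⟩ := hd
  induction i with
  | zero => exact Equiv.Perm.SameCycle.refl _ _
  | succ n ih =>
    refine ih.trans ?_
    have := h ((ρ ^ (n : ℤ)) d)
    rwa [← Equiv.Perm.mul_apply, ← zpow_one_add, add_comm] at this
  | pred n ih =>
    refine ih.trans ?_
    have := h ((ρ ^ (-(n : ℤ) - 1)) d)
    rw [← Equiv.Perm.mul_apply, ← zpow_one_add] at this
    have h2 : (1 + (-(n : ℤ) - 1)) = -n := by ring
    rw [h2] at this
    exact this.symm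

/-! ### Adding an edge with a new end vertex -/

section Perm

variable {D : Type*} (n : Equiv.Perm D)

open Classical in
/-- The permutation with two new elements inserted after `c`. -/
def spikeNext : Option D → Equiv.Perm (D ⊕ Bool)
  -- Without a predecessor `c`, the outer walk consists of the two new directed edges alone.
  | none => Equiv.sumCongr n Equiv.boolNot
  | some c => (Equiv.swap (.inl c) (.inr false)).trans (Equiv.sumCongr n Equiv.boolNot)

lemma spikeNext_true (c : Option D) : spikeNext n c (.inr true) = .inr false := by
  cases c <;> simp [spikeNext, Equiv.swap_apply_def]

lemma spikeNext_none_false : spikeNext n none (.inr false) = .inr true := by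
  simp [spikeNext]

lemma spikeNext_some_false (c : D) : spikeNext n (some c) (.inr false) = .inl (n c) := by
  simp [spikeNext]

lemma spikeNext_some_self (c : D) : spikeNext n (some c) (.inl c) = .inr true := by
  simp [spikeNext]

lemma spikeNext_inl (c : Option D) (d : D) (h : d ∉ c) :
    spikeNext n c (.inl d) = .inl (n d) := by
  cases c with
  | none => simp [spikeNext]
  | some c =>
    have : d ≠ c := by rintro rfl; simp at h
    simp [spikeNext, Equiv.swap_apply_def, this]

open Classical in
/-- The permutation obtained by replacing the segment which follows `c` and ends with `z` in a cycle
by one new element and closing the segment to a cycle with another new element. -/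
def faceNext (c z : D) : Equiv.Perm (D ⊕ Bool) :=
  (((Equiv.swap (.inr true) (.inr false)).trans (Equiv.swap (.inl z) (.inr false))).trans
    (Equiv.swap (.inl c) (.inr true))).trans (Equiv.sumCongr n (Equiv.refl Bool))

variable (c z : D)

lemma faceNext_end : faceNext n c z (.inl z) = .inr false := by
  simp [faceNext, Equiv.swap_apply_def]

lemma faceNext_false : faceNext n c z (.inr false) = .inl (n c) := by
  simp [faceNext, Equiv.swap_apply_def]

variable {c z}

lemma faceNext_start (h : c ≠ z) : faceNext n c z (.inl c) = .inr true := by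
  simp [faceNext, Equiv.swap_apply_def, h]

lemma faceNext_true (h : c ≠ z) : faceNext n c z (.inr true) = .inl (n z) := by
  simp [faceNext, Equiv.swap_apply_def, h.symm]

/-- If the segment is the whole cycle, the new outer edge is a loop that follows itself. -/
lemma faceNext_true_self : faceNext n z z (.inr true) = .inr true := by
  simp [faceNext]

lemma faceNext_inl {d : D} (h : d ≠ c) (h' : d ≠ z) : faceNext n c z (.inl d) = .inl (n d) := by
  simp [faceNext, Equiv.swap_apply_def, h, h']

end Perm

/-! ### 2-complexes with one more edge or one more 2-cell -/

namespace TwoComplex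

variable (Y : TwoComplex)

/-- The edge path condition. -/
abbrev Walk (P : Y.V) (L : List Y.D) (Q : Y.V) : Prop := Chain Y.src Y.tgt P L Q

/-- The 2-complex with a new edge from `P` to a new vertex. -/
@[reducible] def addSpike (P : Y.V) : TwoComplex where
  V := Option Y.V
  D := Y.D ⊕ Bool
  F := Y.F
  src := Sum.elim (fun d => some (Y.src d)) (fun b => cond b (some P) none)
  inv := Sum.map Y.inv (!·)
  inv_inv := by rintro (d | b) <;> simp [Y.inv_inv]
  inv_ne := by rintro (d | b) <;> simp [Y.inv_ne]
  bd f := (Y.bd f).map Sum.inl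
  bd_ne_nil f := by simp [Y.bd_ne_nil]
  bd_closed := by
    intro f i hi
    rw [List.length_map] at hi
    simpa using Y.bd_closed f i hi

/-- The inclusion. -/
def addSpikeEmbedding (P : Y.V) : Embedding Y (Y.addSpike P) where
  onV := some
  onD := Sum.inl
  onF := id
  onV_injective := Option.some_injective _
  src _ := rfl
  inv _ := rfl
  bd _ := rfl

/-- The 2-complex with a new edge from `P` to `Q` and a new 2-cell, which is bounded by the new edge
and the edge path `l`. -/
@[reducible] def addFace {P Q : Y.V} {l : List Y.D} (hl : Y.Walk P l Q) : TwoComplex where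
  V := Y.V
  D := Y.D ⊕ Bool
  F := Option Y.F
  src := Sum.elim Y.src (fun b => cond b P Q)
  inv := Sum.map Y.inv (!·)
  inv_inv := by rintro (d | b) <;> simp [Y.inv_inv]
  inv_ne := by rintro (d | b) <;> simp [Y.inv_ne]
  bd f := f.elim (l.map Sum.inl ++ [.inr false]) (fun f => (Y.bd f).map Sum.inl)
  bd_ne_nil f := by cases f <;> simp [Y.bd_ne_nil]
  bd_closed := by
    intro f
    cases f with
    | none =>
      have h : Chain (Sum.elim Y.src (fun b => cond b P Q))
          (fun d => Sum.elim Y.src (fun b => cond b P Q) (Sum.map Y.inv (!·) d)) P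
          (l.map Sum.inl ++ [.inr false]) P :=
        chain_append.mpr ⟨Q, hl.map Sum.inl id (by simp) (by simp [tgt]), by simp⟩
      exact h.getElem
    | some f =>
      intro i hi
      simp only [Option.elim_some, List.length_map] at hi
      simpa using Y.bd_closed f i hi

/-- The inclusion. -/
def addFaceEmbedding {P Q : Y.V} {l : List Y.D} (hl : Y.Walk P l Q) :
    Embedding Y (Y.addFace hl) where
  onV := id
  onD := Sum.inl
  onF := some
  onV_injective := Function.injective_id
  src _ := rfl
  inv _ := rfl
  bd _ := rfl

end TwoComplex

/-- The inverse letter. -/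
def letterInv {α : Type} (x : α × Bool) : α × Bool := (x.1, !x.2)

/-! ### The boundary cycle of a diagram -/

namespace VanKampenDiagram

variable {α : Type} {S : Set (Word α)} {w : Word α} (Δ : VanKampenDiagram S w)

lemma tgt_eq_src_next (d : Δ.D) : Δ.tgt d = Δ.src (Δ.next d) := (Δ.src_next d).symm

lemma walk_of_chain {h b : Δ.D} {L : List Δ.D} (H : Chain id Δ.next h L b) :
    Δ.Walk (Δ.src h) L (Δ.src b) := by
  have := H.map (g' := Δ.src) (f' := Δ.tgt) id Δ.src (by simp) (by simp [tgt_eq_src_next])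
  simpa using this

lemma boundary_chain (hne : Δ.boundary ≠ []) :
    ∃ h, Δ.src h = Δ.base ∧ Chain id Δ.next h Δ.boundary h :=
  ⟨_, Δ.boundary_start _ (List.head_mem_head? hne), exists_chain hne Δ.next_boundary⟩

lemma boundary_walk : Δ.Walk Δ.base Δ.boundary Δ.base := by
  by_cases h : Δ.boundary = []
  · rw [h]; rfl
  · obtain ⟨d, hd, h⟩ := Δ.boundary_chain h
    have := Δ.walk_of_chain h
    rwa [hd] at this

variable {Δ}

/-- The boundary cycle, started at another vertex. -/
lemma exists_chain_rotate {Lu Lv : List Δ.D} (h : Δ.boundary = Lu ++ Lv) (hne : Δ.boundary ≠ [])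
    {P : Δ.V} (hP : Δ.Walk Δ.base Lu P) : ∃ b, Δ.src b = P ∧ Chain id Δ.next b (Lv ++ Lu) b := by
  obtain ⟨d, hd, hc⟩ := Δ.boundary_chain hne
  rw [h] at hc
  obtain ⟨b, h1, h2⟩ := chain_append.mp hc
  have h3 := Δ.walk_of_chain h1
  rw [hd] at h3
  exact ⟨b, h3.eq_end hP, chain_append.mpr ⟨_, h2, h1⟩⟩

lemma region_of_mem_bd {f : Δ.F} {d : Δ.D} (h : d ∈ Δ.bd f) : d ∉ Δ.boundary := by
  rw [Δ.mem_boundary, (Δ.mem_bd f d).mp h]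
  simp

end VanKampenDiagram

namespace VanKampenDiagram

variable {α : Type} {S : Set (Word α)} {w : Word α} {Δ : VanKampenDiagram S w}

/-! ### Attaching an edge -/

section spike

variable {Lu Lv : List Δ.D} (hL : Δ.boundary = Lu ++ Lv)
    (hD : Δ.boundary = [] → IsEmpty Δ.D) {P : Δ.V} (hP : Δ.Walk Δ.base Lu P)

/-- The successor permutation after attaching an edge. -/
abbrev addSpikeNext (Lu Lv : List Δ.D) : Equiv.Perm (Δ.D ⊕ Bool) :=
  spikeNext Δ.next (Lv ++ Lu).getLast?

include hL hD hP in
-- Read from `P`, the outer walk ends with an edge `c` into `P`, and the new edge goes into the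
-- corner between `c` and `next c`. If there is no such `c`, then `hD` guarantees that the diagram
-- has no edges at all.
lemma spike_cases : (Lu = [] ∧ Lv = [] ∧ IsEmpty Δ.D) ∨ ∃ T0 c, Lv ++ Lu = T0 ++ [c] ∧
    (Lv ++ Lu).getLast? = some c ∧ Chain id Δ.next (Δ.next c) T0 c ∧ Δ.tgt c = P ∧
    c ∈ Δ.boundary ∧ c ∉ T0 := by
  rcases List.eq_nil_or_concat' (Lv ++ Lu) with h | ⟨T0, c, h⟩
  · obtain ⟨rfl, rfl⟩ := List.append_eq_nil_iff.mp h
    exact Or.inl ⟨rfl, rfl, hD hL⟩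
  · have hperm : (Lv ++ Lu).Perm Δ.boundary := by rw [hL]; exact List.perm_append_comm
    have hc : c ∈ Δ.boundary := hperm.mem_iff.mp (by rw [h]; simp)
    have hnd : (T0 ++ [c]).Nodup := by rw [← h]; exact hperm.nodup_iff.mpr Δ.boundary_nodup
    obtain ⟨b, hb, hch⟩ := exists_chain_rotate hL (List.ne_nil_of_mem hc) hP
    rw [h] at hch
    obtain ⟨c', h1, rfl, h2⟩ := chain_append.mp hch
    have h2 : Δ.next c = b := h2
    subst h2
    refine Or.inr ⟨T0, c, h, by rw [h]; simp, h1, by rw [tgt_eq_src_next, hb], hc, ?_⟩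
    intro hcT
    exact (List.nodup_append.mp hnd).2.2 c hcT c (by simp) rfl

include hL hD hP in
lemma spike_src_next (d : Δ.D ⊕ Bool) : (Δ.toTwoComplex.addSpike P).src (addSpikeNext Lu Lv d) =
    (Δ.toTwoComplex.addSpike P).src ((Δ.toTwoComplex.addSpike P).inv d) := by
  rcases spike_cases hL hD hP with ⟨rfl, rfl, hE⟩ | ⟨T0, c, h, hc, hch, ht, hcb, hT⟩
  · rcases d with d | _ | _
    · exact hE.elim d
    · rfl
    · rfl
  · rw [addSpikeNext, hc]
    rcases d with d | _ | _
    · by_cases hd : d = c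
      · subst hd
        rw [spikeNext_some_self]
        exact congrArg some ht.symm
      · rw [spikeNext_inl _ _ _ (by simpa [eq_comm] using hd)]
        exact congrArg some (Δ.src_next d)
    · rw [spikeNext_some_false]
      exact congrArg some ((Δ.src_next c).trans ht)
    · rw [spikeNext_true]; rfl

include hL hD hP in
lemma spike_boundary_chain : ∃ h, Chain id (addSpikeNext Lu Lv) h
    (Lu.map Sum.inl ++ [.inr true, .inr false] ++ Lv.map Sum.inl) h := by
  rw [List.append_assoc]
  refine chain_rotate (P := Sum.inr true) (A := [.inr true, .inr false] ++ Lv.map Sum.inl) ?_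
  rw [List.append_assoc, ← List.map_append, List.cons_append, List.cons_append, List.nil_append,
    chain_cons, chain_cons]
  refine ⟨rfl, (spikeNext_true _ _).symm, ?_⟩
  rcases spike_cases hL hD hP with ⟨rfl, rfl, hE⟩ | ⟨T0, c, h, hc, hch, ht, hcb, hT⟩
  · exact spikeNext_none_false _
  · rw [addSpikeNext, hc, h, spikeNext_some_false, List.map_append, chain_append]
    refine ⟨.inl c, hch.map Sum.inl Sum.inl (fun _ _ => rfl) ?_, rfl, spikeNext_some_self _ _⟩
    intro a ha
    exact spikeNext_inl _ _ _ (by simp only [Option.mem_def, Option.some.injEq]; rintro rfl; exact hT ha)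

include hL hD hP in
lemma spike_next_of_mem_bd {f : Δ.F} {d : Δ.D} (hd : d ∈ Δ.bd f) :
    addSpikeNext Lu Lv (.inl d) = .inl (Δ.next d) := by
  rcases spike_cases hL hD hP with ⟨rfl, rfl, hE⟩ | ⟨T0, c, h, hc, hch, ht, hcb, hT⟩
  · exact hE.elim d
  · rw [addSpikeNext, hc]
    refine spikeNext_inl _ _ _ ?_
    simp only [Option.mem_def, Option.some.injEq]
    rintro rfl
    exact region_of_mem_bd hd hcb

include hL hD hP in
-- Around `P` the new edge is inserted between `inv c` and `next c`; other old cycles do not change,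
-- and a single edge leaves the new vertex.
lemma spike_rotation (d d' : Δ.D ⊕ Bool)
    (hd : (Δ.toTwoComplex.addSpike P).src d = (Δ.toTwoComplex.addSpike P).src d') :
    Equiv.Perm.SameCycle ((Function.Involutive.toPerm (Δ.toTwoComplex.addSpike P).inv
      (Δ.toTwoComplex.addSpike P).inv_inv).trans (addSpikeNext Lu Lv)) d d' := by
  set ρ : Equiv.Perm (Δ.D ⊕ Bool) := ((Function.Involutive.toPerm (Δ.toTwoComplex.addSpike P).inv
      (Δ.toTwoComplex.addSpike P).inv_inv).trans (addSpikeNext Lu Lv)) with hρ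
  have step : ∀ x, ρ.SameCycle x (ρ x) := fun x =>
    Equiv.Perm.sameCycle_apply_right.mpr (Equiv.Perm.SameCycle.refl _ _)
  have hinl : ∀ x : Δ.D, ρ (.inl x) = addSpikeNext Lu Lv (.inl (Δ.inv x)) := fun x => rfl
  have htrue : ρ (.inr true) = addSpikeNext Lu Lv (.inr false) := rfl
  rcases spike_cases hL hD hP with ⟨rfl, rfl, hE⟩ | ⟨T0, c, h, hc, hch, ht, hcb, hT⟩
  · rcases d with d | _ | _
    · exact hE.elim d
    · rcases d' with d | _ | _
      · exact hE.elim d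
      · exact Equiv.Perm.SameCycle.refl _ _
      · simp [TwoComplex.addSpike] at hd
    · rcases d' with d | _ | _
      · exact hE.elim d
      · simp [TwoComplex.addSpike] at hd
      · exact Equiv.Perm.SameCycle.refl _ _
  · simp only [addSpikeNext, hc] at hinl htrue
    have hold : ∀ x x' : Δ.D, Δ.src x = Δ.src x' → ρ.SameCycle (.inl x) (.inl x') := by
      intro x x' hx
      refine sameCycle_map Sum.inl ?_ (Δ.rotation x x' hx)
      intro y
      have hy : (Function.Involutive.toPerm Δ.inv Δ.inv_inv).trans Δ.next y = Δ.next (Δ.inv y) := rfl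
      rw [hy]
      by_cases hyc : Δ.inv y = c
      · have h1 := step (.inl y)
        have h2 := step (.inr true)
        rw [hinl, hyc, spikeNext_some_self] at h1
        rw [htrue, spikeNext_some_false] at h2
        rw [hyc]
        exact h1.trans h2
      · have h1 := step (.inl y)
        rwa [hinl, spikeNext_inl _ _ _ (by simpa [eq_comm] using hyc)] at h1
    have hnew : ∀ x : Δ.D, Δ.src x = P → ρ.SameCycle (.inl x) (.inr true) := by
      intro x hx
      have h1 := step (.inl (Δ.inv c))
      rw [hinl, Δ.inv_inv, spikeNext_some_self] at h1
      exact (hold x (Δ.inv c) (hx.trans ht.symm)).trans h1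
    rcases d with d | _ | _ <;> rcases d' with d' | _ | _
    · exact hold d d' (Option.some_injective _ hd)
    · simp [TwoComplex.addSpike] at hd
    · exact hnew d (Option.some_injective _ hd)
    · simp [TwoComplex.addSpike] at hd
    · exact Equiv.Perm.SameCycle.refl _ _
    · simp [TwoComplex.addSpike] at hd
    · exact (hnew d' (Option.some_injective _ hd.symm)).symm
    · simp [TwoComplex.addSpike] at hd
    · exact Equiv.Perm.SameCycle.refl _ _

lemma spike_connected (P : Δ.V) : (Δ.toTwoComplex.addSpike P).graph.Connected := by
  rw [SimpleGraph.connected_iff_exists_forall_reachable]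
  refine ⟨some P, fun v => ?_⟩
  cases v with
  | some v => exact (Δ.toTwoComplex.addSpikeEmbedding P).reachable Δ.connected P v
  | none =>
    have h : (Δ.toTwoComplex.addSpike P).graph.Adj (some P) none :=
      ⟨by simp, .inr true, rfl, rfl⟩
    exact h.reachable

/-- The diagram with a new edge attached at a vertex of the boundary. -/
def addSpike (x : α × Bool) :
    VanKampenDiagram S (Lu.map Δ.label ++ [x, letterInv x] ++ Lv.map Δ.label) where
  toTwoComplex := Δ.toTwoComplex.addSpike P
  finite_V := have := Δ.finite_V; inferInstanceAs (Finite (Option Δ.V))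
  finite_D := have := Δ.finite_D; inferInstanceAs (Finite (Δ.D ⊕ Bool))
  finite_F := Δ.finite_F
  base := some Δ.base
  label := Sum.elim Δ.label (fun b => cond b x (letterInv x))
  label_inv := by
    rintro (d | b)
    · exact Δ.label_inv d
    · cases b <;> simp [letterInv]
  label_bd f := by
    have := Δ.label_bd f
    simpa using this
  boundary := Lu.map Sum.inl ++ [.inr true, .inr false] ++ Lv.map Sum.inl
  boundary_start := by
    intro d hd
    cases Lu with
    | nil =>
      obtain rfl : Sum.inr true = d := by simpa using hd
      exact congrArg some hP.symm
    | cons a Lu =>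
      obtain rfl : Sum.inl a = d := by simpa using hd
      exact congrArg some hP.1
  boundary_label := by simp
  next := addSpikeNext Lu Lv
  region := Sum.elim Δ.region (fun _ => none)
  src_next := spike_src_next hL hD hP
  bd_nodup f := (Δ.bd_nodup f).map Sum.inl_injective
  mem_bd := by
    rintro f (d | b)
    · simp [Δ.mem_bd]
    · simp
  next_bd := by
    intro f i hi
    have hi' : i < (Δ.bd f).length := by simpa using hi
    have h := spike_next_of_mem_bd hL hD hP (List.getElem_mem hi')
    rw [Δ.next_bd f i hi'] at h
    simpa using h
  boundary_nodup := by
    have h := Δ.boundary_nodup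
    rw [hL] at h
    have h2 : (Lu.map Sum.inl ++ Lv.map Sum.inl ++ [.inr true, .inr false] :
        List (Δ.D ⊕ Bool)).Nodup := by
      rw [← List.map_append, List.nodup_append]
      exact ⟨h.map Sum.inl_injective, by simp, by simp⟩
    refine List.Perm.nodup_iff ?_ |>.mp h2
    rw [List.append_assoc, List.append_assoc]
    exact List.Perm.append_left _ List.perm_append_comm
  mem_boundary := by
    rintro (d | b)
    · have := Δ.mem_boundary d
      rw [hL] at this
      simpa using this
    · cases b <;> simp
  next_boundary := by
    obtain ⟨h, hch⟩ := spike_boundary_chain hL hD hP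
    exact hch.getElem
  rotation := spike_rotation hL hD hP
  connected := spike_connected P
  euler := by
    have := Δ.finite_V
    have := Δ.finite_D
    have h := Δ.euler
    change 2 * Nat.card (Option Δ.V) + 2 * Nat.card Δ.F = Nat.card (Δ.D ⊕ Bool) + 2
    rw [Finite.card_option, Nat.card_sum, Nat.card_eq_fintype_card (α := Bool), Fintype.card_bool]
    omega

end spike

end VanKampenDiagram

namespace VanKampenDiagram

variable {α : Type} {S : Set (Word α)} {w : Word α} {Δ : VanKampenDiagram S w}

/-! ### Attaching a 2-cell -/

section face

variable {Lu l0 Lv : List Δ.D} {z : Δ.D} (hL : Δ.boundary = Lu ++ (l0 ++ [z]) ++ Lv)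
    {P Q : Δ.V} (hP : Δ.Walk Δ.base Lu P) (hQ : Δ.Walk P (l0 ++ [z]) Q)

/-- The last edge of the boundary path in front of the segment to which a 2-cell is attached. -/
abbrev facePred (Lu Lv : List Δ.D) (z : Δ.D) : Δ.D := (Lv ++ Lu).getLast?.getD z

/-- The successor permutation after attaching a 2-cell. -/
abbrev addFaceNext (Lu Lv : List Δ.D) (z : Δ.D) : Equiv.Perm (Δ.D ⊕ Bool) :=
  faceNext Δ.next (facePred Lu Lv z) z

open Classical in
/-- The regions after attaching a 2-cell. -/
def addFaceRegion (l : List Δ.D) : Δ.D ⊕ Bool → Option (Option Δ.F) :=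
  Sum.elim (fun d => if d ∈ l then some none else (Δ.region d).map some)
    (fun b => cond b none (some none))

include hL hP hQ in
-- The edge `c` precedes the segment on the outer walk and therefore ends at `P`. If the segment is
-- the whole boundary, its cyclic predecessor is its own last edge `z`, which explains the default
-- value in `facePred`.
lemma face_cases : ∃ c, facePred Lu Lv z = c ∧ Chain id Δ.next (Δ.next c) l0 z ∧
    Δ.tgt c = P ∧ Δ.tgt z = Q ∧ c ∈ Δ.boundary ∧ c ∉ l0 ∧ z ∉ l0 ∧
    ((c = z ∧ Lu = [] ∧ Lv = []) ∨
      (c ≠ z ∧ ∃ T0, Lv ++ Lu = T0 ++ [c] ∧ Chain id Δ.next (Δ.next z) T0 c ∧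
        c ∉ T0 ∧ z ∉ T0)) := by
  have hL' : Δ.boundary = Lu ++ ((l0 ++ [z]) ++ Lv) := by rw [hL, List.append_assoc]
  have hperm : (l0 ++ [z] ++ (Lv ++ Lu)).Perm Δ.boundary := by
    rw [hL', ← List.append_assoc]; exact List.perm_append_comm
  have hz : z ∈ Δ.boundary := by rw [hL]; simp
  have hnd : (l0 ++ [z] ++ (Lv ++ Lu)).Nodup := hperm.nodup_iff.mpr Δ.boundary_nodup
  obtain ⟨hnd1, hnd2, hnd3⟩ := List.nodup_append.mp hnd
  have hzl : z ∉ l0 := fun h => (List.nodup_append.mp hnd1).2.2 z h z (by simp) rfl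
  obtain ⟨h, hh, hch⟩ := exists_chain_rotate hL' (List.ne_nil_of_mem hz) hP
  rw [List.append_assoc] at hch
  obtain ⟨b, h1, h2⟩ := chain_append.mp hch
  have h3 := Δ.walk_of_chain h1
  rw [hh] at h3
  have hbQ := h3.eq_end hQ
  obtain ⟨z', h4, rfl, h5⟩ := chain_append.mp h1
  have h5 : Δ.next z = b := h5
  subst h5
  simp only [id_eq] at h4
  rcases List.eq_nil_or_concat' (Lv ++ Lu) with h | ⟨T0, c, h⟩
  · rw [h] at h2
    have h2 : Δ.next z = _ := h2
    subst h2
    obtain ⟨rfl, rfl⟩ := List.append_eq_nil_iff.mp h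
    exact ⟨z, rfl, h4, by rw [tgt_eq_src_next, hh], by rw [tgt_eq_src_next, hbQ], hz, hzl,
      hzl, Or.inl ⟨rfl, rfl, rfl⟩⟩
  · have hcT : c ∈ Lv ++ Lu := by rw [h]; simp
    rw [h] at h2
    obtain ⟨c', h6, rfl, h7⟩ := chain_append.mp h2
    have h7 : Δ.next c = _ := h7
    subst h7
    rw [h] at hnd2
    refine ⟨c, by rw [facePred, h]; simp, h4, by rw [tgt_eq_src_next, hh],
      by rw [tgt_eq_src_next, hbQ], hperm.mem_iff.mp (List.mem_append_right _ hcT),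
      fun hc => hnd3 c (by simp [hc]) c hcT rfl, hzl,
      Or.inr ⟨fun hc => hnd3 c (by simp [hc]) c hcT rfl, T0, h, h6, ?_, ?_⟩⟩
    · exact fun hc => (List.nodup_append.mp hnd2).2.2 c hc c (by simp) rfl
    · exact fun hc => hnd3 z (by simp) z (by rw [h]; simp [hc]) rfl

include hL hP hQ in
lemma face_src_next (d : Δ.D ⊕ Bool) :
    (Δ.toTwoComplex.addFace hQ).src (addFaceNext Lu Lv z d) =
    (Δ.toTwoComplex.addFace hQ).src ((Δ.toTwoComplex.addFace hQ).inv d) := by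
  obtain ⟨c, hc, hch, htc, htz, hcb, hcl, hzl, h⟩ := face_cases hL hP hQ
  rw [addFaceNext, hc]
  rcases d with d | _ | _
  · by_cases hdz : d = z
    · subst hdz
      rw [faceNext_end]
      exact htz.symm
    by_cases hdc : d = c
    · subst hdc
      rw [faceNext_start _ hdz]
      exact htc.symm
    · rw [faceNext_inl _ hdc hdz]
      exact Δ.src_next d
  · rw [faceNext_false]
    exact (Δ.src_next c).trans htc
  · rcases h with ⟨rfl, h⟩ | ⟨hcz, h⟩
    · rw [faceNext_true_self]
      exact htc.symm.trans htz
    · rw [faceNext_true _ hcz]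
      exact (Δ.src_next z).trans htz

include hL hP hQ in
lemma face_boundary_chain : ∃ h, Chain id (addFaceNext Lu Lv z) h
    (Lu.map Sum.inl ++ [.inr true] ++ Lv.map Sum.inl) h := by
  obtain ⟨c, hc, hch, htc, htz, hcb, hcl, hzl, h⟩ := face_cases hL hP hQ
  rw [List.append_assoc]
  refine chain_rotate (P := Sum.inr true) (A := [.inr true] ++ Lv.map Sum.inl) ?_
  rw [List.append_assoc, ← List.map_append, List.cons_append, List.nil_append, chain_cons,
    addFaceNext, hc]
  refine ⟨rfl, ?_⟩
  rcases h with ⟨rfl, rfl, rfl⟩ | ⟨hcz, T0, hT, hchT, hcT, hzT⟩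
  · exact faceNext_true_self _
  · rw [hT, faceNext_true _ hcz, List.map_append, chain_append]
    refine ⟨.inl c, hchT.map Sum.inl Sum.inl (fun _ _ => rfl) ?_, rfl, faceNext_start _ hcz⟩
    intro a ha
    exact faceNext_inl _ (by rintro rfl; exact hcT ha) (by rintro rfl; exact hzT ha)

include hL hP hQ in
lemma face_bd_chain : ∃ h, Chain id (addFaceNext Lu Lv z) h
    ((l0 ++ [z]).map Sum.inl ++ [.inr false]) h := by
  obtain ⟨c, hc, hch, htc, htz, hcb, hcl, hzl, h⟩ := face_cases hL hP hQ
  refine ⟨.inl (Δ.next c), ?_⟩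
  rw [List.map_append, chain_append, addFaceNext, hc]
  refine ⟨.inr false, ?_, rfl, faceNext_false _ _ _⟩
  rw [chain_append]
  refine ⟨.inl z, hch.map Sum.inl Sum.inl (fun _ _ => rfl) ?_, rfl, faceNext_end _ _ _⟩
  intro a ha
  exact faceNext_inl _ (by rintro rfl; exact hcl ha) (by rintro rfl; exact hzl ha)

include hL hP hQ in
lemma face_next_of_mem_bd {f : Δ.F} {d : Δ.D} (hd : d ∈ Δ.bd f) :
    addFaceNext Lu Lv z (.inl d) = .inl (Δ.next d) := by
  obtain ⟨c, hc, hch, htc, htz, hcb, hcl, hzl, h⟩ := face_cases hL hP hQ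
  rw [addFaceNext, hc]
  refine faceNext_inl _ ?_ ?_
  · rintro rfl
    exact region_of_mem_bd hd hcb
  · rintro rfl
    exact region_of_mem_bd hd (by rw [hL]; simp)

include hL hP in
-- The new edge enters the rotation at `P` between `inv c` and `next c`, and at `Q` between `inv z`
-- and `next z`. If `c = z`, both of its ends enter the same corner, one after the other.
lemma face_rotation (d d' : Δ.D ⊕ Bool)
    (hd : (Δ.toTwoComplex.addFace hQ).src d = (Δ.toTwoComplex.addFace hQ).src d') :
    Equiv.Perm.SameCycle ((Function.Involutive.toPerm (Δ.toTwoComplex.addFace hQ).inv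
      (Δ.toTwoComplex.addFace hQ).inv_inv).trans (addFaceNext Lu Lv z)) d d' := by
  set ρ : Equiv.Perm (Δ.D ⊕ Bool) := ((Function.Involutive.toPerm (Δ.toTwoComplex.addFace hQ).inv
      (Δ.toTwoComplex.addFace hQ).inv_inv).trans (addFaceNext Lu Lv z)) with hρ
  have step : ∀ x, ρ.SameCycle x (ρ x) := fun x =>
    Equiv.Perm.sameCycle_apply_right.mpr (Equiv.Perm.SameCycle.refl _ _)
  have hinl : ∀ x : Δ.D, ρ (.inl x) = addFaceNext Lu Lv z (.inl (Δ.inv x)) := fun x => rfl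
  have htrue : ρ (.inr true) = addFaceNext Lu Lv z (.inr false) := rfl
  have hfalse : ρ (.inr false) = addFaceNext Lu Lv z (.inr true) := rfl
  obtain ⟨c, hc, hch, htc, htz, hcb, hcl, hzl, h⟩ := face_cases hL hP hQ
  simp only [addFaceNext, hc] at hinl htrue hfalse
  have h1 := step (.inl (Δ.inv z))
  rw [hinl, Δ.inv_inv, faceNext_end] at h1
  have h2 := step (.inr true)
  rw [htrue, faceNext_false] at h2
  have h3 := step (.inr false)
  have hc1 : ρ.SameCycle (.inl (Δ.inv c)) (.inr true) := by
    rcases h with ⟨rfl, h⟩ | ⟨hcz, h⟩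
    · rw [hfalse, faceNext_true_self] at h3
      exact h1.trans h3
    · have h4 := step (.inl (Δ.inv c))
      rwa [hinl, Δ.inv_inv, faceNext_start _ hcz] at h4
  have hz1 : ρ.SameCycle (.inr false) (.inl (Δ.next z)) := by
    rcases h with ⟨rfl, h⟩ | ⟨hcz, h⟩
    · rw [hfalse, faceNext_true_self] at h3
      exact h3.trans h2
    · rwa [hfalse, faceNext_true _ hcz] at h3
  have hold : ∀ x x' : Δ.D, Δ.src x = Δ.src x' → ρ.SameCycle (.inl x) (.inl x') := by
    intro x x' hx
    refine sameCycle_map Sum.inl ?_ (Δ.rotation x x' hx)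
    intro y
    have hy : (Function.Involutive.toPerm Δ.inv Δ.inv_inv).trans Δ.next y = Δ.next (Δ.inv y) := rfl
    rw [hy]
    by_cases hyz : Δ.inv y = z
    · obtain rfl : y = Δ.inv z := by rw [← hyz, Δ.inv_inv]
      rw [Δ.inv_inv]
      exact h1.trans hz1
    by_cases hyc : Δ.inv y = c
    · obtain rfl : y = Δ.inv c := by rw [← hyc, Δ.inv_inv]
      rw [Δ.inv_inv]
      exact hc1.trans h2
    · have h1 := step (.inl y)
      rwa [hinl, faceNext_inl _ hyc hyz] at h1
  have hnew : ∀ (x : Δ.D) (b : Bool), Δ.src x = cond b P Q → ρ.SameCycle (.inl x) (.inr b) := by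
    intro x b hx
    cases b with
    | true => exact (hold x (Δ.inv c) (hx.trans htc.symm)).trans hc1
    | false => exact (hold x (Δ.inv z) (hx.trans htz.symm)).trans h1
  rcases d with d | b <;> rcases d' with d' | b'
  · exact hold d d' hd
  · exact hnew d b' hd
  · exact (hnew d' b hd.symm).symm
  · have hbb : cond b P Q = cond b' P Q := hd
    -- Two new directed edges at one vertex are compared through an old edge leaving it.
    have hx : ∃ x : Δ.D, Δ.src x = cond b P Q := by
      cases b
      · exact ⟨Δ.inv z, htz⟩
      · exact ⟨Δ.inv c, htc⟩
    obtain ⟨x, hx⟩ := hx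
    exact (hnew x b hx).symm.trans (hnew x b' (hx.trans hbb))

lemma face_connected : (Δ.toTwoComplex.addFace hQ).graph.Connected := by
  refine Δ.connected.mono ?_
  rintro u v ⟨h, d, hd⟩
  exact ⟨h, .inl d, hd⟩

/-- The diagram with a new 2-cell and a new edge attached along a segment of the boundary. -/
def addFace (x : α × Bool)
    (hx : (l0 ++ [z]).map Δ.label ++ [letterInv x] ∈ symmetrize S) :
    VanKampenDiagram S (Lu.map Δ.label ++ [x] ++ Lv.map Δ.label) where
  toTwoComplex := Δ.toTwoComplex.addFace hQ
  finite_V := Δ.finite_V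
  finite_D := have := Δ.finite_D; inferInstanceAs (Finite (Δ.D ⊕ Bool))
  finite_F := have := Δ.finite_F; inferInstanceAs (Finite (Option Δ.F))
  base := Δ.base
  label := Sum.elim Δ.label (fun b => cond b x (letterInv x))
  label_inv := by
    rintro (d | b)
    · exact Δ.label_inv d
    · cases b <;> simp [letterInv]
  label_bd f := by
    cases f with
    | none => simpa using hx
    | some f => simpa using Δ.label_bd f
  boundary := Lu.map Sum.inl ++ [.inr true] ++ Lv.map Sum.inl
  boundary_start := by
    intro d hd
    cases Lu with
    | nil =>
      obtain rfl : Sum.inr true = d := by simpa using hd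
      exact hP.symm
    | cons a Lu =>
      obtain rfl : Sum.inl a = d := by simpa using hd
      exact hP.1
  boundary_label := by simp
  next := addFaceNext Lu Lv z
  region := addFaceRegion (l0 ++ [z])
  src_next := face_src_next hL hP hQ
  bd_nodup f := by
    cases f with
    | none =>
      have h := Δ.boundary_nodup
      rw [hL] at h
      have h2 := (List.nodup_append.mp (List.nodup_append.mp h).1).2.1
      have h3 := h2.map (Sum.inl_injective (β := Bool))
      refine List.nodup_append.mpr ⟨h3, by simp, by simp⟩
    | some f => exact (Δ.bd_nodup f).map Sum.inl_injective
  mem_bd := by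
    have hl : ∀ d ∈ l0 ++ [z], Δ.region d = none := by
      intro d hd
      rw [← Δ.mem_boundary, hL]
      exact List.mem_append_left _ (List.mem_append_right _ hd)
    rintro (_ | f) (d | b)
    · by_cases h : d ∈ l0 ++ [z]
      · simp only [addFaceRegion, Sum.elim_inl, if_pos h]
        simpa using h
      · simp only [addFaceRegion, Sum.elim_inl, if_neg h]
        simpa using h
    · cases b <;> simp [addFaceRegion]
    · by_cases h : d ∈ l0 ++ [z]
      · simp only [addFaceRegion, Sum.elim_inl, if_pos h]
        simp [Δ.mem_bd, hl d h]
      · simp only [addFaceRegion, Sum.elim_inl, if_neg h]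
        simp [Δ.mem_bd]
    · cases b <;> simp [addFaceRegion]
  next_bd := by
    rintro (_ | f) i hi
    · obtain ⟨h, hch⟩ := face_bd_chain hL hP hQ
      exact hch.getElem i hi
    · have hi' : i < (Δ.bd f).length := by simpa using hi
      have h := face_next_of_mem_bd hL hP hQ (List.getElem_mem hi')
      rw [Δ.next_bd f i hi'] at h
      simpa using h
  boundary_nodup := by
    have h := Δ.boundary_nodup
    rw [hL, List.append_assoc] at h
    have h1 := h.sublist (List.Sublist.append_left (List.sublist_append_right (l0 ++ [z]) Lv) Lu)
    have h2 : (Lu.map Sum.inl ++ Lv.map Sum.inl ++ [.inr true] : List (Δ.D ⊕ Bool)).Nodup := by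
      rw [← List.map_append, List.nodup_append]
      exact ⟨h1.map Sum.inl_injective, by simp, by simp⟩
    refine List.Perm.nodup_iff ?_ |>.mp h2
    rw [List.append_assoc, List.append_assoc]
    exact List.Perm.append_left _ List.perm_append_comm
  mem_boundary := by
    have hnd := Δ.boundary_nodup
    rw [hL, List.append_assoc] at hnd
    rintro (d | b)
    · have hm := Δ.mem_boundary d
      rw [hL] at hm
      by_cases h : d ∈ l0 ++ [z]
      · have h1 : d ∉ Lu := fun h' =>
          (List.nodup_append.mp hnd).2.2 d h' d (List.mem_append_left _ h) rfl
        have h2 : d ∉ Lv := fun h' =>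
          (List.nodup_append.mp (List.nodup_append.mp hnd).2.1).2.2 d h d h' rfl
        simp only [addFaceRegion, Sum.elim_inl, if_pos h]
        simp [h1, h2]
      · have h3 : d ∈ Lu ++ (l0 ++ [z]) ++ Lv ↔ d ∈ Lu ∨ d ∈ Lv := by
          rw [List.mem_append, List.mem_append]; tauto
        rw [h3] at hm
        simp only [addFaceRegion, Sum.elim_inl, if_neg h]
        simpa using hm
    · cases b <;> simp [addFaceRegion]
  next_boundary := by
    obtain ⟨h, hch⟩ := face_boundary_chain hL hP hQ
    exact hch.getElem
  rotation := face_rotation hL hP hQ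
  connected := face_connected hQ
  euler := by
    have := Δ.finite_F
    have := Δ.finite_D
    have h := Δ.euler
    change 2 * Nat.card Δ.V + 2 * Nat.card (Option Δ.F) = Nat.card (Δ.D ⊕ Bool) + 2
    rw [Finite.card_option, Nat.card_sum, Nat.card_eq_fintype_card (α := Bool), Fintype.card_bool]
    omega

end face

end VanKampenDiagram

/-! ### Concatenation of families of paths -/

section concat

variable {X Z : Type*} [TopologicalSpace X] [TopologicalSpace Z]

/-- The map `s ↦ min (2 s) 1`. -/
def firstHalf : C(I, I) := ⟨fun s => Set.projIcc 0 1 zero_le_one (2 * (s : ℝ)), by fun_prop⟩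

/-- The map `s ↦ max (2 s - 1) 0`. -/
def secondHalf : C(I, I) := ⟨fun s => Set.projIcc 0 1 zero_le_one (2 * (s : ℝ) - 1), by fun_prop⟩

lemma firstHalf_monotone : Monotone firstHalf := fun s t h =>
  Set.monotone_projIcc zero_le_one (by have : (s : ℝ) ≤ t := h; linarith)

lemma secondHalf_monotone : Monotone secondHalf := fun s t h =>
  Set.monotone_projIcc zero_le_one (by have : (s : ℝ) ≤ t := h; linarith)

lemma firstHalf_of_half_le {s : I} (h : 1 / 2 ≤ (s : ℝ)) : firstHalf s = 1 :=
  Set.projIcc_of_right_le zero_le_one (by linarith)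

lemma secondHalf_of_le_half {s : I} (h : (s : ℝ) ≤ 1 / 2) : secondHalf s = 0 :=
  Set.projIcc_of_le_left zero_le_one (by linarith)

@[simp] lemma firstHalf_zero : firstHalf 0 = 0 := Set.projIcc_of_le_left zero_le_one (by simp)

@[simp] lemma firstHalf_one : firstHalf 1 = 1 := firstHalf_of_half_le (by norm_num)

@[simp] lemma secondHalf_one : secondHalf 1 = 1 := Set.projIcc_of_right_le zero_le_one (by norm_num)

/-- The concatenation of two families of paths. -/
def concat (A B : C(X, C(I, Z))) (h : ∀ x, A x 1 = B x 0) : C(X, C(I, Z)) :=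
  ContinuousMap.curry ⟨fun p : X × I =>
    if (p.2 : ℝ) ≤ 1 / 2 then A p.1 (firstHalf p.2) else B p.1 (secondHalf p.2), by
      refine Continuous.if_le ?_ ?_ (by fun_prop) continuous_const ?_
      · fun_prop
      · fun_prop
      · intro p hp
        rw [firstHalf_of_half_le hp.ge, secondHalf_of_le_half hp.le, h]⟩

variable {A B : C(X, C(I, Z))} {h : ∀ x, A x 1 = B x 0}

lemma concat_apply (x : X) (s : I) : concat A B h x s =
    if (s : ℝ) ≤ 1 / 2 then A x (firstHalf s) else B x (secondHalf s) := rfl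

@[simp] lemma concat_zero (x : X) : concat A B h x 0 = A x 0 := by
  rw [concat_apply, if_pos (by norm_num), firstHalf_zero]

@[simp] lemma concat_one (x : X) : concat A B h x 1 = B x 1 := by
  rw [concat_apply, if_neg (by norm_num), secondHalf_one]

/-- This is why `pushPath` runs old paths in half of the time: where the second stage is stationary,
the combing of a new edge agrees with them exactly, so that the families stay compatible. -/
lemma concat_of_const {x : X} (hB : ∀ s, B x s = B x 0) (s : I) :
    concat A B h x s = A x (firstHalf s) := by
  rw [concat_apply]
  split_ifs with hs
  · rfl
  · rw [firstHalf_of_half_le (by linarith), hB, h]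

lemma concat_forall {P : Z → Prop} {x : X} (hA : ∀ s, P (A x s)) (hB : ∀ s, P (B x s)) (s : I) :
    P (concat A B h x s) := by
  rw [concat_apply]
  split_ifs
  · exact hA _
  · exact hB _

lemma concat_monotone {β : Z → ℕ} {x : X} (hA : Monotone fun s => β (A x s))
    (hB : Monotone fun s => β (B x s)) : Monotone fun s => β (concat A B h x s) := by
  intro s t hst
  have hst' : (s : ℝ) ≤ t := hst
  simp only [concat_apply]
  split_ifs with h1 h2 h2
  · exact hA (firstHalf_monotone hst)
  · refine (hA (b := 1) unitInterval.le_one').trans ?_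
    simp only [h x]
    exact hB unitInterval.nonneg'
  · linarith
  · exact hB (secondHalf_monotone hst)

end concat

namespace TwoComplex.Embedding

variable {Y Y' : TwoComplex} (i : Embedding Y Y')

/-- The map of realizations, as a continuous map. -/
def mapC : C(Y.Realization, Y'.Realization) := ⟨i.map, i.continuous_map⟩

/-- The map of paths induced by an embedding. -/
def mapPath : C(C(I, Y.Realization), C(I, Y'.Realization)) :=
  ⟨fun γ => i.mapC.comp γ, ContinuousMap.continuous_postcomp _⟩

@[simp] lemma mapPath_apply (γ : C(I, Y.Realization)) (s : I) : i.mapPath γ s = i.map (γ s) := rfl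

/-- The map of paths induced by an embedding, where the paths are run through in half of the
time. -/
def pushPath : C(C(I, Y.Realization), C(I, Y'.Realization)) :=
  ⟨fun γ => (i.mapPath γ).comp firstHalf,
    (ContinuousMap.continuous_precomp _).comp i.mapPath.continuous⟩

@[simp] lemma pushPath_apply (γ : C(I, Y.Realization)) (s : I) :
    i.pushPath γ s = i.map (γ (firstHalf s)) := rfl

end TwoComplex.Embedding

/-! ### Combed diagrams -/

section

variable {α : Type} {G : Type} [Group G]

/-- The value of a letter. -/
def letterValue (φ : α → G) (x : α × Bool) : G := cond x.2 (φ x.1) (φ x.1)⁻¹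

@[simp] lemma letterValue_letterInv (φ : α → G) (x : α × Bool) :
    letterValue φ (letterInv x) = (letterValue φ x)⁻¹ := by
  rcases x with ⟨a, _ | _⟩ <;> simp [letterValue, letterInv]

/-- The value of a word. -/
def wordProd (φ : α → G) (w : Word α) : G := (w.map (letterValue φ)).prod

@[simp] lemma wordProd_nil (φ : α → G) : wordProd φ [] = 1 := rfl

@[simp] lemma wordProd_cons (φ : α → G) (x : α × Bool) (w : Word α) :
    wordProd φ (x :: w) = letterValue φ x * wordProd φ w := by simp [wordProd]

@[simp] lemma wordProd_append (φ : α → G) (u v : Word α) :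
    wordProd φ (u ++ v) = wordProd φ u * wordProd φ v := by simp [wordProd]

lemma wordProd_eq_lift (φ : α → G) (w : Word α) :
    wordProd φ w = FreeGroup.lift φ (FreeGroup.mk w) := by
  rw [FreeGroup.lift_mk]; rfl

end

/-- A van Kampen diagram with a combing of its 1-skeleton, along which the weights given by a function
on the group do not decrease and bound the distances from the basepoint. -/
structure CombedDiagram {α : Type} (S : Set (Word α)) {G : Type} [Group G] (φ : α → G) (M : G → ℕ)
    (w : Word α) where
  diagram : VanKampenDiagram S w
  isEmpty_of_nil : diagram.boundary = [] → IsEmpty diagram.D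
  val : diagram.V → G
  val_base : val diagram.base = 1
  val_tgt : ∀ d, val (diagram.tgt d) = val (diagram.src d) * letterValue φ (diagram.label d)
  faceWeight : diagram.F → ℕ
  le_faceWeight : ∀ f, ∀ d ∈ diagram.bd f, M (val (diagram.src d)) ≤ faceWeight f
  faceWeight_le : ∀ f, ∃ d ∈ diagram.bd f, faceWeight f ≤ M (val (diagram.src d))
  dist_lt : ∀ v, diagram.graph.dist diagram.base v + 1 ≤ M (val v)
  combing : diagram.SkeletonCombing diagram.base
  monotone_vertex : ∀ v, Monotone fun s =>
    TwoComplex.weight (fun v => M (val v)) faceWeight (combing.atVertex v s)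
  monotone_edge : ∀ d x, Monotone fun s =>
    TwoComplex.weight (fun v => M (val v)) faceWeight (combing.atEdge d x s)

namespace CombedDiagram

variable {α : Type} {S : Set (Word α)} {G : Type} [Group G] {φ : α → G} {M : G → ℕ} {w : Word α}

lemma val_walk (K : CombedDiagram S φ M w) {P Q : K.diagram.V} {L : List K.diagram.D}
    (h : K.diagram.Walk P L Q) : K.val Q = K.val P * wordProd φ (L.map K.diagram.label) := by
  induction L generalizing P with
  | nil => simpa using congrArg K.val h.symm
  | cons a L ih =>
    obtain ⟨rfl, h⟩ := h
    rw [ih h, K.val_tgt]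
    simp [mul_assoc]

lemma exists_walk (K : CombedDiagram S φ M w) {Lu Lv : List K.diagram.D}
    (h : K.diagram.boundary = Lu ++ Lv) : ∃ P, K.diagram.Walk K.diagram.base Lu P ∧
      K.diagram.Walk P Lv K.diagram.base ∧ K.val P = wordProd φ (Lu.map K.diagram.label) := by
  have := K.diagram.boundary_walk
  rw [h] at this
  obtain ⟨P, h1, h2⟩ := chain_append.mp this
  exact ⟨P, h1, h2, by rw [K.val_walk h1, K.val_base, one_mul]⟩

/-- The word on the boundary represents the identity. -/
lemma wordProd_eq_one (K : CombedDiagram S φ M w) : wordProd φ w = 1 := by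
  have := K.val_walk K.diagram.boundary_walk
  rw [K.diagram.boundary_label] at this
  exact (mul_eq_left.mp this.symm)

end CombedDiagram

/-! ### Extending a combing over a new edge -/

namespace TwoComplex

variable {Y : TwoComplex} {y : Y.V} (K : Y.SkeletonCombing y)

lemma SkeletonCombing.edge_start (d : Y.D) : K.atEdge d 0 = K.atVertex (Y.src d) :=
  K.compatible.start d

lemma SkeletonCombing.edge_inv (d : Y.D) (x : I) :
    K.atEdge (Y.inv d) (unitInterval.symm x) = K.atEdge d x := K.compatible.reverse d x

lemma SkeletonCombing.edge_end (d : Y.D) : K.atEdge d 1 = K.atVertex (Y.tgt d) :=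
  K.compatible.finish d

variable (Y) in
/-- The paths from the start of an edge to its points. -/
def edgePaths (d : Y.D) : C(I, C(I, Y.Realization)) :=
  ContinuousMap.curry ⟨fun p : I × I => Y.edgePt d (p.1 * p.2),
    (Y.continuous_edgePt d).comp (by fun_prop)⟩

@[simp] lemma edgePaths_apply (d : Y.D) (x s : I) : Y.edgePaths d x s = Y.edgePt d (x * s) := rfl

section spike

variable (P : Y.V)

/-- The combing of a new edge attached at `P`. -/
def SkeletonCombing.spikeEdge : C(I, C(I, (Y.addSpike P).Realization)) :=
  concat (ContinuousMap.const I ((Y.addSpikeEmbedding P).mapPath (K.atVertex P)))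
    ((Y.addSpike P).edgePaths (.inr true)) (by
      intro x
      simp only [ContinuousMap.const_apply, Embedding.mapPath_apply, K.vertex_one,
        Embedding.map_vertexPt, edgePaths_apply, mul_zero, edgePt_zero]
      rfl)

lemma SkeletonCombing.spikeEdge_zero :
    K.spikeEdge P 0 = (Y.addSpikeEmbedding P).pushPath (K.atVertex P) := by
  ext s
  rw [SkeletonCombing.spikeEdge, concat_of_const (by simp)]
  simp

/-- The combing after attaching a new edge at `P`. -/
def SkeletonCombing.addSpike : (Y.addSpike P).SkeletonCombing (some y) where
  atVertex v := v.elim (K.spikeEdge P 1)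
    (fun v => (Y.addSpikeEmbedding P).pushPath (K.atVertex v))
  atEdge := Sum.elim (fun d => (Y.addSpikeEmbedding P).pushPath.comp (K.atEdge d))
    (fun b => cond b (K.spikeEdge P) ((K.spikeEdge P).comp ⟨_, unitInterval.continuous_symm⟩))
  compatible := by
    constructor
    · rintro (d | _ | _)
      · simp [K.edge_start]
      · simp
      · simp [K.spikeEdge_zero]
    · rintro (d | _ | _) x
      · simp [K.edge_inv]
      · simp
      · simp
  base s := by
    simp only [Option.elim_some, Embedding.pushPath_apply, K.base, Embedding.map_vertexPt]
    rfl
  vertex_zero := by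
    rintro (_ | v)
    · simp only [Option.elim_none, spikeEdge, concat_zero, ContinuousMap.const_apply,
        Embedding.mapPath_apply, K.vertex_zero, Embedding.map_vertexPt]
      rfl
    · simp only [Option.elim_some, Embedding.pushPath_apply, firstHalf_zero, K.vertex_zero,
        Embedding.map_vertexPt]
      rfl
  vertex_one := by
    rintro (_ | v)
    · simp only [Option.elim_none, spikeEdge, concat_one, edgePaths_apply, mul_one, edgePt_one]
      rfl
    · simp only [Option.elim_some, Embedding.pushPath_apply, firstHalf_one, K.vertex_one,
        Embedding.map_vertexPt]
      rfl
  edge_zero := by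
    have h : ∀ x, K.spikeEdge P x 0 = (Y.addSpike P).vertexPt (some y) := by
      intro x
      simp only [spikeEdge, concat_zero, ContinuousMap.const_apply,
        Embedding.mapPath_apply, K.vertex_zero, Embedding.map_vertexPt]
      rfl
    rintro (d | _ | _) x
    · simp only [Sum.elim_inl, ContinuousMap.comp_apply, Embedding.pushPath_apply, firstHalf_zero,
        K.edge_zero, Embedding.map_vertexPt]
      rfl
    · exact h _
    · exact h _
  edge_one := by
    have h : ∀ x, K.spikeEdge P x 1 = (Y.addSpike P).edgePt (.inr true) x := by
      intro x
      simp [spikeEdge]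
    rintro (d | _ | _) x
    · simp only [Sum.elim_inl, ContinuousMap.comp_apply, Embedding.pushPath_apply, firstHalf_one,
        K.edge_one, Embedding.map_edgePt]
      rfl
    · refine (h _).trans ?_
      exact (Y.addSpike P).edgePt_inv (.inr false) x
    · exact h _
  mem_skeleton1 := by
    rintro (_ | v) s
    · refine concat_forall (P := (· ∈ (Y.addSpike P).skeleton1)) ?_ ?_ s
      · intro s
        exact (Y.addSpikeEmbedding P).map_mem_skeleton1 (K.mem_skeleton1 _ _)
      · intro s
        exact Or.inr ⟨_, _, rfl⟩
    · exact (Y.addSpikeEmbedding P).map_mem_skeleton1 (K.mem_skeleton1 _ _)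

/-- On the open edge the weight is the maximum of both ends, which is that of the target, so it can
only jump upwards at the source. -/
lemma monotone_edgeWeight {M : Y.V → ℕ} {d : Y.D} (h : M (Y.src d) ≤ M (Y.tgt d)) (x : I) :
    Monotone fun s => edgeWeight M d (x * s) := by
  intro s t hst
  have hst' : x * s ≤ x * t := mul_le_mul_right hst x
  have h1 : x * t = 0 → x * s = 0 := fun h => le_antisymm (h ▸ hst') unitInterval.nonneg'
  have h2 : x * s = 1 → x * t = 1 := fun h => le_antisymm unitInterval.le_one' (h ▸ hst')
  simp only [edgeWeight]
  split_ifs <;> simp_all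

variable {M : Y.V → ℕ} {N : Y.F → ℕ} {M' : (Y.addSpike P).V → ℕ} {K P}

lemma SkeletonCombing.monotone_spikeEdge (hM : ∀ v, M' (some v) = M v) (hP : M P ≤ M' none)
    (hK : ∀ v, Monotone fun s => weight M N (K.atVertex v s)) (x : I) :
    Monotone fun s => weight M' N (K.spikeEdge P x s) := by
  refine concat_monotone (β := weight M' N) ?_ ?_
  · simp only [ContinuousMap.const_apply, Embedding.mapPath_apply]
    have := fun q => (Y.addSpikeEmbedding P).weight_map (M' := M') (N := N) (N' := N) hM
      (fun _ => rfl) q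
    simpa only [this] using hK P
  · exact monotone_edgeWeight (Y := Y.addSpike P) (M := M') (d := .inr true)
      ((hM P).trans_le hP) x

lemma SkeletonCombing.monotone_addSpike (hM : ∀ v, M' (some v) = M v) (hP : M P ≤ M' none)
    (hK : ∀ v, Monotone fun s => weight M N (K.atVertex v s))
    (hK' : ∀ d x, Monotone fun s => weight M N (K.atEdge d x s)) :
    (∀ v, Monotone fun s => weight M' N ((K.addSpike P).atVertex v s)) ∧
    (∀ d x, Monotone fun s => weight M' N ((K.addSpike P).atEdge d x s)) := by
  have hw := fun q => (Y.addSpikeEmbedding P).weight_map (M' := M') (N := N) (N' := N) hM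
      (fun _ => rfl) q
  constructor
  · rintro (_ | v)
    · exact monotone_spikeEdge hM hP hK 1
    · intro s t hst
      have := hK v (firstHalf_monotone hst)
      simp only [addSpike, Option.elim_some, Embedding.pushPath_apply]
      rw [hw, hw]
      exact this
  · rintro (d | _ | _) x
    · intro s t hst
      have := hK' d x (firstHalf_monotone hst)
      simp only [addSpike, Sum.elim_inl, ContinuousMap.comp_apply, Embedding.pushPath_apply]
      rw [hw, hw]
      exact this
    · exact monotone_spikeEdge hM hP hK _
    · exact monotone_spikeEdge hM hP hK _

end spike

end TwoComplex

/-! ### Attaching an edge to a combed diagram -/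

namespace CombedDiagram

variable {α : Type} {S : Set (Word α)} {G : Type} [Group G] {φ : α → G} {M : G → ℕ} {w : Word α}

/-- A combed diagram remains combed after attaching an edge in a direction in which the weight
increases. -/
def addSpike (K : CombedDiagram S φ M w) {Lu Lv : List K.diagram.D}
    (hL : K.diagram.boundary = Lu ++ Lv) {P : K.diagram.V}
    (hP : K.diagram.Walk K.diagram.base Lu P) (x : α × Bool)
    (hM : M (K.val P) + 1 ≤ M (K.val P * letterValue φ x)) :
    CombedDiagram S φ M
      (Lu.map K.diagram.label ++ [x, letterInv x] ++ Lv.map K.diagram.label) where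
  diagram := VanKampenDiagram.addSpike hL K.isEmpty_of_nil hP x
  isEmpty_of_nil h := by simp [VanKampenDiagram.addSpike] at h
  val v := v.elim (K.val P * letterValue φ x) K.val
  val_base := K.val_base
  val_tgt := by
    rintro (d | _ | _)
    · exact K.val_tgt d
    · change K.val P = K.val P * letterValue φ x * letterValue φ (letterInv x)
      simp
    · rfl
  faceWeight := K.faceWeight
  le_faceWeight f := by
    intro d hd
    obtain ⟨d, hd', rfl⟩ := List.mem_map.mp hd
    exact K.le_faceWeight f d hd'
  faceWeight_le f := by
    obtain ⟨d, hd, h⟩ := K.faceWeight_le f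
    exact ⟨.inl d, List.mem_map_of_mem hd, h⟩
  dist_lt := by
    have h : ∀ v : K.diagram.V, (K.diagram.toTwoComplex.addSpike P).graph.dist
        (some K.diagram.base) (some v) + 1 ≤ M (K.val v) := fun v =>
      (Nat.succ_le_succ ((K.diagram.toTwoComplex.addSpikeEmbedding P).dist_le
        K.diagram.connected K.diagram.base v)).trans (K.dist_lt v)
    rintro (_ | v)
    -- The new vertex is at most one step further away than `P`, and it is heavier by at least one.
    · refine le_trans ?_ hM
      have := (K.diagram.toTwoComplex.addSpike P).dist_src_le
        (VanKampenDiagram.spike_connected P) (some K.diagram.base) (.inr false)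
      have h2 := h P
      exact Nat.succ_le_succ (this.trans h2)
    · exact h v
  combing := K.combing.addSpike P
  monotone_vertex := (TwoComplex.SkeletonCombing.monotone_addSpike (fun _ => rfl)
    (Nat.le_of_succ_le hM) K.monotone_vertex K.monotone_edge).1
  monotone_edge := (TwoComplex.SkeletonCombing.monotone_addSpike (fun _ => rfl)
    (Nat.le_of_succ_le hM) K.monotone_vertex K.monotone_edge).2

/-- In this form the move can be applied to boundary words without reference to the edges of a
diagram. -/
lemma nonempty_addSpike {u v : Word α} (hK : Nonempty (CombedDiagram S φ M (u ++ v)))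
    (x : α × Bool) (hM : M (wordProd φ u) + 1 ≤ M (wordProd φ (u ++ [x]))) :
    Nonempty (CombedDiagram S φ M (u ++ [x, letterInv x] ++ v)) := by
  obtain ⟨K⟩ := hK
  obtain ⟨Lu, Lv, hL, hu, hv⟩ := List.map_eq_append_iff.mp K.diagram.boundary_label
  obtain ⟨P, hP, -, hval⟩ := K.exists_walk hL
  have h := K.addSpike hL hP x (by rw [hval, hu]; simpa using hM)
  rw [hu, hv] at h
  exact ⟨h⟩

end CombedDiagram

namespace TwoComplex

/-! ### Crossing a 2-cell -/

/-- The point of the unit circle at the fraction `τ / n` of the full turn. -/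
def circlePoint (n : ℕ) (τ : ℝ) : Disc :=
  ⟨Complex.exp ((2 * Real.pi * (τ / n) : ℝ) * Complex.I), by
    rw [mem_closedBall_zero_iff, Complex.norm_exp_ofReal_mul_I]⟩

lemma norm_circlePoint (n : ℕ) (τ : ℝ) : ‖(circlePoint n τ : ℂ)‖ = 1 :=
  Complex.norm_exp_ofReal_mul_I _

lemma sidePoint_eq_circlePoint (n i : ℕ) (s : I) : sidePoint n i s = circlePoint n (i + s) := by
  apply Subtype.ext
  simp only [sidePoint, circlePoint]
  congr 1
  push_cast
  ring

lemma circlePoint_self {n : ℕ} (hn : n ≠ 0) : circlePoint n n = circlePoint n 0 := by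
  apply Subtype.ext
  have : (n : ℝ) ≠ 0 := by exact_mod_cast hn
  simp [circlePoint, div_self this]

/-- The homotopy in the disc which moves the points of a path on the circle along segments to the
points of the last side of the polygon with `n` sides. -/
def crossDisc (n : ℕ) (θ : C(I, ℝ)) : C(I, C(I, Disc)) :=
  ContinuousMap.curry ⟨fun p : I × I =>
    ⟨((1 - (p.1 : ℝ) * (1 - p.1) * (p.2 * (1 - p.2)) : ℝ) : ℂ) *
      (((1 - p.2 : ℝ) : ℂ) * circlePoint n (θ p.1) + ((p.2 : ℝ) : ℂ) * circlePoint n (n - p.1)), by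
      have h1 := p.1.2.1
      have h2 := p.1.2.2
      have h3 := p.2.2.1
      have h4 := p.2.2.2
      have h5 : (p.1 : ℝ) * (1 - p.1) * (p.2 * (1 - p.2)) ≤ 1 :=
        mul_le_one₀ (mul_le_one₀ h2 (by linarith) (by linarith))
          (mul_nonneg h3 (by linarith)) (mul_le_one₀ h4 (by linarith) (by linarith))
      have h6 : 0 ≤ (p.1 : ℝ) * (1 - p.1) * (p.2 * (1 - p.2)) :=
        mul_nonneg (mul_nonneg h1 (by linarith)) (mul_nonneg h3 (by linarith))
      rw [mem_closedBall_zero_iff, norm_mul, Complex.norm_real, Real.norm_eq_abs,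
        abs_of_nonneg (by linarith)]
      refine mul_le_one₀ (by linarith) (norm_nonneg _) ((norm_add_le _ _).trans ?_)
      rw [norm_mul, norm_mul, norm_circlePoint, norm_circlePoint, Complex.norm_real,
        Complex.norm_real, Real.norm_eq_abs, Real.norm_eq_abs, abs_of_nonneg h3,
        abs_of_nonneg (by linarith)]
      linarith⟩, by
    refine Continuous.subtype_mk ?_ _
    simp only [circlePoint]
    fun_prop⟩

section crossDisc

variable {n : ℕ} {θ : C(I, ℝ)}

lemma crossDisc_val (x s : I) : (crossDisc n θ x s : ℂ) =
    ((1 - (x : ℝ) * (1 - x) * (s * (1 - s)) : ℝ) : ℂ) *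
      (((1 - s : ℝ) : ℂ) * circlePoint n (θ x) + ((s : ℝ) : ℂ) * circlePoint n (n - x)) := rfl

lemma crossDisc_zero_right (x : I) : crossDisc n θ x 0 = circlePoint n (θ x) := by
  apply Subtype.ext
  simp [crossDisc_val]

lemma crossDisc_one_right (x : I) : crossDisc n θ x 1 = circlePoint n (n - x) := by
  apply Subtype.ext
  simp [crossDisc_val]

lemma crossDisc_zero_left (hn : n ≠ 0) (hθ : θ 0 = 0) (s : I) :
    crossDisc n θ 0 s = circlePoint n 0 := by
  apply Subtype.ext
  rw [crossDisc_val, hθ]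
  simp only [Set.Icc.coe_zero, sub_zero, circlePoint_self hn]
  push_cast
  ring

lemma crossDisc_one_left (hθ : θ 1 = n - 1) (s : I) :
    crossDisc n θ 1 s = circlePoint n (n - 1) := by
  apply Subtype.ext
  rw [crossDisc_val, hθ]
  simp only [Set.Icc.coe_one]
  push_cast
  ring

/-- The triangle inequality gives only ≤ 1 for the point of the chord. Strictness comes from the
factor 1 - x(1-x)s(1-s), which equals 1 on the boundary of the square and is smaller inside, so the
chord need not be shown to be nondegenerate. -/
lemma norm_crossDisc_lt {x s : I} (hx0 : x ≠ 0) (hx1 : x ≠ 1) (hs0 : s ≠ 0) (hs1 : s ≠ 1) :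
    ‖(crossDisc n θ x s : ℂ)‖ < 1 := by
  have h1 := unitInterval.pos_iff_ne_zero.mpr hx0
  have h2 := unitInterval.lt_one_iff_ne_one.mpr hx1
  have h3 := unitInterval.pos_iff_ne_zero.mpr hs0
  have h4 := unitInterval.lt_one_iff_ne_one.mpr hs1
  have h1' : (0 : ℝ) < x := h1
  have h2' : (x : ℝ) < 1 := h2
  have h3' : (0 : ℝ) < s := h3
  have h4' : (s : ℝ) < 1 := h4
  have h5 : (x : ℝ) * (1 - x) * (s * (1 - s)) ≤ 1 :=
    mul_le_one₀ (mul_le_one₀ h2'.le (by linarith) (by linarith))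
      (mul_nonneg h3'.le (by linarith)) (mul_le_one₀ h4'.le (by linarith) (by linarith))
  have h6 : 0 < (x : ℝ) * (1 - x) * (s * (1 - s)) :=
    mul_pos (mul_pos h1' (by linarith)) (mul_pos h3' (by linarith))
  rw [crossDisc_val, norm_mul, Complex.norm_real, Real.norm_eq_abs, abs_of_nonneg (by linarith)]
  refine (mul_le_of_le_one_right (by linarith) ((norm_add_le _ _).trans ?_)).trans_lt
    (by linarith : 1 - (x : ℝ) * (1 - x) * (s * (1 - s)) < 1)
  rw [norm_mul, norm_mul, norm_circlePoint, norm_circlePoint, Complex.norm_real,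
    Complex.norm_real, Real.norm_eq_abs, Real.norm_eq_abs, abs_of_nonneg h3'.le,
    abs_of_nonneg (by linarith)]
  linarith

end crossDisc

variable {Y : TwoComplex} {y : Y.V} (K : Y.SkeletonCombing y)

/-- The combing paths to the points of an edge path form a path, in parallel with which the position
on the edge path increases. -/
lemma SkeletonCombing.exists_path {P Q : Y.V} {L : List Y.D} (h : Y.Walk P L Q) (a : ℝ) :
    ∃ γ : Path ((K.atVertex P, a) : C(I, Y.Realization) × ℝ) (K.atVertex Q, a + L.length),
      ∀ x, γ x = (K.atVertex P, a) ∨ ∃ (j : ℕ) (hj : j < L.length) (s : I),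
        γ x = (K.atEdge L[j] s, a + j + s) := by
  induction L generalizing P a with
  | nil =>
    obtain rfl : P = Q := h
    exact ⟨(Path.refl _).cast rfl (by simp), fun x => Or.inl rfl⟩
  | cons d L ih =>
    obtain ⟨rfl, h⟩ := h
    obtain ⟨γ, hγ⟩ := ih h (a + 1)
    let γ₀ : Path ((K.atVertex (Y.src d), a) : C(I, Y.Realization) × ℝ)
        (K.atVertex (Y.tgt d), a + 1) :=
      ⟨⟨fun s => (K.atEdge d s, a + s), by fun_prop⟩, by simp [K.edge_start],
        by simp [K.edge_end]⟩
    refine ⟨(γ₀.trans γ).cast rfl (by push_cast [List.length_cons]; rw [add_assoc, add_comm 1]),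
      fun x => Or.inr ?_⟩
    have hx : (γ₀.trans γ) x ∈ Set.range (γ₀.trans γ) := ⟨x, rfl⟩
    rw [Path.trans_range] at hx
    rcases hx with ⟨s, hs⟩ | ⟨s, hs⟩
    · exact ⟨0, by simp, s, hs.symm.trans (by simp [γ₀])⟩
    · rcases hγ s with h1 | ⟨j, hj, t, h1⟩
      -- The start of the remaining path is the end of the edge `d`.
      · exact ⟨0, by simp, 1, hs.symm.trans (h1.trans (by simp [K.edge_end]))⟩
      · refine ⟨j + 1, by simpa using hj, t, hs.symm.trans (h1.trans ?_)⟩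
        simp only [List.getElem_cons_succ, Prod.mk.injEq, true_and]
        push_cast
        ring

section face

variable {P Q : Y.V} {l : List Y.D} (hl : Y.Walk P l Q)

/-- The combing paths to the points of an edge path. -/
def SkeletonCombing.walkPath :
    Path ((K.atVertex P, 0) : C(I, Y.Realization) × ℝ) (K.atVertex Q, 0 + (l.length : ℝ)) :=
  (K.exists_path hl 0).choose

lemma SkeletonCombing.walkPath_spec (hne : l ≠ []) (x : I) :
    ∃ (j : ℕ) (hj : j < l.length) (s : I),
      K.walkPath hl x = (K.atEdge l[j] s, (j : ℝ) + s) := by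
  rcases (K.exists_path hl 0).choose_spec x with h | ⟨j, hj, s, h⟩
  · cases l with
    | nil => exact absurd rfl hne
    | cons d l =>
      refine ⟨0, by simp, 0, h.trans ?_⟩
      obtain ⟨rfl, -⟩ := hl
      simp [K.edge_start]
  · refine ⟨j, hj, s, h.trans ?_⟩
    simp

lemma addFace_side (hl : Y.Walk P l Q) (j : ℕ) (hj : j < l.length) (s : I) :
    (Y.addFace hl).facePt none (circlePoint (l.length + 1) (j + s)) =
      (Y.addFace hl).edgePt (.inl l[j]) s := by
  have h := (Y.addFace hl).facePt_side none j (by simp; omega) s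
  simp only [Option.elim_none, List.length_append, List.length_map, List.length_singleton,
    sidePoint_eq_circlePoint] at h
  rw [h]
  congr 1
  rw [List.getElem_append_left (by simpa using hj)]
  simp

/-- The last side of the polygon is the new edge run from `Q` to `P`, hence the reversed parameter.
-/
lemma addFace_last (hl : Y.Walk P l Q) (x : I) :
    (Y.addFace hl).facePt none (circlePoint (l.length + 1) ((l.length + 1 : ℕ) - x)) =
      (Y.addFace hl).edgePt (.inr true) x := by
  have h := (Y.addFace hl).facePt_side none l.length (by simp) (unitInterval.symm x)
  simp only [Option.elim_none, List.length_append, List.length_map, List.length_singleton,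
    sidePoint_eq_circlePoint, unitInterval.coe_symm_eq] at h
  have h2 : ((l.length + 1 : ℕ) : ℝ) - x = l.length + (1 - x) := by push_cast; ring
  rw [h2, h, ← (Y.addFace hl).edgePt_inv (.inr true) x]
  congr 1
  rw [List.getElem_append_right (by simp)]
  simp

/-- The crossing of the new 2-cell. -/
def SkeletonCombing.faceCross : C(I, C(I, (Y.addFace hl).Realization)) :=
  ⟨fun x => (⟨(Y.addFace hl).facePt none, (Y.addFace hl).continuous_facePt none⟩ :
      C(Disc, (Y.addFace hl).Realization)).comp
    (crossDisc (l.length + 1) ⟨fun x => (K.walkPath hl x).2, by fun_prop⟩ x),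
    (ContinuousMap.continuous_postcomp _).comp (ContinuousMap.continuous _)⟩

lemma SkeletonCombing.faceCross_apply (x s : I) : K.faceCross hl x s =
    (Y.addFace hl).facePt none
      (crossDisc (l.length + 1) ⟨fun x => (K.walkPath hl x).2, by fun_prop⟩ x s) := rfl

/-- The position recorded in the second coordinate of `walkPath` makes the crossing start exactly
where the combing path ends. -/
lemma SkeletonCombing.faceCross_zero_right (hne : l ≠ []) (x : I) :
    ∃ (j : ℕ) (hj : j < l.length) (s : I), (K.walkPath hl x).1 = K.atEdge l[j] s ∧
      K.faceCross hl x 0 = (Y.addFace hl).edgePt (.inl l[j]) s := by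
  obtain ⟨j, hj, s, h⟩ := K.walkPath_spec hl hne x
  refine ⟨j, hj, s, by rw [h], ?_⟩
  rw [faceCross_apply, crossDisc_zero_right, ← addFace_side]
  simp [h]

lemma SkeletonCombing.faceCross_one_right (x : I) :
    K.faceCross hl x 1 = (Y.addFace hl).edgePt (.inr true) x := by
  rw [faceCross_apply, crossDisc_one_right, addFace_last]

/-- At these parameters the chord shrinks to a corner of the polygon, so nothing moves and the
combing of the new edge joins those of `P` and `Q`. -/
lemma SkeletonCombing.faceCross_const {x : I} (hx : x = 0 ∨ x = 1) (s : I) :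
    K.faceCross hl x s = K.faceCross hl x 0 := by
  rcases hx with rfl | rfl
  · rw [faceCross_apply, faceCross_apply, crossDisc_zero_left (by omega) (by simp),
      crossDisc_zero_left (by omega) (by simp)]
  · rw [faceCross_apply, faceCross_apply, crossDisc_one_left (by simp), crossDisc_one_left (by simp)]

variable (hne : l ≠ [])

/-- The combing of the new edge on a new 2-cell. -/
def SkeletonCombing.faceEdge : C(I, C(I, (Y.addFace hl).Realization)) :=
  concat ((Y.addFaceEmbedding hl).mapPath.comp ⟨fun x => (K.walkPath hl x).1, by fun_prop⟩)
    (K.faceCross hl) (by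
      intro x
      obtain ⟨j, hj, s, h1, h2⟩ := K.faceCross_zero_right hl hne x
      rw [h2]
      simp only [ContinuousMap.comp_apply, ContinuousMap.coe_mk, h1, Embedding.mapPath_apply,
        K.edge_one, Embedding.map_edgePt]
      rfl)

lemma SkeletonCombing.faceEdge_of_const {x : I} (hx : x = 0 ∨ x = 1) :
    K.faceEdge hl hne x = (Y.addFaceEmbedding hl).pushPath (K.walkPath hl x).1 := by
  ext s
  rw [SkeletonCombing.faceEdge, concat_of_const (K.faceCross_const hl hx)]
  simp

/-- The combing after attaching a new 2-cell along an edge path. -/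
def SkeletonCombing.addFace : (Y.addFace hl).SkeletonCombing y where
  atVertex v := (Y.addFaceEmbedding hl).pushPath (K.atVertex v)
  atEdge := Sum.elim (fun d => (Y.addFaceEmbedding hl).pushPath.comp (K.atEdge d))
    (fun b => cond b (K.faceEdge hl hne)
      ((K.faceEdge hl hne).comp ⟨_, unitInterval.continuous_symm⟩))
  compatible := by
    constructor
    · rintro (d | _ | _)
      · simp [K.edge_start]
      · simp [K.faceEdge_of_const hl hne (x := 1)]
      · simp [K.faceEdge_of_const hl hne (x := 0)]
    · rintro (d | _ | _) x
      · simp [K.edge_inv]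
      · simp
      · simp
  base s := by
    simp only [Embedding.pushPath_apply, K.base, Embedding.map_vertexPt]
    rfl
  vertex_zero v := by
    simp only [Embedding.pushPath_apply, firstHalf_zero, K.vertex_zero, Embedding.map_vertexPt]
    rfl
  vertex_one v := by
    simp only [Embedding.pushPath_apply, firstHalf_one, K.vertex_one, Embedding.map_vertexPt]
    rfl
  edge_zero := by
    have h : ∀ x, K.faceEdge hl hne x 0 = (Y.addFace hl).vertexPt y := by
      intro x
      obtain ⟨j, hj, s, h1, -⟩ := K.faceCross_zero_right hl hne x
      simp only [faceEdge, concat_zero, ContinuousMap.comp_apply, ContinuousMap.coe_mk, h1,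
        Embedding.mapPath_apply, K.edge_zero, Embedding.map_vertexPt]
      rfl
    rintro (d | _ | _) x
    · simp only [Sum.elim_inl, ContinuousMap.comp_apply, Embedding.pushPath_apply, firstHalf_zero,
        K.edge_zero, Embedding.map_vertexPt]
      rfl
    · exact h _
    · exact h _
  edge_one := by
    have h : ∀ x, K.faceEdge hl hne x 1 = (Y.addFace hl).edgePt (.inr true) x := by
      intro x
      rw [faceEdge, concat_one, K.faceCross_one_right]
    rintro (d | _ | _) x
    · simp only [Sum.elim_inl, ContinuousMap.comp_apply, Embedding.pushPath_apply, firstHalf_one,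
        K.edge_one, Embedding.map_edgePt]
      rfl
    · exact (h _).trans ((Y.addFace hl).edgePt_inv (.inr false) x)
    · exact h _
  mem_skeleton1 v s := (Y.addFaceEmbedding hl).map_mem_skeleton1 (K.mem_skeleton1 _ _)

variable {M : Y.V → ℕ} {N : Y.F → ℕ} {N' : Option Y.F → ℕ} {K hl hne}

/-- Entering the cell from `l` cannot lower the weight, since the cell is at least as heavy as the
vertices of `l`. Leaving it into the open new edge does not change the weight: by `hPQ` both are the
larger weight of `P` and `Q`. -/
lemma SkeletonCombing.monotone_faceEdge (hN : ∀ f, N' (some f) = N f)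
    (hPQ : N' none = max (M P) (M Q))
    (hM : ∀ d ∈ l, M (Y.src d) ≤ N' none ∧ M (Y.tgt d) ≤ N' none)
    (hK : ∀ d x, Monotone fun s => weight M N (K.atEdge d x s)) (x : I) :
    Monotone fun s => weight (Y := Y.addFace hl) M N' (K.faceEdge hl hne x s) := by
  have hw := fun q => (Y.addFaceEmbedding hl).weight_map (M := M) (M' := M) (N := N) (N' := N')
      (fun _ => rfl) hN q
  obtain ⟨j, hj, s, h1, h2⟩ := K.faceCross_zero_right hl hne x
  refine concat_monotone (β := weight (Y := Y.addFace hl) M N') ?_ ?_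
  · simp only [ContinuousMap.comp_apply, ContinuousMap.coe_mk, h1, Embedding.mapPath_apply, hw]
    exact hK _ _
  · by_cases hx : x = 0 ∨ x = 1
    · intro s t _
      simp only
      rw [K.faceCross_const hl hx s, K.faceCross_const hl hx t]
    · push Not at hx
      have hpos : ∀ t, t ≠ 0 →
          weight (Y := Y.addFace hl) M N' (K.faceCross hl x t) = N' none := by
        intro t ht
        by_cases ht1 : t = 1
        · rw [ht1, K.faceCross_one_right, weight_edgePt, edgeWeight, if_neg hx.1, if_neg hx.2, hPQ]
          rfl
        · rw [faceCross_apply]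
          exact weight_facePt _ _ _ _ (norm_crossDisc_lt hx.1 hx.2 ht ht1)
      have hzero : weight (Y := Y.addFace hl) M N' (K.faceCross hl x 0) ≤ N' none := by
        rw [h2, weight_edgePt]
        exact (edgeWeight_le _ _ _).trans (max_le (hM _ (List.getElem_mem hj)).1
          (hM _ (List.getElem_mem hj)).2)
      intro s t hst
      simp only
      by_cases ht : t = 0
      · obtain rfl : s = 0 := le_antisymm (ht ▸ hst) unitInterval.nonneg'
        rw [ht]
      · rw [hpos t ht]
        by_cases hs : s = 0
        · rw [hs]; exact hzero
        · exact (hpos s hs).le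

lemma SkeletonCombing.monotone_addFace (hN : ∀ f, N' (some f) = N f)
    (hPQ : N' none = max (M P) (M Q))
    (hM : ∀ d ∈ l, M (Y.src d) ≤ N' none ∧ M (Y.tgt d) ≤ N' none)
    (hK : ∀ v, Monotone fun s => weight M N (K.atVertex v s))
    (hK' : ∀ d x, Monotone fun s => weight M N (K.atEdge d x s)) :
    (∀ v, Monotone fun s =>
      weight (Y := Y.addFace hl) M N' ((K.addFace hl hne).atVertex v s)) ∧
    (∀ d x, Monotone fun s =>
      weight (Y := Y.addFace hl) M N' ((K.addFace hl hne).atEdge d x s)) := by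
  have hw := fun q => (Y.addFaceEmbedding hl).weight_map (M := M) (M' := M) (N := N) (N' := N')
      (fun _ => rfl) hN q
  constructor
  · intro v s t hst
    have := hK v (firstHalf_monotone hst)
    simp only [addFace, Embedding.pushPath_apply]
    rw [hw, hw]
    exact this
  · rintro (d | _ | _) x
    · intro s t hst
      have := hK' d x (firstHalf_monotone hst)
      simp only [addFace, Sum.elim_inl, ContinuousMap.comp_apply, Embedding.pushPath_apply]
      rw [hw, hw]
      exact this
    · exact monotone_faceEdge (hne := hne) hN hPQ hM hK' _
    · exact monotone_faceEdge (hne := hne) hN hPQ hM hK' _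

end face

end TwoComplex

/-- The trivial 2-complex. -/
@[reducible] def TwoComplex.point : TwoComplex where
  V := Unit
  D := Empty
  F := Empty
  src := Empty.elim
  inv := id
  inv_inv := Empty.rec
  inv_ne := Empty.rec
  bd := Empty.elim
  bd_ne_nil := Empty.rec
  bd_closed := Empty.rec

/-- The trivial diagram. -/
def VanKampenDiagram.point {α : Type} (S : Set (Word α)) : VanKampenDiagram S [] where
  toTwoComplex := TwoComplex.point
  finite_V := inferInstanceAs (Finite Unit)
  finite_D := inferInstanceAs (Finite Empty)
  finite_F := inferInstanceAs (Finite Empty)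
  base := ()
  label := Empty.elim
  label_inv := Empty.rec
  label_bd := Empty.rec
  boundary := []
  boundary_start := by simp
  boundary_label := rfl
  next := Equiv.refl _
  region := Empty.elim
  src_next := Empty.rec
  bd_nodup := Empty.rec
  mem_bd := Empty.rec
  next_bd := Empty.rec
  boundary_nodup := List.nodup_nil
  mem_boundary := Empty.rec
  next_boundary i hi := absurd hi (Nat.not_lt_zero _)
  rotation := Empty.rec
  connected := by
    rw [SimpleGraph.connected_iff_exists_forall_reachable]
    exact ⟨(), fun _ => SimpleGraph.Reachable.refl _⟩
  euler := by simp

/-! ### Attaching a 2-cell to a combed diagram, and tameness -/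

namespace CombedDiagram

variable {α : Type} {S : Set (Word α)} {G : Type} [Group G] {φ : α → G} {M : G → ℕ} {w : Word α}

/-- A combed diagram remains combed after attaching a 2-cell all of whose vertices have at most the
weight of one of the ends of the new edge. -/
def addFace (K : CombedDiagram S φ M w) {Lu l0 Lv : List K.diagram.D} {z : K.diagram.D}
    (hL : K.diagram.boundary = Lu ++ (l0 ++ [z]) ++ Lv)
    {P Q : K.diagram.V} (hP : K.diagram.Walk K.diagram.base Lu P)
    (hQ : K.diagram.Walk P (l0 ++ [z]) Q) (x : α × Bool)
    (hx : (l0 ++ [z]).map K.diagram.label ++ [letterInv x] ∈ symmetrize S)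
    (hval : K.val Q = K.val P * letterValue φ x)
    (hM : ∀ d ∈ l0 ++ [z], M (K.val (K.diagram.src d)) ≤ max (M (K.val P)) (M (K.val Q)) ∧
      M (K.val (K.diagram.tgt d)) ≤ max (M (K.val P)) (M (K.val Q))) :
    CombedDiagram S φ M (Lu.map K.diagram.label ++ [x] ++ Lv.map K.diagram.label) where
  diagram := VanKampenDiagram.addFace hL hP hQ x hx
  isEmpty_of_nil h := by simp [VanKampenDiagram.addFace] at h
  val := K.val
  val_base := K.val_base
  val_tgt := by
    rintro (d | _ | _)
    · exact K.val_tgt d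
    · change K.val P = K.val Q * letterValue φ (letterInv x)
      simp [hval]
    · exact hval
  faceWeight f := f.elim (max (M (K.val P)) (M (K.val Q))) K.faceWeight
  le_faceWeight := by
    rintro (_ | f) d hd
    · rcases List.mem_append.mp hd with h | h
      · obtain ⟨d, hd', rfl⟩ := List.mem_map.mp h
        exact (hM d hd').1
      · obtain rfl := List.mem_singleton.mp h
        exact le_max_right _ _
    · obtain ⟨d, hd', rfl⟩ := List.mem_map.mp hd
      exact K.le_faceWeight f d hd'
  faceWeight_le := by
    rintro (_ | f)
    -- Both candidates for the maximum are sources of boundary edges: `P` of the first edge of the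
    -- segment, `Q` of the new edge run backwards.
    · rcases max_choice (M (K.val P)) (M (K.val Q)) with h | h
      · obtain ⟨d, l, hdl⟩ := List.exists_cons_of_ne_nil (l := l0 ++ [z]) (by simp)
        have hd : K.diagram.src d = P := by
          rw [hdl] at hQ
          exact hQ.1
        refine ⟨.inl d, List.mem_append_left _ (List.mem_map_of_mem (by rw [hdl]; simp)), ?_⟩
        change max _ _ ≤ M (K.val (K.diagram.src d))
        rw [hd, h]
      · exact ⟨.inr false, List.mem_append_right _ (List.mem_singleton.mpr rfl), h.le⟩
    · obtain ⟨d, hd, h⟩ := K.faceWeight_le f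
      exact ⟨.inl d, List.mem_map_of_mem hd, h⟩
  dist_lt v := (Nat.succ_le_succ ((K.diagram.toTwoComplex.addFaceEmbedding hQ).dist_le
        K.diagram.connected K.diagram.base v)).trans (K.dist_lt v)
  combing := K.combing.addFace hQ (by simp)
  monotone_vertex := (TwoComplex.SkeletonCombing.monotone_addFace (fun _ => rfl) rfl hM
    K.monotone_vertex K.monotone_edge).1
  monotone_edge := (TwoComplex.SkeletonCombing.monotone_addFace (fun _ => rfl) rfl hM
    K.monotone_vertex K.monotone_edge).2

lemma nonempty_addFace {u l v : Word α} (hK : Nonempty (CombedDiagram S φ M (u ++ l ++ v)))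
    (hl : l ≠ []) (x : α × Bool) (hx : l ++ [letterInv x] ∈ symmetrize S)
    (hval : wordProd φ l = letterValue φ x)
    (hM : ∀ l₁ l₂, l = l₁ ++ l₂ →
      M (wordProd φ (u ++ l₁)) ≤ max (M (wordProd φ u)) (M (wordProd φ (u ++ [x])))) :
    Nonempty (CombedDiagram S φ M (u ++ [x] ++ v)) := by
  obtain ⟨K⟩ := hK
  obtain ⟨L, Lv, hL, hu', hv⟩ := List.map_eq_append_iff.mp K.diagram.boundary_label
  obtain ⟨Lu, Ll, rfl, hu, hlab⟩ := List.map_eq_append_iff.mp hu'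
  have hLl : Ll ≠ [] := by
    rintro rfl
    exact hl hlab.symm
  obtain ⟨l0, z, rfl⟩ := (List.eq_nil_or_concat' Ll).resolve_left hLl
  obtain ⟨Q, hQ, -, hvQ⟩ := K.exists_walk hL
  obtain ⟨P, hP, hPQ⟩ := chain_append.mp hQ
  have hvP := K.val_walk hP
  have hvPQ := K.val_walk hPQ
  rw [K.val_base, one_mul, hu] at hvP
  rw [hlab, hval] at hvPQ
  have hmax : max (M (K.val P)) (M (K.val Q)) =
      max (M (wordProd φ u)) (M (wordProd φ (u ++ [x]))) := by
    rw [hvPQ, hvP]; simp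
  have h := K.addFace hL hP hPQ x (by rw [hlab]; exact hx) hvPQ (by
    intro d hd
    -- Cutting the segment before and after `d` expresses its two ends by prefixes of `l`.
    obtain ⟨A, B, hAB⟩ := List.append_of_mem hd
    rw [hmax]
    obtain ⟨R, h1, h2⟩ := chain_append.mp (hAB ▸ hPQ)
    obtain ⟨rfl, h3⟩ := h2
    have hA := K.val_walk h1
    rw [hAB, List.map_append, List.map_cons] at hlab
    constructor
    · rw [hA, hvP, ← wordProd_append]
      exact hM _ _ hlab.symm
    · rw [K.val_tgt, hA, hvP, ← wordProd_append]
      have := hM (A.map K.diagram.label ++ [K.diagram.label d]) (B.map K.diagram.label)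
        (hlab.symm.trans (by simp))
      simpa [mul_assoc] using this)
  rw [hu, hv] at h
  exact ⟨h⟩

lemma nonempty_nil (hM : 1 ≤ M 1) : Nonempty (CombedDiagram S φ M []) :=
  ⟨{ diagram := VanKampenDiagram.point S
     isEmpty_of_nil := fun _ => inferInstanceAs (IsEmpty Empty)
     val := fun _ => 1
     val_base := rfl
     val_tgt := Empty.rec
     faceWeight := Empty.elim
     le_faceWeight := Empty.rec
     faceWeight_le := Empty.rec
     dist_lt := fun v => by
      obtain rfl : v = (VanKampenDiagram.point S).base := rfl
      simpa using hM
     combing :=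
      { atVertex := fun _ => ContinuousMap.const I (TwoComplex.vertexPt _ ())
        atEdge := Empty.elim
        compatible := ⟨Empty.rec, Empty.rec⟩
        base := fun _ => rfl
        vertex_zero := fun _ => rfl
        vertex_one := fun _ => rfl
        edge_zero := Empty.rec
        edge_one := Empty.rec
        mem_skeleton1 := fun _ _ => Or.inl ⟨_, rfl⟩ }
     monotone_vertex := fun _ => monotone_const
     monotone_edge := Empty.rec }⟩

/-- A combed diagram is a diagram with a tame 1-combing. -/
lemma exists_tame (K : CombedDiagram S φ M w) {ψ : ℕ → ℕ} (hψ : Monotone ψ)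
    (hM : ∀ u : Word α, M (wordProd φ u) ≤ ψ u.length) {f : QuarterNat → QuarterNat}
    (hf : ∀ x, (ψ (⌈x.1⌉₊ + 1) : ℝ) ≤ (f x).1) :
    ∃ (Δ : VanKampenDiagram S w) (γ : Δ.boundarySet × I → Δ.Realization),
      Δ.IsOneCombing Δ.boundarySet Δ.base γ ∧ Δ.IsTame f Δ.base γ := by
  obtain ⟨γ, hγ, h⟩ := K.combing.exists_isOneCombing K.diagram.boundary
  refine ⟨K.diagram, γ, hγ, ?_⟩
  intro p s t hst
  have h1 : ∀ q, K.diagram.coarseDist K.diagram.base q ≤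
      TwoComplex.weight (fun v => M (K.val v)) K.faceWeight q :=
    TwoComplex.coarseDist_le_weight K.dist_lt K.le_faceWeight
  -- The labels along a geodesic to `v` form a word of length equal to the distance and with value
  -- `K.val v`.
  have hdist : ∀ v, M (K.val v) ≤ ψ (K.diagram.graph.dist K.diagram.base v) := by
    intro v
    obtain ⟨π, hπ⟩ := K.diagram.connected.exists_walk_length_eq_dist K.diagram.base v
    have key : ∀ {a b : K.diagram.V} (π : K.diagram.graph.Walk a b), ∃ u : Word α,
        u.length = π.length ∧ K.val b = K.val a * wordProd φ u := by
      intro a b π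
      induction π with
      | nil => exact ⟨[], rfl, by simp⟩
      | cons hadj _ ih =>
        obtain ⟨u, hu, hv⟩ := ih
        obtain ⟨-, d, rfl, rfl⟩ := hadj
        exact ⟨K.diagram.label d :: u,
          congrArg Nat.succ hu,
          by rw [hv, K.val_tgt]; simp [mul_assoc]⟩
    obtain ⟨u, hu, hv⟩ := key π
    rw [K.val_base, one_mul] at hv
    rw [hv, ← hπ, ← hu]
    exact hM u
  have h2 : ∀ q, TwoComplex.weight (fun v => M (K.val v)) K.faceWeight q ≤
      ψ (⌈K.diagram.coarseDist K.diagram.base q⌉₊ + 1) :=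
    TwoComplex.weight_le_of_coarseDist K.diagram.connected hψ hdist K.faceWeight_le
  have h3 : TwoComplex.weight (fun v => M (K.val v)) K.faceWeight (γ (p, s)) ≤
      TwoComplex.weight (fun v => M (K.val v)) K.faceWeight (γ (p, t)) := by
    rcases h p with ⟨v, hv⟩ | ⟨d, x, hv⟩
    · rw [hv, hv]; exact K.monotone_vertex v hst.le
    · rw [hv, hv]; exact K.monotone_edge d x hst.le
  refine (h1 _).trans (le_trans ?_ (hf _))
  exact_mod_cast h3.trans (h2 _)

end CombedDiagram

/-! ### Weights of words -/

section boundedAlong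

variable {α G : Type} [Group G] (φ : α → G) (M : G → ℕ) (B : ℕ)

/-- The weights of all vertices of the path which starts at `g` and has the label `l` are at
most `B`. -/
def BoundedAlong (g : G) : Word α → Prop
  | [] => M g ≤ B
  | x :: l => M g ≤ B ∧ BoundedAlong (g * letterValue φ x) l

variable {φ M B}

lemma BoundedAlong.le {g : G} {l₁ l₂ : Word α} (h : BoundedAlong φ M B g (l₁ ++ l₂)) :
    M (g * wordProd φ l₁) ≤ B := by
  induction l₁ generalizing g with
  | nil =>
    cases l₂ with
    | nil => simpa [BoundedAlong] using h
    | cons x l => simpa using h.1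
  | cons x l ih => simpa [mul_assoc] using ih h.2

lemma BoundedAlong.append {g : G} {l₁ l₂ : Word α} (h₁ : BoundedAlong φ M B g l₁)
    (h₂ : BoundedAlong φ M B (g * wordProd φ l₁) l₂) : BoundedAlong φ M B g (l₁ ++ l₂) := by
  induction l₁ generalizing g with
  | nil => simpa using h₂
  | cons x l ih => exact ⟨h₁.1, ih h₁.2 (by simpa [mul_assoc] using h₂)⟩

lemma boundedAlong_replicate {g : G} {x : α × Bool} {n : ℕ}
    (h : ∀ s ≤ n, M (g * letterValue φ x ^ s) ≤ B) :
    BoundedAlong φ M B g (List.replicate n x) := by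
  induction n generalizing g with
  | zero => simpa [BoundedAlong] using h 0 le_rfl
  | succ n ih =>
    refine ⟨by simpa using h 0 (Nat.zero_le _), ih fun s hs => ?_⟩
    have := h (s + 1) (by omega)
    rwa [pow_succ', ← mul_assoc] at this

@[simp] lemma wordProd_replicate (x : α × Bool) (n : ℕ) :
    wordProd φ (List.replicate n x) = letterValue φ x ^ n := by
  simp [wordProd]

end boundedAlong

/-- With the value of `u` multiplied in front, both sides can be computed in the normal form `aff`,
and the condition on prefixes becomes a check vertex by vertex. -/
lemma CombedDiagram.nonempty_addFace' {α : Type} {S : Set (Word α)} {G : Type} [Group G]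
    {φ : α → G} {M : G → ℕ} {u l v : Word α}
    (hK : Nonempty (CombedDiagram S φ M (u ++ l ++ v)))
    (hl : l ≠ []) (x : α × Bool) (hx : l ++ [letterInv x] ∈ symmetrize S)
    (hval : wordProd φ u * wordProd φ l = wordProd φ u * letterValue φ x)
    (hM : BoundedAlong φ M (max (M (wordProd φ u)) (M (wordProd φ u * letterValue φ x)))
      (wordProd φ u) l) :
    Nonempty (CombedDiagram S φ M (u ++ [x] ++ v)) := by
  refine nonempty_addFace hK hl x hx (mul_left_cancel hval) ?_
  rintro l₁ l₂ rfl
  have := hM.le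
  simpa using this

/-! ### The solvable Baumslag-Solitar groups as groups of affine maps -/

namespace BS

variable (p : ℕ) [NeZero p]

/-- The action of the generators on the rational numbers. -/
def act : BSGen → Equiv.Perm ℚ
  | .a => Equiv.addRight 1
  | .t => Equiv.mulLeft₀ (p : ℚ) (by exact_mod_cast NeZero.ne p)

lemma cast_ne : (p : ℚ) ≠ 0 := by exact_mod_cast NeZero.ne p

/-- The affine map represented by the word `t⁻ⁱ aᵐ tᵏ`. -/
def aff (i : ℕ) (m : ℤ) (k : ℕ) : Equiv.Perm ℚ where
  toFun x := (p ^ k * x + m) / p ^ i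
  invFun x := (p ^ i * x - m) / p ^ k
  left_inv x := by have := cast_ne p; field_simp; ring
  right_inv x := by have := cast_ne p; field_simp; ring

/-- The exponent of a letter. -/
def sgn (b : Bool) : ℤ := cond b 1 (-1)

variable {p}

lemma aff_apply (i : ℕ) (m : ℤ) (k : ℕ) (x : ℚ) : aff p i m k x = (p ^ k * x + m) / p ^ i := rfl

lemma aff_zero : aff p 0 0 0 = 1 := by
  ext x; simp [aff_apply]

/-- This is the relation t⁻¹ aᵖᵐ t = aᵐ. -/
lemma aff_succ (i : ℕ) (m : ℤ) (k : ℕ) : aff p (i + 1) (p * m) (k + 1) = aff p i m k := by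
  ext x
  have := cast_ne p
  simp only [aff_apply]
  push_cast
  field_simp
  ring

lemma aff_mul_a (i : ℕ) (m : ℤ) (k : ℕ) (b : Bool) :
    aff p i m k * letterValue (act p) (.a, b) = aff p i (m + sgn b * p ^ k) k := by
  ext x
  cases b <;> simp [aff_apply, letterValue, act, sgn, Equiv.Perm.mul_apply] <;> ring

lemma aff_mul_a_pow (i : ℕ) (m : ℤ) (k : ℕ) (b : Bool) (n : ℕ) :
    aff p i m k * letterValue (act p) (.a, b) ^ n = aff p i (m + sgn b * (n * p ^ k)) k := by
  induction n with
  | zero => simp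
  | succ n ih =>
    rw [pow_succ, ← mul_assoc, ih, aff_mul_a]
    congr 1
    push_cast
    ring

lemma aff_mul_t (i : ℕ) (m : ℤ) (k : ℕ) :
    aff p i m k * letterValue (act p) (.t, true) = aff p i m (k + 1) := by
  ext x
  simp [aff_apply, letterValue, act, Equiv.Perm.mul_apply, pow_succ, mul_assoc]

lemma aff_succ_mul_t_inv (i : ℕ) (m : ℤ) (k : ℕ) :
    aff p i m (k + 1) * letterValue (act p) (.t, false) = aff p i m k := by
  rw [← aff_mul_t, mul_assoc]
  simp [letterValue]

lemma aff_mul_t_inv (i : ℕ) (m : ℤ) (k : ℕ) :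
    aff p i m k * letterValue (act p) (.t, false) = aff p (i + 1) (p * m) k := by
  rw [← aff_succ, aff_succ_mul_t_inv]

variable (p) in
/-- The weight of an element: the minimum of `i + |m| + 2 pᵏ` over its representations by words
`t⁻ⁱ aᵐ tᵏ`. -/
def size (g : Equiv.Perm ℚ) : ℕ :=
  sInf {N | ∃ (i : ℕ) (m : ℤ) (k : ℕ), g = aff p i m k ∧ N = i + m.natAbs + 2 * p ^ k}

lemma size_le (i : ℕ) (m : ℤ) (k : ℕ) : size p (aff p i m k) ≤ i + m.natAbs + 2 * p ^ k :=
  Nat.sInf_le ⟨i, m, k, rfl, rfl⟩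

variable (p) in
/-- The word `t⁻ⁱ aᵐ tᵏ` is reduced. -/
def Reduced (i : ℕ) (m : ℤ) (k : ℕ) : Prop := ¬ (p : ℤ) ∣ m ∨ i = 0 ∨ k = 0

/-- The values at 0 and 1 determine the translation part m / pⁱ and the slope pᵏ / pⁱ. -/
lemma eq_of_aff_eq (hp : 2 ≤ p) {i i' k k' : ℕ} {m m' : ℤ} (h : aff p i m k = aff p i' m' k') :
    k + i' = k' + i ∧ m * p ^ i' = m' * p ^ i := by
  have hp0 := cast_ne p
  have h0 := congrArg (· 0) h
  have h1 := congrArg (· 1) h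
  simp only [aff_apply, mul_zero, zero_add, mul_one] at h0 h1
  rw [add_div, add_div, h0, add_left_inj] at h1
  rw [div_eq_div_iff (by positivity) (by positivity)] at h0 h1
  refine ⟨?_, by exact_mod_cast h0⟩
  rw [← pow_add, ← pow_add] at h1
  have h2 : p ^ (k + i') = p ^ (k' + i) := by exact_mod_cast h1
  exact Nat.pow_right_injective hp h2

/-- Every other expression of the element is (i + c, m pᶜ, k + c) for some c > 0, and this decreases
none of the three summands. -/
lemma size_eq (hp : 2 ≤ p) {i k : ℕ} {m : ℤ} (h : Reduced p i m k) :
    size p (aff p i m k) = i + m.natAbs + 2 * p ^ k := by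
  refine le_antisymm (size_le i m k) (le_csInf ⟨_, i, m, k, rfl, rfl⟩ ?_)
  rintro N ⟨i', m', k', h1, rfl⟩
  obtain ⟨h2, h3⟩ := eq_of_aff_eq hp h1
  have hp0 : (p : ℤ) ≠ 0 := by exact_mod_cast NeZero.ne p
  rcases Nat.lt_or_ge i' i with hlt | hge
  · exfalso
    obtain ⟨c, rfl⟩ := Nat.exists_eq_add_of_lt hlt
    rcases h with h | h | h
    · apply h
      refine ⟨m' * p ^ c, ?_⟩
      apply mul_right_cancel₀ (pow_ne_zero i' hp0)
      rw [h3]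
      ring
    · omega
    · omega
  · obtain ⟨c, rfl⟩ := Nat.exists_eq_add_of_le hge
    obtain rfl : k' = k + c := by omega
    have h4 : m' = m * p ^ c := by
      apply mul_right_cancel₀ (pow_ne_zero i hp0)
      rw [← h3]
      ring
    have h5 : m.natAbs ≤ m'.natAbs := by
      rw [h4, Int.natAbs_mul, Int.natAbs_pow, Int.natAbs_natCast]
      exact Nat.le_mul_of_pos_right _ (by positivity)
    have h6 : p ^ k ≤ p ^ (k + c) := Nat.pow_le_pow_right (by omega) (by omega)
    omega

/-- The weight grows at most exponentially with the length of a word. -/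
lemma size_wordProd_le (hp : 2 ≤ p) (u : Word BSGen) :
    size p (wordProd (act p) u) ≤ p ^ (3 * u.length + 2) := by
  -- Each letter is absorbed with i raised by exactly one, which multiplies m by p and raises k by
  -- at most 2. The letter a further changes m by a power of p, and a factor p³ per letter leaves
  -- room for that.
  have key : ∃ (m : ℤ) (k : ℕ), wordProd (act p) u = aff p u.length m k ∧ k ≤ 2 * u.length ∧
      m.natAbs ≤ p ^ (3 * u.length) := by
    induction u using List.reverseRecOn with
    | nil => exact ⟨0, 0, aff_zero.symm, by simp, by simp⟩
    | append_singleton u x ih =>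
      obtain ⟨m, k, h1, h2, h3⟩ := ih
      have hlen : (u ++ [x]).length = u.length + 1 := by simp
      have h4 : p * m.natAbs ≤ p ^ (3 * u.length + 1) := by
        rw [pow_succ']
        exact Nat.mul_le_mul_left _ h3
      have h5 : 2 * p ^ (3 * u.length + 1) ≤ p ^ (3 * u.length + 3) := by
        rw [pow_succ _ (3 * u.length + 2), pow_succ _ (3 * u.length + 1), mul_assoc, mul_comm]
        refine Nat.mul_le_mul_left _ (hp.trans (Nat.le_mul_of_pos_left _ (by omega)))
      have h6 : (p * m).natAbs ≤ p ^ (3 * u.length + 1) := by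
        rwa [Int.natAbs_mul, Int.natAbs_natCast]
      rw [hlen, wordProd_append, h1, wordProd_cons, wordProd_nil, mul_one]
      obtain ⟨g, b⟩ := x
      cases g with
      | a =>
        refine ⟨p * m + sgn b * p ^ (k + 1), k + 1, by rw [← aff_succ, aff_mul_a], by omega, ?_⟩
        have h7 : (sgn b * (p : ℤ) ^ (k + 1)).natAbs ≤ p ^ (3 * u.length + 1) := by
          rw [Int.natAbs_mul, Int.natAbs_pow, Int.natAbs_natCast]
          have : (sgn b).natAbs = 1 := by cases b <;> rfl
          rw [this, one_mul]
          exact Nat.pow_le_pow_right (by omega) (by omega)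
        have h8 := Int.natAbs_add_le (p * m) (sgn b * (p : ℤ) ^ (k + 1))
        rw [show 3 * (u.length + 1) = 3 * u.length + 3 by ring]
        omega
      | t =>
        rw [show 3 * (u.length + 1) = 3 * u.length + 3 by ring]
        cases b with
        | true => exact ⟨p * m, k + 2, by rw [← aff_succ, aff_mul_t], by omega, by omega⟩
        | false => exact ⟨p * m, k, by rw [aff_mul_t_inv], by omega, by omega⟩
  obtain ⟨m, k, h1, h2, h3⟩ := key
  rw [h1]
  refine (size_le _ _ _).trans ?_
  have h4 : u.length ≤ p ^ (3 * u.length) :=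
    (Nat.lt_pow_self (by omega)).le.trans (Nat.pow_le_pow_right (by omega) (by omega))
  have h5 : p ^ k ≤ p ^ (3 * u.length) := Nat.pow_le_pow_right (by omega) (by omega)
  -- The three summands of the weight amount to at most four times p^(3|u|), and 4 ≤ p².
  have h6 : p ^ (3 * u.length) * (2 * 2) ≤ p ^ (3 * u.length + 2) := by
    rw [pow_add, sq]
    exact Nat.mul_le_mul_left _ (Nat.mul_le_mul hp hp)
  omega

end BS

namespace BS

open List (replicate)

/-! ### Relators -/

lemma invRev_bsRelator (p : ℕ) : FreeGroup.invRev (bsRelator p) =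
    replicate p (.a, true) ++ [(.t, true), (.a, false), (.t, false)] := by
  simp [bsRelator, FreeGroup.invRev]

lemma mem_symmetrize_of_relator {p : ℕ} (u v : Word BSGen) (h : u ++ v = bsRelator p) :
    v ++ u ∈ symmetrize (bsRelators p) :=
  ⟨_, rfl, Or.inl (h ▸ List.isRotated_append)⟩

lemma mem_symmetrize_of_inverse {p : ℕ} (u v : Word BSGen)
    (h : u ++ v = replicate p (.a, true) ++ [(.t, true), (.a, false), (.t, false)]) :
    v ++ u ∈ symmetrize (bsRelators p) :=
  ⟨_, rfl, Or.inr (by rw [invRev_bsRelator, ← h]; exact List.isRotated_append)⟩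

/-- In this and the next two lemmas the last letter is the reversed new edge; depending on `b`, the
word is a cyclic permutation of the relator or of its inverse. -/
lemma relator_down (p : ℕ) (b : Bool) : [(.a, !b), (.t, false)] ++ replicate p (.a, b) ++
    [letterInv (.t, false)] ∈ symmetrize (bsRelators p) := by
  cases b with
  | true =>
    have := mem_symmetrize_of_inverse (p := p) (replicate p (.a, true) ++ [(.t, true)])
      [(.a, false), (.t, false)] (by simp)
    simpa [letterInv] using this
  | false =>
    have := mem_symmetrize_of_relator (p := p) [(.t, true)]
      ([(.a, true), (.t, false)] ++ replicate p (.a, false)) (by simp [bsRelator])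
    simpa [letterInv] using this

lemma relator_up (p : ℕ) (b : Bool) : replicate p (.a, !b) ++ [(.t, true), (.a, b)] ++
    [letterInv (.t, true)] ∈ symmetrize (bsRelators p) := by
  cases b with
  | true =>
    have := mem_symmetrize_of_relator (p := p) [(.t, true), (.a, true), (.t, false)]
      (replicate p (.a, false)) (by simp [bsRelator])
    simpa [letterInv] using this
  | false =>
    have := mem_symmetrize_of_inverse (p := p) []
      (replicate p (.a, true) ++ [(.t, true), (.a, false), (.t, false)]) (by simp)
    simpa [letterInv] using this

lemma relator_row (p : ℕ) (b : Bool) : [(.t, false)] ++ replicate p (.a, b) ++ [(.t, true)] ++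
    [letterInv (.a, b)] ∈ symmetrize (bsRelators p) := by
  cases b with
  | true =>
    have := mem_symmetrize_of_inverse (p := p)
      (replicate p (.a, true) ++ [(.t, true), (.a, false)]) [(.t, false)] (by simp)
    simpa [letterInv] using this
  | false =>
    have := mem_symmetrize_of_relator (p := p) [(.t, true), (.a, true)]
      ([(.t, false)] ++ replicate p (.a, false)) (by simp [bsRelator])
    simpa [letterInv] using this

/-! ### Elementary moves -/

variable (p : ℕ) [NeZero p]

/-- There is a combed diagram with the boundary word `w`. -/
def HasCombing (w : Word BSGen) : Prop :=
  Nonempty (CombedDiagram (bsRelators p) (act p) (size p) w)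

/-- The value of a word. -/
abbrev value (w : Word BSGen) : Equiv.Perm ℚ := wordProd (act p) w

variable {p}

lemma sgn_natAbs (b : Bool) : (sgn b).natAbs = 1 := by cases b <;> rfl

lemma sgn_mul_sgn (b : Bool) : sgn b * sgn b = 1 := by cases b <;> rfl

lemma sgn_not (b : Bool) : sgn (!b) = - sgn b := by cases b <;> rfl

lemma sgn_mul_natAbs (b : Bool) (n : ℕ) : (sgn b * n).natAbs = n := by
  rw [Int.natAbs_mul, sgn_natAbs, one_mul, Int.natAbs_natCast]

lemma hasCombing_spike {u v : Word BSGen} (h : HasCombing p (u ++ v)) (x : BSGen × Bool)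
    (hM : size p (value p u) + 1 ≤ size p (value p u * letterValue (act p) x)) :
    HasCombing p (u ++ [x, letterInv x] ++ v) :=
  CombedDiagram.nonempty_addSpike h x (by simpa using hM)

variable (hp : 2 ≤ p)

include hp

lemma spike_a {u v : Word BSGen} (h : HasCombing p (u ++ v)) {i : ℕ} {m : ℤ}
    (hu : value p u = aff p i m 0) (b : Bool) (hm : 0 ≤ sgn b * m) :
    HasCombing p (u ++ [(.a, b), (.a, !b)] ++ v) := by
  refine hasCombing_spike h (.a, b) ?_
  rw [hu, aff_mul_a, size_eq hp (Or.inr (Or.inr rfl)), size_eq hp (Or.inr (Or.inr rfl))]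
  have : (m + sgn b * (p : ℤ) ^ 0).natAbs = m.natAbs + 1 := by
    rw [pow_zero]
    cases b <;> simp only [sgn, cond_true, cond_false] at hm ⊢ <;> omega
  omega

/-- By `hm` the expressions with k and with k + 1 are both reduced, so the weight rises by 2 (pᵏ⁺¹ -
pᵏ). -/
lemma spike_t {u v : Word BSGen} (h : HasCombing p (u ++ v)) {i k : ℕ} {m : ℤ}
    (hu : value p u = aff p i m k) (hm : ¬ (p : ℤ) ∣ m ∨ i = 0) :
    HasCombing p (u ++ [(.t, true), (.t, false)] ++ v) := by
  refine hasCombing_spike h (.t, true) ?_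
  rw [hu, aff_mul_t, size_eq hp (hm.imp_right Or.inl), size_eq hp (hm.imp_right Or.inl), pow_succ]
  have : p ^ k * 1 < p ^ k * p := Nat.mul_lt_mul_of_pos_left (by omega) (by positivity)
  omega

lemma spike_t_inv {u v : Word BSGen} (h : HasCombing p (u ++ v)) {i : ℕ}
    (hu : value p u = aff p i 0 0) :
    HasCombing p (u ++ [(.t, false), (.t, true)] ++ v) := by
  refine hasCombing_spike h (.t, false) ?_
  rw [hu, aff_mul_t_inv, size_eq hp (Or.inr (Or.inr rfl)), size_eq hp (Or.inr (Or.inr rfl))]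
  simp

/-- The end of the new edge has weight (i + 1) + p (j + 1) + 2 and is the heaviest vertex: the
others have expressions with k = 0, first index at most i + 1 and |m| at most p (j + 1). -/
lemma cell_down {u v : Word BSGen} (b : Bool) {i j : ℕ}
    (hu : value p u = aff p i (sgn b * (j + 1)) 0)
    (h : HasCombing p (u ++ ([(.a, !b), (.t, false)] ++ replicate p (.a, b)) ++ v)) :
    HasCombing p (u ++ [(.t, false)] ++ v) := by
  have e1 : aff p i (sgn b * (j + 1)) 0 * letterValue (act p) (.a, !b) = aff p i (sgn b * j) 0 := by
    rw [aff_mul_a, sgn_not]; congr 1; ring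
  have e2 : aff p i (sgn b * j) 0 * letterValue (act p) (.t, false) =
      aff p (i + 1) (sgn b * (p * j)) 0 := by
    rw [aff_mul_t_inv]; congr 1; ring
  have e3 : ∀ s : ℕ, aff p (i + 1) (sgn b * (p * j)) 0 * letterValue (act p) (.a, b) ^ s =
      aff p (i + 1) (sgn b * (p * j + s : ℕ)) 0 := by
    intro s; rw [aff_mul_a_pow]; congr 1; push_cast; ring
  have e4 : aff p i (sgn b * (j + 1)) 0 * letterValue (act p) (.t, false) =
      aff p (i + 1) (sgn b * (p * j + p : ℕ)) 0 := by
    rw [aff_mul_t_inv]; congr 1; push_cast; ring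
  refine CombedDiagram.nonempty_addFace' h (by simp) (.t, false) (relator_down p b) ?_ ?_
  · simp only [hu, wordProd_append, wordProd_cons, wordProd_nil, mul_one, wordProd_replicate]
    rw [← mul_assoc, ← mul_assoc, e1, e2, e3, e4]
  · rw [show wordProd (act p) u = value p u from rfl, hu, e4]
    have hB : size p (aff p (i + 1) (sgn b * (p * j + p : ℕ)) 0) = i + 1 + (p * j + p) + 2 := by
      rw [size_eq hp (Or.inr (Or.inr rfl)), sgn_mul_natAbs]; simp
    rw [hB]
    have hle : ∀ (i' n : ℕ), size p (aff p i' (sgn b * n) 0) ≤ i' + n + 2 := by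
      intro i' n
      have := size_le (p := p) i' (sgn b * n) 0
      rwa [sgn_mul_natAbs, pow_zero, mul_one] at this
    have hj : j ≤ p * j := Nat.le_mul_of_pos_left _ (by omega)
    refine BoundedAlong.append ⟨le_max_left _ _, ?_, ?_⟩ (boundedAlong_replicate ?_)
    · rw [e1]
      exact le_max_of_le_right ((hle i j).trans (by omega))
    · rw [e1, e2]
      have := hle (i + 1) (p * j)
      push_cast at this
      exact le_max_of_le_right (this.trans (by omega))
    · intro s hs
      simp only [wordProd_cons, wordProd_nil, mul_one]
      rw [← mul_assoc, e1, e2, e3]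
      exact le_max_of_le_right ((hle _ _).trans (by omega))

/-- Here the start of the new edge is the heaviest vertex of the cell. -/
lemma cell_up {u v : Word BSGen} (b : Bool) {i j : ℕ}
    (hu : value p u = aff p (i + 1) (sgn b * (p * (j + 1))) 0)
    (h : HasCombing p (u ++ (replicate p (.a, !b) ++ [(.t, true), (.a, b)]) ++ v)) :
    HasCombing p (u ++ [(.t, true)] ++ v) := by
  have e1 : ∀ s : ℕ, s ≤ p → aff p (i + 1) (sgn b * (p * (j + 1))) 0 *
      letterValue (act p) (.a, !b) ^ s = aff p (i + 1) (sgn b * (p * j + (p - s) : ℕ)) 0 := by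
    intro s hs; rw [aff_mul_a_pow, sgn_not]; congr 1; push_cast [hs]; ring
  have e2 : aff p (i + 1) (sgn b * (p * j + (p - p) : ℕ)) 0 * letterValue (act p) (.t, true) =
      aff p i (sgn b * j) 0 := by
    rw [aff_mul_t, ← aff_succ i (sgn b * j)]; congr 1; push_cast; simp; ring
  have e3 : aff p i (sgn b * j) 0 * letterValue (act p) (.a, b) =
      aff p i (sgn b * (j + 1 : ℕ)) 0 := by
    rw [aff_mul_a]; congr 1; push_cast; ring
  have e4 : aff p (i + 1) (sgn b * (p * (j + 1))) 0 * letterValue (act p) (.t, true) =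
      aff p i (sgn b * (j + 1 : ℕ)) 0 := by
    rw [aff_mul_t, ← aff_succ i]; congr 1; push_cast; ring
  refine CombedDiagram.nonempty_addFace' h (by simp) (.t, true) (relator_up p b) ?_ ?_
  · simp only [hu, wordProd_append, wordProd_cons, wordProd_nil, mul_one, wordProd_replicate]
    rw [← mul_assoc, ← mul_assoc, e1 p le_rfl, e2, e3, e4]
  · rw [show wordProd (act p) u = value p u from rfl, hu]
    have hB : size p (aff p (i + 1) (sgn b * (p * (j + 1))) 0) = i + 1 + (p * j + p) + 2 := by
      have := sgn_mul_natAbs b (p * (j + 1))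
      push_cast at this
      rw [size_eq hp (Or.inr (Or.inr rfl)), this]
      ring
    rw [hB]
    have hle : ∀ (i' n : ℕ), size p (aff p i' (sgn b * n) 0) ≤ i' + n + 2 := by
      intro i' n
      have := size_le (p := p) i' (sgn b * n) 0
      rwa [sgn_mul_natAbs, pow_zero, mul_one] at this
    have hj : j ≤ p * j := Nat.le_mul_of_pos_left _ (by omega)
    refine BoundedAlong.append (boundedAlong_replicate ?_) ⟨?_, ?_, ?_⟩
    · intro s hs
      rw [e1 s hs]
      exact le_max_of_le_left ((hle _ _).trans (by omega))
    · rw [wordProd_replicate, e1 p le_rfl]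
      exact le_max_of_le_left ((hle _ _).trans (by omega))
    · rw [wordProd_replicate, e1 p le_rfl, e2]
      exact le_max_of_le_left ((hle _ _).trans (by omega))
    · rw [wordProd_replicate, e1 p le_rfl, e2, e3]
      exact le_max_of_le_left ((hle _ _).trans (by omega))

/-- The p + 1 lower vertices have weight at most i + |m| + pᵏ⁺¹ + 2 pᵏ. The coefficient 2 in `size`
makes this at most the weight i + |m| + 2 pᵏ⁺¹ of the start of the new edge, as 2 pᵏ ≤ pᵏ⁺¹. -/
lemma cell_row {u v : Word BSGen} (b : Bool) {i k : ℕ} {m : ℤ}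
    (hu : value p u = aff p i m (k + 1)) (hm : ¬ (p : ℤ) ∣ m ∨ i = 0)
    (h : HasCombing p (u ++ ([(.t, false)] ++ replicate p (.a, b) ++ [(.t, true)]) ++ v)) :
    HasCombing p (u ++ [(.a, b)] ++ v) := by
  have e1 : aff p i m (k + 1) * letterValue (act p) (.t, false) = aff p i m k :=
    aff_succ_mul_t_inv i m k
  have e2 : ∀ s : ℕ, aff p i m k * letterValue (act p) (.a, b) ^ s =
      aff p i (m + sgn b * (s * p ^ k)) k := fun s => aff_mul_a_pow i m k b s
  have e3 : aff p i (m + sgn b * (p * p ^ k)) k * letterValue (act p) (.t, true) =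
      aff p i (m + sgn b * p ^ (k + 1)) (k + 1) := by
    rw [aff_mul_t]; congr 1; ring
  have e4 : aff p i m (k + 1) * letterValue (act p) (.a, b) =
      aff p i (m + sgn b * p ^ (k + 1)) (k + 1) := aff_mul_a i m (k + 1) b
  refine CombedDiagram.nonempty_addFace' h (by simp) (.a, b) (relator_row p b) ?_ ?_
  · simp only [hu, wordProd_append, wordProd_cons, wordProd_nil, mul_one, wordProd_replicate]
    rw [← mul_assoc, ← mul_assoc, e1, e2, e3, e4]
  · rw [show wordProd (act p) u = value p u from rfl, hu, e4]
    have hB : size p (aff p i m (k + 1)) = i + m.natAbs + 2 * p ^ (k + 1) :=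
      size_eq hp (hm.imp_right Or.inl)
    have hk : 2 * p ^ k ≤ p ^ (k + 1) := by
      rw [pow_succ']; exact Nat.mul_le_mul_right _ hp
    have hle : ∀ s ≤ p, size p (aff p i (m + sgn b * (s * p ^ k)) k) ≤
        i + m.natAbs + 2 * p ^ (k + 1) := by
      intro s hs
      refine (size_le _ _ _).trans ?_
      have h1 := Int.natAbs_add_le m (sgn b * (s * p ^ k : ℕ))
      rw [sgn_mul_natAbs] at h1
      push_cast at h1
      have h2 : s * p ^ k ≤ p ^ (k + 1) := by rw [pow_succ']; exact Nat.mul_le_mul_right _ hs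
      omega
    rw [hB]
    refine BoundedAlong.append (BoundedAlong.append ⟨?_, ?_⟩ (boundedAlong_replicate ?_)) ⟨?_, ?_⟩
    · rw [hB]; exact le_max_left _ _
    · rw [e1]
      have := hle 0 (Nat.zero_le _)
      simp only [Nat.cast_zero, zero_mul, mul_zero, add_zero] at this
      exact le_max_of_le_left this
    · intro s hs
      simp only [wordProd_cons, wordProd_nil, mul_one]
      rw [e1, e2]
      exact le_max_of_le_left (hle s hs)
    · simp only [wordProd_append, wordProd_cons, wordProd_nil, mul_one, wordProd_replicate]
      rw [← mul_assoc, e1, e2]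
      exact le_max_of_le_left (hle p le_rfl)
    · simp only [wordProd_append, wordProd_cons, wordProd_nil, mul_one, wordProd_replicate]
      rw [← mul_assoc, e1, e2, e3]
      exact le_max_right _ _

end BS

namespace BS

open List (replicate)

/-! ### Reduced words -/

/-- The word `aᵐ` for an integer `m`. -/
def aPow (m : ℤ) : Word BSGen := replicate m.natAbs (.a, decide (0 ≤ m))

lemma aPow_zero : aPow 0 = [] := rfl

lemma aPow_add_of_nonneg {b : Bool} {m : ℤ} (h : 0 ≤ sgn b * m) :
    aPow (m + sgn b) = aPow m ++ [(.a, b)] := by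
  cases b with
  | true =>
    simp only [sgn, cond_true, one_mul] at h ⊢
    have h1 : (m + 1).natAbs = m.natAbs + 1 := by omega
    have h2 : 0 ≤ m + 1 := by omega
    simp [aPow, h1, h, h2, List.replicate_succ']
  | false =>
    simp only [sgn, cond_false] at h ⊢
    have h1 : (m + -1).natAbs = m.natAbs + 1 := by omega
    have h2 : ¬ 1 ≤ m := by omega
    rcases eq_or_ne m 0 with rfl | h3
    · rfl
    · have h4 : ¬ 0 ≤ m := by omega
      simp [aPow, h1, h2, h4, List.replicate_succ']

lemma aPow_of_neg {b : Bool} {m : ℤ} (h : sgn b * m < 0) :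
    aPow m = aPow (m + sgn b) ++ [(.a, !b)] := by
  have := aPow_add_of_nonneg (b := !b) (m := m + sgn b) (by
    cases b <;> simp only [sgn, cond_true, cond_false, Bool.not_true, Bool.not_false] at h ⊢ <;>
      omega)
  rwa [sgn_not, add_neg_cancel_right] at this

lemma aPow_sgn_mul (b : Bool) (n : ℕ) : aPow (sgn b * n) = replicate n (.a, b) := by
  induction n with
  | zero => simp [aPow]
  | succ n ih =>
    have : sgn b * ((n + 1 : ℕ) : ℤ) = sgn b * n + sgn b := by push_cast; ring
    rw [this, aPow_add_of_nonneg, ih, List.replicate_succ']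
    rw [← mul_assoc, sgn_mul_sgn]
    positivity

lemma exists_eq_sgn_mul (m : ℤ) : ∃ (b : Bool) (n : ℕ), m = sgn b * n := by
  rcases Int.natAbs_eq m with h | h
  · exact ⟨true, m.natAbs, by simpa [sgn] using h⟩
  · exact ⟨false, m.natAbs, by simpa [sgn] using h⟩

/-- The word `t⁻ⁱ aᵐ tᵏ`. -/
def tail (i : ℕ) (m : ℤ) (k : ℕ) : Word BSGen :=
  replicate i (.t, false) ++ aPow m ++ replicate k (.t, true)

variable {p : ℕ} [NeZero p]

lemma value_append (u v : Word BSGen) : value p (u ++ v) = value p u * value p v :=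
  wordProd_append _ _ _

lemma value_t_inv_pow (i : ℕ) : value p (replicate i (.t, false)) = aff p i 0 0 := by
  induction i with
  | zero => exact aff_zero.symm
  | succ i ih =>
    rw [List.replicate_succ', value_append, ih, value, wordProd_cons, wordProd_nil, mul_one,
      aff_mul_t_inv, mul_zero]

lemma value_append_a {u : Word BSGen} {i k : ℕ} {m : ℤ} (hu : value p u = aff p i m k) (b : Bool)
    (n : ℕ) : value p (u ++ replicate n (.a, b)) = aff p i (m + sgn b * (n * p ^ k)) k := by
  rw [value_append, hu, value, wordProd_replicate, aff_mul_a_pow]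

lemma value_append_aPow {u : Word BSGen} {i : ℕ} (hu : value p u = aff p i 0 0) (m : ℤ) :
    value p (u ++ aPow m) = aff p i m 0 := by
  obtain ⟨b, n, rfl⟩ := exists_eq_sgn_mul m
  rw [aPow_sgn_mul, value_append_a hu]
  simp

lemma value_append_t {u : Word BSGen} {i k : ℕ} {m : ℤ} (hu : value p u = aff p i m k) :
    value p (u ++ [(.t, true)]) = aff p i m (k + 1) := by
  rw [value_append, hu, value, wordProd_cons, wordProd_nil, mul_one, aff_mul_t]

lemma value_append_t_pow {u : Word BSGen} {i k : ℕ} {m : ℤ} (hu : value p u = aff p i m k)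
    (n : ℕ) : value p (u ++ replicate n (.t, true)) = aff p i m (k + n) := by
  induction n with
  | zero => simpa using hu
  | succ n ih =>
    rw [List.replicate_succ', ← List.append_assoc, value_append_t ih, add_assoc]

lemma value_tail (i : ℕ) (m : ℤ) (k : ℕ) : value p (tail i m k) = aff p i m k := by
  rw [tail, value_append_t_pow (value_append_aPow (value_t_inv_pow i) m), zero_add]

variable (hp : 2 ≤ p)

include hp

/-- Away from exponent 0, each step inserts a cancelling pair. Towards 0, the word stays the same
and only the place of the cut moves. -/
lemma hasCombing_shift {u v : Word BSGen} {i : ℕ} (hu : value p u = aff p i 0 0) {m : ℤ} (b : Bool)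
    (n : ℕ) (h : HasCombing p (u ++ aPow m ++ v)) :
    HasCombing p (u ++ aPow (m + sgn b * n) ++ replicate n (.a, !b) ++ v) := by
  induction n with
  | zero => simpa using h
  | succ n ih =>
    have e : m + sgn b * ((n + 1 : ℕ) : ℤ) = m + sgn b * n + sgn b := by push_cast; ring
    rw [e, List.replicate_succ]
    set m' := m + sgn b * n
    rcases le_or_gt 0 (sgn b * m') with hm | hm
    · rw [List.append_assoc] at ih
      have := spike_a hp ih (value_append_aPow hu m') b hm
      rw [aPow_add_of_nonneg hm]
      simpa using this
    · rw [aPow_of_neg hm] at ih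
      simpa using ih

/-- Each step inserts a cancelling pair of letters a in front of t⁻¹ and then uses one cell to
absorb its second letter and a block of p letters behind t⁻¹. -/
lemma hasCombing_down {u v : Word BSGen} {i : ℕ} (hu : value p u = aff p i 0 0) (b : Bool)
    (n j : ℕ)
    (h : HasCombing p (u ++ replicate j (.a, b) ++ [(.t, false)] ++ replicate (p * n) (.a, b) ++ v)) :
    HasCombing p (u ++ replicate (j + n) (.a, b) ++ [(.t, false)] ++ v) := by
  induction n generalizing j with
  | zero => simpa using h
  | succ n ih =>
    have hval := value_append_a hu b j
    have h1 := spike_a hp (u := u ++ replicate j (.a, b))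
      (v := [(.t, false)] ++ replicate (p * (n + 1)) (.a, b) ++ v) (by simpa using h) hval b
      (by rw [zero_add, ← mul_assoc, sgn_mul_sgn]; positivity)
    have hval2 := value_append_a hu b (j + 1)
    have h2 := cell_down hp (u := u ++ replicate (j + 1) (.a, b))
      (v := replicate (p * n) (.a, b) ++ v) b (i := i) (j := j) (by rw [hval2]; simp) (by
        rw [mul_add, mul_one, add_comm (p * n), List.replicate_add] at h1
        simpa [List.replicate_succ', -List.replicate_append_replicate] using h1)
    have h3 := ih (j + 1) (by simpa using h2)
    rwa [show j + (n + 1) = j + 1 + n by ring]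

/-- Each letter a that is moved to the left of t becomes p letters; one cell does this after p
cancelling pairs have been inserted. -/
lemma hasCombing_up {u v : Word BSGen} {i : ℕ} (hu : value p u = aff p (i + 1) 0 0) (b : Bool)
    (n j : ℕ)
    (h : HasCombing p (u ++ replicate (p * j) (.a, b) ++ [(.t, true)] ++ replicate n (.a, b) ++ v)) :
    HasCombing p (u ++ replicate (p * (j + n)) (.a, b) ++ [(.t, true)] ++ v) := by
  induction n generalizing j with
  | zero => simpa using h
  | succ n ih =>
    have e : (sgn b * (p * j : ℕ) : ℤ) + sgn b * p = sgn b * (p * (j + 1) : ℕ) := by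
      push_cast; ring
    have h1 := hasCombing_shift hp (v := [(.t, true)] ++ replicate (n + 1) (.a, b) ++ v) hu b p
      (m := sgn b * (p * j : ℕ)) (by rw [aPow_sgn_mul]; simpa using h)
    rw [e, aPow_sgn_mul] at h1
    have hval := value_append_a hu b (p * (j + 1))
    have h2 := cell_up hp (u := u ++ replicate (p * (j + 1)) (.a, b))
      (v := replicate n (.a, b) ++ v) b (i := i) (j := j) (by rw [hval]; simp)
      (by simpa [List.replicate_succ] using h1)
    have h3 := ih (j + 1) (by simpa using h2)
    rwa [show j + (n + 1) = j + 1 + n by ring]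

/-- The last block of p letters crosses first: insert t t⁻¹ in front of it, then replace t⁻¹ aᵖ t
(or its analogue for a⁻¹) by one letter. -/
lemma hasCombing_row {u v : Word BSGen} {i k : ℕ} {m : ℤ} (hu : value p u = aff p i m k)
    (hm : ¬ (p : ℤ) ∣ m ∨ i = 0) (b : Bool) (c : ℕ)
    (h : HasCombing p (u ++ replicate (p * c) (.a, b) ++ [(.t, true)] ++ v)) :
    HasCombing p (u ++ [(.t, true)] ++ replicate c (.a, b) ++ v) := by
  induction c generalizing v with
  | zero => simpa using h
  | succ c ih =>
    have hval := value_append_a hu b (p * c)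
    -- The exponent changes by a multiple of p, so t still leads to a reduced expression.
    have hm' : ¬ (p : ℤ) ∣ m + sgn b * ((p * c : ℕ) * p ^ k) ∨ i = 0 := by
      refine hm.imp_left fun h h' => h ?_
      rwa [Int.dvd_add_left] at h'
      exact ⟨sgn b * (c * p ^ k), by push_cast; ring⟩
    have h1 := spike_t hp (u := u ++ replicate (p * c) (.a, b))
      (v := replicate p (.a, b) ++ [(.t, true)] ++ v) (by
        rw [mul_add, mul_one, List.replicate_add] at h
        simpa [-List.replicate_append_replicate] using h) hval hm'
    have h2 := cell_row hp (u := u ++ replicate (p * c) (.a, b) ++ [(.t, true)]) (v := v) b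
      (value_append_t hval) hm' (by simpa using h1)
    have h3 := ih (v := [(.a, b)] ++ v) (by simpa using h2)
    simpa [List.replicate_succ'] using h3

/-- One row of cells for each t divides the number of letters a by p. -/
lemma hasCombing_rows {u v : Word BSGen} {i k : ℕ} {m : ℤ} (hu : value p u = aff p i m k)
    (hm : ¬ (p : ℤ) ∣ m ∨ i = 0) (b : Bool) (n : ℕ)
    (h : HasCombing p (u ++ replicate (p ^ n) (.a, b) ++ replicate n (.t, true) ++ v)) :
    HasCombing p (u ++ replicate n (.t, true) ++ [(.a, b)] ++ v) := by
  induction n generalizing u k with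
  | zero => simpa using h
  | succ n ih =>
    have h1 := hasCombing_row hp hu hm b (p ^ n) (v := replicate n (.t, true) ++ v) (by
      rw [pow_succ'] at h
      simpa [List.replicate_succ] using h)
    have h2 := ih (value_append_t hu) (by simpa using h1)
    simpa [List.replicate_succ] using h2

/-- The reduced word of a combed diagram can be multiplied by any letter. -/
lemma hasCombing_step {i k : ℕ} {m : ℤ} (hr : Reduced p i m k) {v : Word BSGen}
    (h : HasCombing p (tail i m k ++ v)) (x : BSGen × Bool) :
    ∃ (i' k' : ℕ) (m' : ℤ), Reduced p i' m' k' ∧ HasCombing p (tail i' m' k' ++ x :: v) := by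
  have hti : value p (replicate i (.t, false)) = aff p i 0 0 := value_t_inv_pow i
  obtain ⟨g, b⟩ := x
  cases g with
  | a =>
    cases k with
    | zero =>
      refine ⟨i, 0, m + sgn (!b), Or.inr (Or.inr rfl), ?_⟩
      have h1 := hasCombing_shift hp (v := v) hti (!b) 1 (m := m) (by simpa [tail] using h)
      simpa [tail] using h1
    | succ k =>
      have hm : ¬ (p : ℤ) ∣ m ∨ i = 0 := hr.imp_right fun h => h.resolve_right (by omega)
      -- The letter `x` behind tᵏ⁺¹ equals p^(k+1) such letters in front of it. These are split off
      -- the power of a and carried across by rows of cells.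
      have h1 := hasCombing_shift hp (v := replicate (k + 1) (.t, true) ++ v) hti (!b) (p ^ (k + 1))
        (m := m) (by simpa [tail] using h)
      rw [Bool.not_not] at h1
      set m' := m + sgn (!b) * (p ^ (k + 1) : ℕ) with hm'
      have hdvd : ¬ (p : ℤ) ∣ m' ∨ i = 0 := by
        refine hm.imp_left fun h h' => h ?_
        rwa [hm', Int.dvd_add_left] at h'
        exact ⟨sgn (!b) * p ^ k, by push_cast; ring⟩
      refine ⟨i, k + 1, m', hdvd.imp_right Or.inl, ?_⟩
      have h2 := hasCombing_rows hp (v := v) (value_append_aPow hti m') hdvd b (k + 1)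
        (by simpa using h1)
      simpa [tail] using h2
  | t =>
    cases b with
    | true =>
      cases k with
      | zero =>
        obtain ⟨b, n, rfl⟩ := exists_eq_sgn_mul m
        refine ⟨i + 1, 0, sgn b * (p * n : ℕ), Or.inr (Or.inr rfl), ?_⟩
        -- There is no t to split off, so t⁻¹ t is inserted in front of the power of a, which then
        -- crosses that t.
        have h1 := spike_t_inv hp (u := replicate i (.t, false)) (v := replicate n (.a, b) ++ v)
          (by simpa [tail, aPow_sgn_mul] using h) hti
        have h2 := hasCombing_up hp (v := v) (value_t_inv_pow (i + 1)) b n 0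
          (by simpa [List.replicate_succ'] using h1)
        rw [tail, aPow_sgn_mul]
        simpa using h2
      | succ k =>
        refine ⟨i, k, m, hr.imp_right fun h => Or.inl (h.resolve_right (by omega)), ?_⟩
        -- The word is unchanged: its last t is read as `x`.
        simpa [tail, List.replicate_succ'] using h
    | false =>
      by_cases hm : ¬ (p : ℤ) ∣ m ∨ i = 0
      · refine ⟨i, k + 1, m, hm.imp_right Or.inl, ?_⟩
        have h1 := spike_t hp h (value_tail i m k) hm
        simpa [tail, List.replicate_succ'] using h1
      -- A further t would give an expression that is not reduced. Reducedness forces k = 0, and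
      -- instead the last t⁻¹ of the prefix is moved behind the power of a.
      · push Not at hm
        obtain ⟨⟨m, rfl⟩, hi⟩ := hm
        obtain ⟨i, rfl⟩ := Nat.exists_eq_succ_of_ne_zero hi
        obtain rfl : k = 0 := by
          rcases hr with h | h | h
          · exact absurd (dvd_mul_right _ _) h
          · exact absurd h hi
          · exact h
        obtain ⟨b, n, rfl⟩ := exists_eq_sgn_mul m
        refine ⟨i, 0, sgn b * n, Or.inr (Or.inr rfl), ?_⟩
        rw [show (p : ℤ) * (sgn b * n) = sgn b * (p * n : ℕ) by push_cast; ring, tail,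
          aPow_sgn_mul] at h
        have h1 := hasCombing_down hp (v := v) (value_t_inv_pow i) b n 0
          (by simpa [List.replicate_succ'] using h)
        rw [tail, aPow_sgn_mul]
        simpa using h1

lemma exists_hasCombing (w : Word BSGen) :
    ∃ (i k : ℕ) (m : ℤ), Reduced p i m k ∧ HasCombing p (tail i m k ++ w) := by
  induction w with
  | nil =>
    refine ⟨0, 0, 0, Or.inr (Or.inr rfl), CombedDiagram.nonempty_nil ?_⟩
    rw [← aff_zero (p := p), size_eq hp (Or.inr (Or.inr rfl))]
    simp
  | cons x w ih =>
    obtain ⟨i, k, m, hr, h⟩ := ih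
    exact hasCombing_step hp hr h x

/-- The whole boundary word has value 1, hence so has the reduced prefix; the only reduced word with
value 1 is empty. -/
lemma hasCombing_of_value_eq_one {w : Word BSGen} (hw : value p w = 1) : HasCombing p w := by
  obtain ⟨i, k, m, hr, h⟩ := exists_hasCombing hp w
  obtain ⟨K⟩ := id h
  have h1 := K.wordProd_eq_one
  rw [wordProd_append, show wordProd (act p) w = 1 from hw, mul_one,
    show wordProd (act p) (tail i m k) = _ from value_tail i m k, ← aff_zero (p := p)] at h1
  obtain ⟨h2, h3⟩ := eq_of_aff_eq hp h1
  obtain rfl : m = 0 := by simpa using h3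
  obtain rfl : i = 0 := by
    rcases hr with hr | hr | hr
    · simp at hr
    · exact hr
    · omega
  obtain rfl : k = 0 := by omega
  simpa [tail, aPow_zero] using h

omit hp in
-- It is enough that the action respects the relator; its faithfulness is not needed beforehand.
lemma value_eq_one {w : Word BSGen} (hw : wordValue (bsRelators p) w = 1) : value p w = 1 := by
  have h : ∀ r ∈ FreeGroup.mk '' bsRelators p, FreeGroup.lift (act p) r = 1 := by
    rintro _ ⟨r, rfl, rfl⟩
    rw [bsRelator_eq]
    ext x
    have := cast_ne p
    have hpow : ∀ (n : ℕ) (y : ℚ), (act p .a ^ n) y = y + n := by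
      intro n
      induction n with
      | zero => simp
      | succ n ih =>
        intro y
        rw [pow_succ', Equiv.Perm.mul_apply, ih]
        simp [act, add_assoc]
    have hinv : (act p .a ^ p)⁻¹ x = x - p := by
      rw [Equiv.Perm.inv_eq_iff_eq, hpow]; ring
    simp only [map_mul, map_inv, map_pow, FreeGroup.lift_apply_of, Equiv.Perm.mul_apply, hinv]
    have hinv' : ∀ y, (act p .t)⁻¹ y = y / p := by
      intro y
      rw [Equiv.Perm.inv_eq_iff_eq]
      simp only [act, Equiv.mulLeft₀_apply]
      field_simp
    rw [hinv']
    simp only [act, Equiv.coe_addRight, Equiv.mulLeft₀_apply, Equiv.Perm.coe_one, id_eq]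
    field_simp
    ring
  have h2 := congrArg (PresentedGroup.toGroup h) hw
  rw [map_one] at h2
  rw [value, wordProd_eq_lift]
  exact h2

end BS

end TameFilling

end

/-! ### The exponential filling function -/

theorem mainTheorem10 (p : ℕ) (hp : 3 ≤ p) :
    ∃ f : TameFilling.QuarterNat → TameFilling.QuarterNat,
      TameFilling.IsIntrinsicTameFillingFunction (TameFilling.bsRelators p) f ∧
      TameFilling.LipschitzEquivalent (fun n => (f n : ℝ)) (fun n => (p : ℝ) ^ (n : ℝ)) := by
  have : NeZero p := ⟨by omega⟩
  have hp2 : 2 ≤ p := by omega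
  have hp1 : (1 : ℝ) ≤ p := by exact_mod_cast (by omega : 1 ≤ p)
  -- The exponent is the one of `size_wordProd_le` at length ⌈x⌉ + 1, the shift of
  -- `weight_le_of_coarseDist`. The constant 8 works because 3 (⌈x⌉ + 1) + 2 < 3 x + 8 ≤ 8 x + 8.
  refine ⟨fun x => ⟨((p ^ (3 * (⌈x.1⌉₊ + 1) + 2) : ℕ) : ℝ), 4 * p ^ (3 * (⌈x.1⌉₊ + 1) + 2), by
    push_cast; ring⟩, ⟨?_, ?_⟩, 8, ?_⟩
  · intro x y hxy
    have h : ⌈x.1⌉₊ ≤ ⌈y.1⌉₊ := Nat.ceil_mono hxy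
    have h2 : p ^ (3 * (⌈x.1⌉₊ + 1) + 2) ≤ p ^ (3 * (⌈y.1⌉₊ + 1) + 2) :=
      Nat.pow_le_pow_right (by omega) (by omega)
    exact Subtype.mk_le_mk.mpr (by exact_mod_cast h2)
  · intro w hw
    obtain ⟨K⟩ := TameFilling.BS.hasCombing_of_value_eq_one hp2 (TameFilling.BS.value_eq_one hw)
    refine K.exists_tame (ψ := fun n => p ^ (3 * n + 2)) ?_
      (TameFilling.BS.size_wordProd_le hp2) (fun x => le_rfl)
    intro m n hmn
    exact Nat.pow_le_pow_right (by omega) (by omega)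
  · rintro ⟨_, n, rfl⟩
    have hx0 : (0 : ℝ) ≤ n / 4 := by positivity
    simp only [TameFilling.QuarterNat.affine]
    push_cast
    set x : ℝ := n / 4 with hx
    have hpos : ∀ y : ℝ, 0 < (p : ℝ) ^ y := fun y => Real.rpow_pos_of_pos (by linarith) y
    have hc := Nat.ceil_lt_add_one hx0
    have hc2 := Nat.le_ceil (8 * x + 8)
    constructor
    · have h : (p : ℝ) ^ (3 * (⌈x⌉₊ + 1) + 2) ≤ (p : ℝ) ^ (8 * x + 8) := by
        rw [← Real.rpow_natCast]
        refine Real.rpow_le_rpow_of_exponent_le hp1 ?_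
        push_cast
        linarith
      linarith [hpos (8 * x + 8)]
    · have h : (p : ℝ) ^ x ≤ (p : ℝ) ^ (3 * (⌈8 * x + 8⌉₊ + 1) + 2) := by
        rw [← Real.rpow_natCast]
        refine Real.rpow_le_rpow_of_exponent_le hp1 ?_
        push_cast
        linarith
      linarith [hpos x]
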